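/- For $f:\mathbb{N}\to\mathbb{C}$, $x\ge 2$, $q\ge 1$ and $(a,q)=1$ put $$\Delta(f,x;q,a):=\sum_{\substack{n\le x\\ n\equiv a \,(\mathrm{mod}\, q)}} f(n)-\frac1{\varphi(q)}\sum_{\substack{n\le x\\ (n,q)=1}} f(n).$$ The \emph{Bombieri--Vinogradov Hypothesis} holds for $f$ if for every $A>0$ there is a constant $B=B(A)$ such that $$\sum_{q\le \sqrt{x}/(\log x)^B}\ \max_{a:\,(a,q)=1}|\Delta(f,x;q,a)|\ll_A \frac{x}{(\log x)^A}\qquad\text{for all } x\ge 2.$$ The \emph{Siegel--Walfisz criterion} holds for $f$ if for every $A>0$ we have $|\Delta(f,x;q,a)|\ll_A x/(\log x)^A$ for all $x\ge 2$, all $q\ge1$ and all $a$ with $(a,q)=1$. (The implied constants may depend on $f$ and $A$, but not on $x$, $q$ or $a$.) Let $\mathcal{C}$ be the class of multiplicative functions $f:\mathbb{N}\to\mathbb{C}$ whose Dirichlet series $F(s)=\sum_{n\ge1}f(n)n^{-s}$ converges absolutely for $\mathrm{Re}(s)>1$ and for which $-F'(s)/F(s)=\sum_{n\ge 2}\Lambda_f(n)n^{-s}$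 for $\mathrm{Re}(s)>1$, with coefficients satisfying $|\Lambda_f(n)|\le\Lambda(n)$ for all $n\ge1$, where $\Lambda$ is the von Mangoldt function. Let $1_{\mathcal P}$ be the indicator function of the set $\mathcal P$ of primes. \textbf{Theorem.} Let $f,g\in\mathcal{C}$ have Dirichlet series $F,G$ with $F(s)G(s)=1$ for $\mathrm{Re}(s)>1$ (that is, $g$ is the Dirichlet inverse of $f$). (a) If the Bombieri--Vinogradov Hypothesis holds for both $f$ and $g$, then it holds for $f\cdot 1_{\mathcal P}$. (b) If the Bombieri--Vinogradov Hypothesis holds for $f\cdot 1_{\mathcal P}$ and the Siegel--Walfisz criterion holds for $f$, then the Bombieri--Vinogradov Hypothesis holds for $f$. Moreover, the Bombieri--Vinogradov Hypothesis holds for both $f$ and $g$ if and only if the Bombieri--Vinogradov Hypothesis holds for $f\cdot 1_{\mathcal P}$ and the Siegel--Walfisz criterion holds for both $f$ and $g$. -/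

import Mathlib

noncomputable section

/-- `Δ(f, x; q, a)`: the discrepancy of `f` up to `x` in the residue class `a` modulo `q`,
`∑_{n ≤ x, n ≡ a (q)} f(n) - (1/φ(q)) ∑_{n ≤ x, (n,q) = 1} f(n)`. -/
def discrepancy (f : ℕ → ℂ) (x : ℝ) (q : ℕ) (a : ZMod q) : ℂ :=
  (∑ n ∈ (Finset.Icc 1 ⌊x⌋₊).filter (fun n : ℕ => (n : ZMod q) = a), f n)
    - (1 / (Nat.totient q : ℂ)) *
        ∑ n ∈ (Finset.Icc 1 ⌊x⌋₊).filter (fun n : ℕ => Nat.Coprime n q), f n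

/-- The Bombieri–Vinogradov Hypothesis for `f`: for every `A > 0` there is `B` with
`∑_{q ≤ √x/(log x)^B} max_{(a,q)=1} |Δ(f,x;q,a)| ≪_A x/(log x)^A` for all `x ≥ 2`.
The supremum runs over the finite nonempty group of residue classes coprime to `q ≥ 1`,
so that it is a maximum. -/
def BombieriVinogradovHypothesis (f : ℕ → ℂ) : Prop :=
  ∀ A : ℝ, 0 < A → ∃ B C : ℝ, ∀ x : ℝ, 2 ≤ x →
    ∑ q ∈ Finset.Icc 1 ⌊√x / (Real.log x) ^ B⌋₊,
      (⨆ a : (ZMod q)ˣ, ‖discrepancy f x q (a : ZMod q)‖) ≤ C * (x / (Real.log x) ^ A)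

/-- The Siegel–Walfisz criterion for `f`: for every `A > 0`,
`|Δ(f,x;q,a)| ≪_A x/(log x)^A` for all `x ≥ 2`, `q ≥ 1` and all `a` coprime to `q`,
the implied constant depending on `A` (and `f`) only. -/
def SiegelWalfiszCriterion (f : ℕ → ℂ) : Prop :=
  ∀ A : ℝ, 0 < A → ∃ C : ℝ, ∀ x : ℝ, 2 ≤ x → ∀ q : ℕ, 1 ≤ q → ∀ a : (ZMod q)ˣ,
    ‖discrepancy f x q (a : ZMod q)‖ ≤ C * (x / (Real.log x) ^ A)

/-- The class `𝒞` of multiplicative functions `f`, with Dirichlet series `F(s)` in `Re s > 1`,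
such that `-F'(s)/F(s) = ∑ Λ_f(n) n^{-s}` for `Re s > 1` with coefficients
`|Λ_f(n)| ≤ Λ(n)` for all `n`. -/
structure IsClassC (f : ArithmeticFunction ℂ) : Prop where
  isMultiplicative : f.IsMultiplicative
  summable : ∀ s : ℂ, 1 < s.re → LSeriesSummable f s
  exists_vonMangoldt : ∃ Λf : ℕ → ℂ,
    (∀ s : ℂ, 1 < s.re → LSeriesHasSum Λf s (-deriv (LSeries f) s / LSeries f s)) ∧
    ∀ n : ℕ, ‖Λf n‖ ≤ ArithmeticFunction.vonMangoldt n

/-- `f · 1_𝒫`: the function `f` restricted to the primes. -/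
def restrictPrimes (f : ℕ → ℂ) : ℕ → ℂ :=
  Set.indicator {p : ℕ | p.Prime} f

end

/-! Write `L` for the coefficients of -F'/F. Multiplying -F'/F by F gives `L * f = mulLog f`, that
is, L * f = f·log as a Dirichlet convolution; since f * g = 1, also L = (f·log) * g. The bound |L| ≤
Λ forces |f| ≤ 1 by induction on n (`norm_le_one_of_mul_eq_mulLog`). Moreover L(p) = f(p) log p, and
proper prime powers contribute only O(√x log x), so up to partial summation a bound for f·1_𝒫 is the
same as a bound for L.

The engine is `BVUniform.dirichletConv`: if u and v satisfy Bombieri–Vinogradov bounds and their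
sums against characters of small modulus are small, then u * v satisfies such a bound, with a loss
of only (log x)^(1/2). To see this, cut both variables at a power (log x)^K. If one variable lies
below the cut, apply the bound for the other function at length x/a; the sum of |u(a)|/a over these
a is a power of log log x. If both lie above the cut, pass to primitive characters. Conductors
beyond a power of log x are handled by the large sieve in bilinear form (`sum_large_conductor_le`).
Smaller conductors are handled by the hyperbola method and the character sum hypothesis
(`norm_sum_dirichletConv_truncateBelow_le`).

For (a), apply the engine to (f·log) * g. Its character sum hypotheses come from the Siegel–Walfisz
criterion, which for bounded functions follows from the Bombieri–Vinogradov Hypothesis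
(`BombieriVinogradovHypothesis.siegelWalfisz`) and extends to sums over integers coprime to m by
sieving with the Dirichlet inverse (`SiegelWalfiszCriterion.characterSumBound`).

For (b), apply the engine to L * f = f·log and bootstrap. A saving of (log x)^A for f gives (log
x)^(A - 1/2) for f·log, and removing the factor log gives (log x)^(A + 1/2) for f. Starting from the
trivial exponent -3, every exponent is reached. In the equivalence, (b) is applied also to g,
because g(p) = -f(p). -/

open Finset Filter

noncomputable section

/-! ### The additive large sieve. -/

/-- The additive character `t ↦ exp (2πit)` of `ℝ`. -/
def expTwoPi (t : ℝ) : ℂ := Complex.exp (2 * Real.pi * t * Complex.I)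

lemma expTwoPi_add (s t : ℝ) : expTwoPi (s + t) = expTwoPi s * expTwoPi t := by
  rw [expTwoPi, expTwoPi, expTwoPi, ← Complex.exp_add]
  congr 1; push_cast; ring

lemma expTwoPi_zero : expTwoPi 0 = 1 := by simp [expTwoPi]

lemma norm_expTwoPi (t : ℝ) : ‖expTwoPi t‖ = 1 := by
  have := Complex.norm_exp_ofReal_mul_I (2 * Real.pi * t)
  push_cast at this
  exact this

lemma expTwoPi_neg (t : ℝ) : expTwoPi (-t) = (starRingEnd ℂ) (expTwoPi t) := by
  rw [expTwoPi, expTwoPi, ← Complex.exp_conj]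
  congr 1
  rw [show (2 * Real.pi * t * Complex.I : ℂ) = ((2 * Real.pi * t : ℝ) : ℂ) * Complex.I by
    push_cast; rfl, map_mul, Complex.conj_ofReal, Complex.conj_I]
  push_cast; ring

lemma expTwoPi_intCast (n : ℤ) : expTwoPi n = 1 := by
  rw [expTwoPi, ← Complex.exp_int_mul_two_pi_mul_I n]
  congr 1; push_cast; ring

lemma expTwoPi_natCast_mul (n : ℕ) (t : ℝ) : expTwoPi (n * t) = expTwoPi t ^ n := by
  rw [expTwoPi, expTwoPi, ← Complex.exp_nat_mul]
  congr 1; push_cast; ring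

lemma expTwoPi_sub_round (t : ℝ) : expTwoPi (t - round t) = expTwoPi t := by
  conv_rhs => rw [show t = (t - round t) + (round t : ℤ) by ring, expTwoPi_add,
    expTwoPi_intCast, mul_one]

lemma norm_expTwoPi_sub_one_ge (t : ℝ) : 4 * |t - round t| ≤ ‖expTwoPi t - 1‖ := by
  set s := t - round t with hs
  have h1 : ‖expTwoPi t - 1‖ = 2 * |Real.sin (Real.pi * s)| := by
    rw [← expTwoPi_sub_round, ← hs]
    have := Complex.norm_exp_I_mul_ofReal_sub_one (2 * Real.pi * s)
    rw [show (2 * Real.pi * s) / 2 = Real.pi * s by ring] at this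
    rw [expTwoPi, show (2 * Real.pi * s * Complex.I : ℂ)
      = Complex.I * ((2 * Real.pi * s : ℝ) : ℂ) by push_cast; ring, this]
    simp
  have h2 : |s| ≤ 1 / 2 := abs_sub_round t
  have h3 := Real.mul_abs_le_abs_sin (x := Real.pi * s) (by
    rw [abs_mul, abs_of_pos Real.pi_pos]
    nlinarith [Real.pi_pos])
  rw [abs_mul, abs_of_pos Real.pi_pos, ← mul_assoc, div_mul_cancel₀ _ Real.pi_ne_zero] at h3
  rw [h1]; linarith

/-- The geometric sum identity. The product form stays valid when `t` is an integer, where the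
distance to the nearest integer is zero. -/
lemma norm_sum_expTwoPi_mul_le (n : ℕ) (t : ℝ) :
    ‖∑ i ∈ range n, expTwoPi (i * t)‖ * (2 * |t - round t|) ≤ 1 := by
  have h1 : (∑ i ∈ range n, expTwoPi (i * t)) * (expTwoPi t - 1) = expTwoPi t ^ n - 1 := by
    simp_rw [expTwoPi_natCast_mul]
    exact geom_sum_mul _ _
  have h2 : ‖expTwoPi t ^ n - 1‖ ≤ 2 := by
    refine (norm_sub_le _ _).trans ?_
    rw [norm_pow, norm_expTwoPi]; norm_num
  have h3 := congrArg norm h1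
  rw [norm_mul] at h3
  have h4 := norm_expTwoPi_sub_one_ge t
  nlinarith [norm_nonneg (∑ i ∈ range n, expTwoPi (i * t))]

lemma norm_sum_expTwoPi_le (n : ℕ) (t : ℝ) : ‖∑ i ∈ range n, expTwoPi (i * t)‖ ≤ n := by
  refine (norm_sum_le _ _).trans ?_
  simp [norm_expTwoPi]

/-- The constant `∑_{j ≠ 0} 1/j²`, summed over the integers. -/
def sumInvSq : ℝ := ∑' j : ℤ, 1 / (j : ℝ) ^ 2

lemma sumInvSq_nonneg : 0 ≤ sumInvSq := tsum_nonneg fun j => by positivity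

lemma sum_inv_sq_le {ι : Type*} (s : Finset ι) (j : ι → ℤ) (hj : Set.InjOn j s) :
    ∑ l ∈ s, 1 / (j l : ℝ) ^ 2 ≤ sumInvSq := by
  rw [← Finset.sum_image (f := fun z : ℤ => 1 / (z : ℝ) ^ 2) hj]
  exact Summable.sum_le_tsum _ (fun z _ => by positivity)
    (Real.summable_one_div_int_pow.mpr (by norm_num))

lemma sum_norm_sq_dirichletKernel_le {ι : Type*} (K : Finset ι) (x : ι → ℝ) {δ : ℝ}
    (hδ : 0 < δ)
    (hsep : ∀ k ∈ K, ∀ l ∈ K, k ≠ l → ∀ z : ℤ, δ ≤ |x k - x l - z|) (n : ℕ) {k : ι}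
    (hk : k ∈ K) :
    ∑ l ∈ K, ‖∑ i ∈ range n, expTwoPi (i * (x k - x l))‖ ^ 2 ≤ n ^ 2 + sumInvSq / δ ^ 2 := by
  classical
  rw [← Finset.add_sum_erase _ _ hk]
  refine add_le_add ?_ ?_
  · gcongr
    exact norm_sum_expTwoPi_le _ _
  set s : ι → ℝ := fun l => (x k - x l) - round (x k - x l) with hs
  -- The integers `j l` index the cells of width δ that contain the `s l`. Separation makes them
  -- distinct, and |s l| ≥ δ makes them nonzero with |j l|·δ ≤ 2|s l|, so the squared kernels are
  -- dominated by a sum of distinct inverse squares.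
  set j : ι → ℤ := fun l => ⌊s l / δ⌋ with hj
  have hinj : Set.InjOn j (K.erase k) := by
    intro l hl l' hl' h
    by_contra hne
    have h1 := Int.abs_sub_lt_one_of_floor_eq_floor h
    have h2 := hsep l' (mem_of_mem_erase hl') l (mem_of_mem_erase hl) (Ne.symm hne)
      (round (x k - x l) - round (x k - x l'))
    have h3 : x l' - x l - ((round (x k - x l) - round (x k - x l') : ℤ) : ℝ) = s l - s l' := by
      simp only [hs]; push_cast; ring
    rw [h3] at h2
    rw [← sub_div, abs_div, abs_of_pos hδ, div_lt_one hδ] at h1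
    linarith
  calc ∑ l ∈ K.erase k, ‖∑ i ∈ range n, expTwoPi (i * (x k - x l))‖ ^ 2
      ≤ ∑ l ∈ K.erase k, (1 / (j l : ℝ) ^ 2) / δ ^ 2 := by
        refine sum_le_sum fun l hl => ?_
        have hs1 : δ ≤ |s l| := hsep k hk l (mem_of_mem_erase hl) (ne_of_mem_erase hl).symm _
        have hfl : (j l : ℝ) ≤ s l / δ := Int.floor_le _
        have hfl' : s l / δ < j l + 1 := Int.lt_floor_add_one _
        have hj2 : |(j l : ℝ)| * δ ≤ 2 * |s l| ∧ (j l : ℝ) ≠ 0 := by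
          rw [le_div_iff₀ hδ] at hfl
          rw [div_lt_iff₀ hδ] at hfl'
          rcases le_or_gt 0 (s l) with h0 | h0
          · rw [abs_of_nonneg h0] at hs1 ⊢
            have : 0 < j l := by
              rw [hj, Int.floor_pos, le_div_iff₀ hδ]; linarith
            have hp : (0 : ℝ) < j l := by exact_mod_cast this
            rw [abs_of_pos hp]
            exact ⟨by linarith, hp.ne'⟩
          · rw [abs_of_neg h0] at hs1 ⊢
            have : (j l : ℝ) * δ < 0 := by linarith
            have hn : (j l : ℝ) < 0 := by
              by_contra hcon
              push Not at hcon
              nlinarith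
            rw [abs_of_neg hn]
            exact ⟨by linarith, hn.ne⟩
        have h1 := norm_sum_expTwoPi_mul_le n (x k - x l)
        change _ * (2 * |s l|) ≤ 1 at h1
        have hjp : 0 < |(j l : ℝ)| := abs_pos.mpr hj2.2
        have h2 : ‖∑ i ∈ range n, expTwoPi (i * (x k - x l))‖ ≤ 1 / (|(j l : ℝ)| * δ) := by
          rw [le_div_iff₀ (by positivity)]
          refine le_trans ?_ h1
          exact mul_le_mul_of_nonneg_left hj2.1 (norm_nonneg _)
        calc _ ≤ (1 / (|(j l : ℝ)| * δ)) ^ 2 := by gcongr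
          _ = _ := by rw [div_pow, mul_pow, sq_abs, div_div, one_pow]
    _ = (∑ l ∈ K.erase k, (1 / (j l : ℝ) ^ 2)) / δ ^ 2 := by rw [Finset.sum_div]
    _ ≤ _ := by
        gcongr
        exact sum_inv_sq_le _ _ hinj

lemma sum_sum_norm_sq_expTwoPi {ι : Type*} (K : Finset ι) (x : ι → ℝ) (c : ι → ℂ) (n : ℕ) :
    ∑ i ∈ range n, ∑ j ∈ range n, ((‖∑ k ∈ K, c k * expTwoPi ((i - j : ℝ) * x k)‖ ^ 2 : ℝ) : ℂ)
      = ∑ k ∈ K, ∑ l ∈ K, c k * (starRingEnd ℂ) (c l) *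
        ((‖∑ i ∈ range n, expTwoPi (i * (x k - x l))‖ ^ 2 : ℝ) : ℂ) := by
  have key : ∀ i j : ℕ, ((‖∑ k ∈ K, c k * expTwoPi ((i - j : ℝ) * x k)‖ ^ 2 : ℝ) : ℂ)
      = ∑ k ∈ K, ∑ l ∈ K, c k * (starRingEnd ℂ) (c l) *
        (expTwoPi (i * (x k - x l)) * (starRingEnd ℂ) (expTwoPi (j * (x k - x l)))) := by
    intro i j
    rw [Complex.ofReal_pow, ← Complex.mul_conj', map_sum, Finset.sum_mul_sum]
    refine sum_congr rfl fun k _ => sum_congr rfl fun l _ => ?_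
    rw [map_mul, ← expTwoPi_neg, ← expTwoPi_neg, ← expTwoPi_add, mul_mul_mul_comm, ← expTwoPi_add]
    congr 2; ring
  simp_rw [key]
  have : ∀ k l, ((‖∑ i ∈ range n, expTwoPi (i * (x k - x l))‖ ^ 2 : ℝ) : ℂ) =
      ∑ i ∈ range n, ∑ j ∈ range n,
        (expTwoPi (i * (x k - x l)) * (starRingEnd ℂ) (expTwoPi (j * (x k - x l)))) := by
    intro k l
    rw [Complex.ofReal_pow, ← Complex.mul_conj', map_sum, Finset.sum_mul_sum]
  simp_rw [this, Finset.mul_sum]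
  rw [Finset.sum_congr rfl fun i _ => Finset.sum_comm]
  rw [Finset.sum_comm]
  refine sum_congr rfl fun k _ => ?_
  rw [Finset.sum_congr rfl fun i _ => Finset.sum_comm]
  rw [Finset.sum_comm]

/-- Schur's test: |c k||c l| ≤ (|c k|² + |c l|²)/2, and symmetry of `d` makes the two halves equal.
-/
lemma sum_sum_mul_norm_le {ι : Type*} (K : Finset ι) (c : ι → ℂ) (d : ι → ι → ℝ)
    (hd0 : ∀ k l, 0 ≤ d k l) (hd : ∀ k l, d k l = d l k) {D : ℝ}
    (hD : ∀ k ∈ K, ∑ l ∈ K, d k l ≤ D) :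
    ‖∑ k ∈ K, ∑ l ∈ K, c k * (starRingEnd ℂ) (c l) * (d k l : ℂ)‖ ≤ D * ∑ k ∈ K, ‖c k‖ ^ 2 := by
  have h1 : ‖∑ k ∈ K, ∑ l ∈ K, c k * (starRingEnd ℂ) (c l) * (d k l : ℂ)‖
      ≤ ∑ k ∈ K, ∑ l ∈ K, (‖c k‖ ^ 2 / 2 * d k l + ‖c l‖ ^ 2 / 2 * d k l) := by
    refine (norm_sum_le _ _).trans (sum_le_sum fun k _ => (norm_sum_le _ _).trans
      (sum_le_sum fun l _ => ?_))
    rw [norm_mul, norm_mul, RCLike.norm_conj, Complex.norm_real, Real.norm_of_nonneg (hd0 k l),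
      ← add_mul]
    refine mul_le_mul_of_nonneg_right ?_ (hd0 k l)
    nlinarith [sq_nonneg (‖c k‖ - ‖c l‖)]
  refine h1.trans ?_
  simp_rw [Finset.sum_add_distrib]
  have h2 : ∑ k ∈ K, ∑ l ∈ K, ‖c l‖ ^ 2 / 2 * d k l = ∑ k ∈ K, ∑ l ∈ K, ‖c k‖ ^ 2 / 2 * d k l := by
    rw [Finset.sum_comm]
    exact sum_congr rfl fun k _ => sum_congr rfl fun l _ => by rw [hd]
  rw [h2, ← two_mul, Finset.mul_sum, Finset.mul_sum]
  refine sum_le_sum fun k hk => ?_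
  rw [← Finset.mul_sum]
  nlinarith [hD k hk, sq_nonneg ‖c k‖]

/-- The dual form of the large sieve inequality. -/
lemma sum_norm_sq_expTwoPi_dual_le {ι : Type*} (K : Finset ι) (x : ι → ℝ) {δ : ℝ} (hδ : 0 < δ)
    (hsep : ∀ k ∈ K, ∀ l ∈ K, k ≠ l → ∀ z : ℤ, δ ≤ |x k - x l - z|) (c : ι → ℂ) {N : ℕ}
    (hN : 1 / δ ≤ N) :
    ∑ n ∈ range N, ‖∑ k ∈ K, c k * expTwoPi (n * x k)‖ ^ 2
      ≤ (4 + sumInvSq) * N * ∑ k ∈ K, ‖c k‖ ^ 2 := by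
  have hN0 : (0 : ℝ) < N := lt_of_lt_of_le (by positivity) hN
  set P : ℕ → ℕ → ℝ := fun i j => ‖∑ k ∈ K, c k * expTwoPi ((i - j : ℝ) * x k)‖ ^ 2 with hP
  -- Each n < N is a difference i - j of at least N pairs i, j < 2N. Averaging over such pairs
  -- replaces the Dirichlet kernel by its square, which is summable over separated points without a
  -- logarithmic loss.
  have h1 : N * ∑ n ∈ range N, ‖∑ k ∈ K, c k * expTwoPi (n * x k)‖ ^ 2
      ≤ ∑ j ∈ range (2 * N), ∑ i ∈ range (2 * N), P i j := by
    have h2 : N * ∑ n ∈ range N, ‖∑ k ∈ K, c k * expTwoPi (n * x k)‖ ^ 2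
        = ∑ j ∈ range N, ∑ i ∈ Ico j (j + N), P i j := by
      rw [← nsmul_eq_mul, ← Finset.card_range N, ← Finset.sum_const, Finset.card_range]
      refine sum_congr rfl fun j _ => ?_
      rw [Finset.sum_Ico_eq_sum_range, Nat.add_sub_cancel_left]
      refine sum_congr rfl fun n _ => ?_
      simp [hP]
    rw [h2]
    calc _ ≤ ∑ j ∈ range N, ∑ i ∈ range (2 * N), P i j := by
          refine sum_le_sum fun j hj => sum_le_sum_of_subset_of_nonneg ?_ ?_
          · intro i hi
            simp only [mem_Ico, mem_range] at *; omega
          · intros; positivity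
      _ ≤ _ := by
          refine sum_le_sum_of_subset_of_nonneg (range_mono (by omega)) ?_
          intros; positivity
  have h3 : ∑ j ∈ range (2 * N), ∑ i ∈ range (2 * N), P i j ≤
      (((2 * N : ℕ) : ℝ) ^ 2 + sumInvSq / δ ^ 2) * ∑ k ∈ K, ‖c k‖ ^ 2 := by
    rw [Finset.sum_comm]
    have h4 := sum_sum_mul_norm_le K c
      (fun k l => ‖∑ i ∈ range (2 * N), expTwoPi (i * (x k - x l))‖ ^ 2)
      (fun _ _ => by positivity) (fun k l => by
        congr 1
        rw [← RCLike.norm_conj, map_sum]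
        congr 1
        refine sum_congr rfl fun i _ => ?_
        rw [← expTwoPi_neg]
        congr 1; ring)
      (D := ((2 * N : ℕ) : ℝ) ^ 2 + sumInvSq / δ ^ 2)
      (fun k hk => sum_norm_sq_dirichletKernel_le K x hδ hsep _ hk)
    rw [← sum_sum_norm_sq_expTwoPi] at h4
    refine le_trans (le_of_eq ?_) h4
    simp_rw [← Complex.ofReal_sum]
    rw [Complex.norm_real, Real.norm_of_nonneg]
    positivity
  have h5 : ((2 * N : ℕ) : ℝ) ^ 2 + sumInvSq / δ ^ 2 ≤ (4 + sumInvSq) * N * N := by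
    have : sumInvSq / δ ^ 2 ≤ sumInvSq * N ^ 2 := by
      rw [div_eq_mul_one_div, ← one_div_pow]
      have := sumInvSq_nonneg
      gcongr
    push_cast
    nlinarith
  have h6 := h1.trans (h3.trans (mul_le_mul_of_nonneg_right h5 (by positivity)))
  refine le_of_mul_le_mul_left ?_ hN0
  linarith

/-- The large sieve inequality for `δ`-separated points modulo `1`. -/
lemma sum_norm_sq_expTwoPi_le {ι : Type*} (K : Finset ι) (x : ι → ℝ) {δ : ℝ} (hδ : 0 < δ)
    (hsep : ∀ k ∈ K, ∀ l ∈ K, k ≠ l → ∀ z : ℤ, δ ≤ |x k - x l - z|) (a : ℕ → ℂ) {N : ℕ}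
    (hN : 1 / δ ≤ N) :
    ∑ k ∈ K, ‖∑ n ∈ range N, a n * expTwoPi (n * x k)‖ ^ 2
      ≤ (4 + sumInvSq) * N * ∑ n ∈ range N, ‖a n‖ ^ 2 := by
  set T : ι → ℂ := fun k => ∑ n ∈ range N, a n * expTwoPi (n * x k) with hT
  set X := ∑ k ∈ K, ‖T k‖ ^ 2 with hX
  have hX0 : 0 ≤ X := by positivity
  -- Duality: expand one factor of |T k|² and exchange the sums. Cauchy–Schwarz with the dual
  -- inequality then bounds X² by a multiple of X, and one factor X cancels.
  have h1 : (X : ℂ) = ∑ n ∈ range N, a n *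
      ∑ k ∈ K, (starRingEnd ℂ) (T k) * expTwoPi (n * x k) := by
    simp_rw [hX, Finset.mul_sum]
    rw [Finset.sum_comm, Complex.ofReal_sum]
    refine sum_congr rfl fun k _ => ?_
    rw [Complex.ofReal_pow, ← Complex.conj_mul']
    conv_lhs => rw [hT]
    rw [Finset.mul_sum]
    exact sum_congr rfl fun n _ => by ring
  have h2 : X ≤ ∑ n ∈ range N, ‖a n‖ *
      ‖∑ k ∈ K, (starRingEnd ℂ) (T k) * expTwoPi (n * x k)‖ := by
    have := congrArg norm h1
    rw [Complex.norm_real, Real.norm_of_nonneg hX0] at this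
    rw [this]
    refine (norm_sum_le _ _).trans (sum_le_sum fun n _ => ?_)
    rw [norm_mul]
  have h3 := sum_norm_sq_expTwoPi_dual_le K x hδ hsep (fun k => (starRingEnd ℂ) (T k)) hN
  simp_rw [RCLike.norm_conj] at h3
  have h4 := Finset.sum_mul_sq_le_sq_mul_sq (range N) (fun n => ‖a n‖)
    (fun n => ‖∑ k ∈ K, (starRingEnd ℂ) (T k) * expTwoPi (n * x k)‖)
  have h5 : X ^ 2 ≤ (∑ n ∈ range N, ‖a n‖ ^ 2) * ((4 + sumInvSq) * N * X) := by
    refine le_trans (pow_le_pow_left₀ hX0 h2 2) (h4.trans ?_)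
    exact mul_le_mul_of_nonneg_left h3 (by positivity)
  rcases hX0.eq_or_lt with h | h
  · rw [← h]
    have := sumInvSq_nonneg
    positivity
  · refine le_of_mul_le_mul_right ?_ h
    nlinarith

/-- Distinct reduced fractions in `[0, 1)` with denominators at most `R` are `1/R²`-separated
modulo `1`. -/
lemma farey_separated {R r s b c : ℕ} (hr : r ∈ Icc 1 R) (hs : s ∈ Icc 1 R) (hb : b < r)
    (hc : c < s) (hbr : b.Coprime r) (hcs : c.Coprime s) (hne : ¬ (r = s ∧ b = c)) (z : ℤ) :
    1 / (R : ℝ) ^ 2 ≤ |(b / r : ℝ) - c / s - z| := by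
  rw [mem_Icc] at hr hs
  have hr0 : (0 : ℝ) < r := by exact_mod_cast hr.1
  have hs0 : (0 : ℝ) < s := by exact_mod_cast hs.1
  set w : ℤ := b * s - c * r - z * r * s with hw
  have hw0 : w ≠ 0 := by
    intro h0
    have hz : z = 0 := by
      have h1 : (b : ℤ) * s < r * s := by
        have : (0 : ℤ) < s := by exact_mod_cast hs.1
        have : (b : ℤ) < r := by exact_mod_cast hb
        nlinarith
      have h2 : (c : ℤ) * r < r * s := by
        have : (0 : ℤ) < r := by exact_mod_cast hr.1
        have : (c : ℤ) < s := by exact_mod_cast hc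
        nlinarith
      have h3 : (0 : ℤ) ≤ b * s := by positivity
      have h4 : (0 : ℤ) ≤ c * r := by positivity
      have h5 : (0 : ℤ) < r * s := by
        have := hr.1; have := hs.1; positivity
      have h6 : z * (r * s) = b * s - c * r := by linarith
      have h7 : z < 1 := by
        by_contra h; push Not at h; nlinarith
      have h8 : -1 < z := by
        by_contra h; push Not at h; nlinarith
      omega
    rw [hz] at hw
    have h1 : b * s = c * r := by
      have : (b * s : ℤ) = c * r := by linarith
      exact_mod_cast this
    have h2 : r ∣ s := by
      have : r ∣ b * s := ⟨c, by rw [h1, mul_comm]⟩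
      exact (Nat.Coprime.dvd_of_dvd_mul_left hbr.symm this)
    have h3 : s ∣ r := by
      have : s ∣ c * r := ⟨b, by rw [← h1, mul_comm]⟩
      exact (Nat.Coprime.dvd_of_dvd_mul_left hcs.symm this)
    have h4 := Nat.dvd_antisymm h2 h3
    refine hne ⟨h4, ?_⟩
    subst h4
    exact Nat.eq_of_mul_eq_mul_right hr.1 h1
  have heq : (b / r : ℝ) - c / s - z = w / (r * s) := by
    rw [hw]; push_cast; field_simp
  rw [heq, abs_div, abs_of_pos (by positivity : (0 : ℝ) < r * s)]
  have h1 : (1 : ℝ) ≤ |(w : ℝ)| := by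
    have := Int.one_le_abs hw0
    exact_mod_cast this
  have hrR : (r : ℝ) ≤ R := by exact_mod_cast hr.2
  have hsR : (s : ℝ) ≤ R := by exact_mod_cast hs.2
  have : (r * s : ℝ) ≤ (R : ℝ) ^ 2 := by nlinarith
  gcongr

/-- The additive large sieve inequality over reduced fractions. -/
lemma sum_farey_norm_sq_le (a : ℕ → ℂ) {N R : ℕ} (hN : R ^ 2 ≤ N) :
    ∑ r ∈ Icc 1 R, ∑ b ∈ range r with b.Coprime r,
      ‖∑ n ∈ range N, a n * expTwoPi (n * (b / r : ℝ))‖ ^ 2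
      ≤ (4 + sumInvSq) * N * ∑ n ∈ range N, ‖a n‖ ^ 2 := by
  rcases Nat.eq_zero_or_pos R with h0 | h0
  · subst h0
    have := sumInvSq_nonneg
    simp
    positivity
  rw [Finset.sum_sigma']
  refine sum_norm_sq_expTwoPi_le (((Icc 1 R).sigma
    fun r => (range r).filter fun b => b.Coprime r)) (fun p => (p.2 / p.1 : ℝ))
    (δ := 1 / (R : ℝ) ^ 2) (by positivity) ?_ a ?_
  · rintro ⟨r, b⟩ h ⟨s, c⟩ h' hne z
    simp only [mem_sigma, mem_filter, mem_range] at h h'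
    refine farey_separated h.1 h'.1 h.2.1 h'.2.1 h.2.2 h'.2.2 ?_ z
    rintro ⟨rfl, rfl⟩
    exact hne rfl
  · rw [one_div_one_div]; exact_mod_cast hN

/-! ### Gauss sums and the multiplicative large sieve. -/

lemma stdAddChar_natCast_mul {r : ℕ} [NeZero r] (n b : ℕ) :
    ZMod.stdAddChar ((b : ZMod r) * (n : ZMod r)) = expTwoPi (n * (b / r : ℝ)) := by
  have := ZMod.stdAddChar_coe (N := r) ((b * n : ℕ) : ℤ)
  push_cast at this
  rw [this, expTwoPi]
  congr 1; push_cast; ring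

lemma conj_stdAddChar {r : ℕ} [NeZero r] (j : ZMod r) :
    (starRingEnd ℂ) (ZMod.stdAddChar j) = ZMod.stdAddChar (-j) := by
  rw [AddChar.map_neg_eq_inv, ZMod.stdAddChar_apply, ← Circle.coe_inv_eq_conj, Circle.coe_inv]

lemma sum_mul_inv_apply {r : ℕ} [NeZero r] (χ : DirichletCharacter ℂ r) :
    ∑ b : ZMod r, χ b * χ⁻¹ b = r.totient := by
  simp_rw [← MulChar.mul_apply, mul_inv_cancel]
  rw [MulChar.sum_one_eq_card_units, ZMod.card_units_eq_totient]

/-- The Gauss sum of a primitive character modulo `r` has absolute value `√r`. -/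
lemma norm_sq_gaussSum {r : ℕ} [NeZero r] {χ : DirichletCharacter ℂ r} (hχ : χ.IsPrimitive) :
    ‖gaussSum χ (ZMod.stdAddChar (N := r))‖ ^ 2 = r := by
  set e := ZMod.stdAddChar (N := r)
  -- The sum over n of |τ(χ, n)|² is computed twice: by primitivity, where only units n contribute,
  -- and by orthogonality of additive characters.
  have h1 : ∑ n : ZMod r, gaussSum χ (e.mulShift n) * (starRingEnd ℂ) (gaussSum χ (e.mulShift n))
      = r.totient * (gaussSum χ e * (starRingEnd ℂ) (gaussSum χ e)) := by
    rw [← sum_mul_inv_apply χ, Finset.sum_mul]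
    refine sum_congr rfl fun n _ => ?_
    rw [gaussSum_mulShift_of_isPrimitive e hχ, map_mul, ← RCLike.star_def, MulChar.star_apply',
      inv_inv]
    ring
  have h2 : ∑ n : ZMod r, gaussSum χ (e.mulShift n) * (starRingEnd ℂ) (gaussSum χ (e.mulShift n))
      = r.totient * r := by
    have h3 : ∀ n : ZMod r, gaussSum χ (e.mulShift n) *
        (starRingEnd ℂ) (gaussSum χ (e.mulShift n))
        = ∑ b : ZMod r, ∑ c : ZMod r, (χ b * χ⁻¹ c) * e (n * (b - c)) := by
      intro n
      rw [gaussSum, map_sum, Finset.sum_mul_sum]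
      refine sum_congr rfl fun b _ => sum_congr rfl fun c _ => ?_
      rw [map_mul, ← RCLike.star_def, MulChar.star_apply', RCLike.star_def, AddChar.mulShift_apply,
        AddChar.mulShift_apply, conj_stdAddChar, mul_mul_mul_comm, ← AddChar.map_add_eq_mul]
      congr 2; ring
    simp_rw [h3]
    rw [Finset.sum_comm]
    have h4 : ∀ b : ZMod r, ∑ n : ZMod r, ∑ c : ZMod r, (χ b * χ⁻¹ c) * e (n * (b - c))
        = χ b * χ⁻¹ b * r := by
      intro b
      rw [Finset.sum_comm]
      have h5 : ∀ c : ZMod r, ∑ n : ZMod r, e (n * (b - c)) = if b = c then (r : ℂ) else 0 := by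
        intro c
        rw [AddChar.sum_mulShift _ (ZMod.isPrimitive_stdAddChar r), ZMod.card]
        simp [sub_eq_zero]
      simp_rw [← Finset.mul_sum, h5]
      simp
    simp_rw [h4, ← Finset.sum_mul, sum_mul_inv_apply]
  rw [h1] at h2
  have hφ : (r.totient : ℂ) ≠ 0 := by
    exact_mod_cast (Nat.totient_pos.mpr (Nat.pos_of_ne_zero (NeZero.ne r))).ne'
  have h5 := mul_left_cancel₀ hφ h2
  rw [Complex.mul_conj'] at h5
  exact_mod_cast h5

lemma sum_inv_apply_mul_apply {r : ℕ} [NeZero r] (u v : (ZMod r)ˣ) :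
    ∑ χ : DirichletCharacter ℂ r, χ⁻¹ u * χ v = if u = v then (r.totient : ℂ) else 0 := by
  have h := DirichletCharacter.sum_char_inv_mul_char_eq ℂ (n := r) u.isUnit (v : ZMod r)
  simp only [Units.val_inj] at h
  rw [← h]
  refine sum_congr rfl fun χ _ => ?_
  congr 1
  rw [MulChar.inv_apply, Ring.inverse_unit, ZMod.inv_coe_unit]

/-- Plancherel's identity for the group of residue classes coprime to `r`. -/
lemma sum_norm_sq_sum_inv_apply {r : ℕ} [NeZero r] (S : (ZMod r)ˣ → ℂ) :
    ∑ χ : DirichletCharacter ℂ r, ‖∑ u : (ZMod r)ˣ, χ⁻¹ u * S u‖ ^ 2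
      = r.totient * ∑ u : (ZMod r)ˣ, ‖S u‖ ^ 2 := by
  have h : ((∑ χ : DirichletCharacter ℂ r, ‖∑ u : (ZMod r)ˣ, χ⁻¹ u * S u‖ ^ 2 : ℝ) : ℂ)
      = ((r.totient * ∑ u : (ZMod r)ˣ, ‖S u‖ ^ 2 : ℝ) : ℂ) := by
    push_cast
    have h1 : ∀ χ : DirichletCharacter ℂ r, ((‖∑ u : (ZMod r)ˣ, χ⁻¹ u * S u‖ : ℂ)) ^ 2
        = ∑ u : (ZMod r)ˣ, ∑ v : (ZMod r)ˣ, (S u * (starRingEnd ℂ) (S v)) * (χ⁻¹ u * χ v) := by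
      intro χ
      rw [← Complex.mul_conj', map_sum, Finset.sum_mul_sum]
      refine sum_congr rfl fun u _ => sum_congr rfl fun v _ => ?_
      rw [map_mul, ← RCLike.star_def, MulChar.star_apply', inv_inv]
      ring
    simp_rw [h1]
    rw [Finset.sum_comm, Finset.mul_sum]
    refine sum_congr rfl fun u _ => ?_
    rw [Finset.sum_comm]
    simp_rw [← Finset.mul_sum, sum_inv_apply_mul_apply]
    simp only [mul_ite, mul_zero, Finset.sum_ite_eq, Finset.mem_univ, if_true]
    rw [Complex.mul_conj']
    ring
  exact_mod_cast h

lemma sum_units_eq_sum_coprime {r : ℕ} [NeZero r] (F : ZMod r → ℝ) :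
    ∑ u : (ZMod r)ˣ, F u = ∑ b ∈ range r with b.Coprime r, F (b : ZMod r) := by
  refine Finset.sum_bij (fun u _ => (u : ZMod r).val) ?_ ?_ ?_ ?_
  · intro u _
    rw [mem_filter, mem_range]
    exact ⟨ZMod.val_lt _, ZMod.val_coe_unit_coprime u⟩
  · intro u _ v _ h
    exact Units.val_injective (ZMod.val_injective r h)
  · intro b hb
    rw [mem_filter, mem_range] at hb
    refine ⟨ZMod.unitOfCoprime b hb.2, mem_univ _, ?_⟩
    rw [ZMod.coe_unitOfCoprime, ZMod.val_cast_of_lt hb.1]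
  · intro u _
    rw [ZMod.natCast_zmod_val]

open Classical in
/-- The primitive Dirichlet characters modulo `r` (none if `r = 0`). -/
def primitiveCharacters (r : ℕ) : Finset (DirichletCharacter ℂ r) :=
  if h : r = 0 then ∅ else
    haveI := NeZero.mk h
    Finset.univ.filter fun χ => χ.IsPrimitive

lemma mem_primitiveCharacters {r : ℕ} [NeZero r] {χ : DirichletCharacter ℂ r} :
    χ ∈ primitiveCharacters r ↔ χ.IsPrimitive := by
  rw [primitiveCharacters, dif_neg (NeZero.ne r)]
  simp

lemma card_primitiveCharacters_le (r : ℕ) : #(primitiveCharacters r) ≤ r.totient := by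
  rw [primitiveCharacters]
  split_ifs with h
  · simp
  · have := NeZero.mk h
    rw [← DirichletCharacter.card_eq_totient_of_hasEnoughRootsOfUnity ℂ r,
      Nat.card_eq_fintype_card]
    exact Finset.card_le_univ _

/-- Multiplying by the Gauss sum of χ⁻¹, of absolute value √r, turns χ(n) into a combination of
additive characters. Plancherel over all characters modulo `r`, with the imprimitive ones dropped,
then gives the additive sums at reduced fractions. -/
lemma sum_primitiveCharacters_norm_sq_le {r : ℕ} (hr : 1 ≤ r) (a : ℕ → ℂ) (N : ℕ) :
    (r / r.totient : ℝ) * ∑ χ ∈ primitiveCharacters r, ‖∑ n ∈ range N, a n * χ n‖ ^ 2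
      ≤ ∑ b ∈ range r with b.Coprime r, ‖∑ n ∈ range N, a n * expTwoPi (n * (b / r : ℝ))‖ ^ 2 := by
  have : NeZero r := ⟨by omega⟩
  set e := ZMod.stdAddChar (N := r)
  set S : ZMod r → ℂ := fun b => ∑ n ∈ range N, a n * e (b * n)
  have hφ : (0 : ℝ) < r.totient := by exact_mod_cast Nat.totient_pos.mpr hr
  have h1 : ∑ b ∈ range r with b.Coprime r, ‖∑ n ∈ range N, a n * expTwoPi (n * (b / r : ℝ))‖ ^ 2
      = ∑ u : (ZMod r)ˣ, ‖S u‖ ^ 2 := by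
    rw [sum_units_eq_sum_coprime (fun b => ‖S b‖ ^ 2)]
    refine sum_congr rfl fun b _ => ?_
    simp only [S, e, stdAddChar_natCast_mul]
  have h2 : ∀ χ ∈ primitiveCharacters r, r * ‖∑ n ∈ range N, a n * χ n‖ ^ 2
      = ‖∑ u : (ZMod r)ˣ, χ⁻¹ u * S u‖ ^ 2 := by
    intro χ hχ
    rw [mem_primitiveCharacters] at hχ
    have hχ' : χ⁻¹.IsPrimitive := by
      rw [DirichletCharacter.isPrimitive_def, DirichletCharacter.conductor_inv]
      exact hχ
    rw [← norm_sq_gaussSum hχ', ← mul_pow, ← norm_mul]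
    congr 2
    rw [Finset.mul_sum]
    have h3 : ∑ u : (ZMod r)ˣ, χ⁻¹ u * S u = ∑ b : ZMod r, χ⁻¹ b * S b := by
      symm
      rw [← Finset.sum_subset (s₁ := univ.map ⟨fun u : (ZMod r)ˣ => (u : ZMod r),
        Units.val_injective⟩) (subset_univ _), Finset.sum_map]
      · rfl
      · intro b _ hb
        rw [MulChar.map_nonunit, zero_mul]
        rintro ⟨u, hu⟩
        exact hb (by rw [Finset.mem_map]; exact ⟨u, mem_univ _, hu⟩)
    rw [h3]
    simp only [S, Finset.mul_sum]
    rw [Finset.sum_comm]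
    refine sum_congr rfl fun n _ => ?_
    have h4 := gaussSum_mulShift_of_isPrimitive e hχ' (n : ZMod r)
    rw [inv_inv] at h4
    rw [show gaussSum χ⁻¹ e * (a n * χ n) = a n * (χ n * gaussSum χ⁻¹ e) by ring, ← h4, gaussSum,
      Finset.mul_sum]
    refine sum_congr rfl fun b _ => ?_
    rw [AddChar.mulShift_apply, mul_comm (n : ZMod r) b]
    ring
  have h3 : ∑ χ ∈ primitiveCharacters r, ‖∑ u : (ZMod r)ˣ, χ⁻¹ u * S u‖ ^ 2
      ≤ r.totient * ∑ u : (ZMod r)ˣ, ‖S u‖ ^ 2 := by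
    rw [← sum_norm_sq_sum_inv_apply fun u : (ZMod r)ˣ => S u]
    exact sum_le_sum_of_subset_of_nonneg (subset_univ _) fun _ _ _ => by positivity
  rw [h1, div_mul_eq_mul_div, div_le_iff₀ hφ, Finset.mul_sum, sum_congr rfl h2, mul_comm]
  linarith

/-- The multiplicative large sieve inequality. -/
lemma multiplicative_large_sieve (a : ℕ → ℂ) (N R : ℕ) :
    ∑ r ∈ Icc 1 R, (r / r.totient : ℝ) *
        ∑ χ ∈ primitiveCharacters r, ‖∑ n ∈ range N, a n * χ n‖ ^ 2
      ≤ (4 + sumInvSq) * (N + R ^ 2) * ∑ n ∈ range N, ‖a n‖ ^ 2 := by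
  have key : ∀ F : ℕ → ℂ → ℂ, (∀ n, F n 0 = 0) →
      ∑ n ∈ range (N + R ^ 2), F n (if n < N then a n else 0) = ∑ n ∈ range N, F n (a n) := by
    intro F hF
    rw [Finset.sum_range_add, Finset.sum_eq_zero (s := range (R ^ 2)), add_zero]
    · exact sum_congr rfl fun n hn => by rw [if_pos (mem_range.mp hn)]
    · intro n _
      rw [if_neg (by omega), hF]
  -- The sequence is padded by zeros to length N + R², since the additive inequality needs a length
  -- of at least R².
  have h1 := sum_farey_norm_sq_le (fun n => if n < N then a n else 0)
    (N := N + R ^ 2) (R := R) (by omega)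
  have h2 : ∑ n ∈ range (N + R ^ 2), ‖if n < N then a n else 0‖ ^ 2
      = ∑ n ∈ range N, ‖a n‖ ^ 2 := by
    rw [Finset.sum_range_add, Finset.sum_eq_zero (s := range (R ^ 2)), add_zero]
    · exact sum_congr rfl fun n hn => by rw [if_pos (mem_range.mp hn)]
    · intro n _
      rw [if_neg (by omega)]; simp
  rw [h2] at h1
  push_cast at h1
  refine le_trans (sum_le_sum fun r hr => ?_) h1
  refine le_trans (le_of_eq ?_) (sum_primitiveCharacters_norm_sq_le (mem_Icc.mp hr).1
    (fun n => if n < N then a n else 0) (N + R ^ 2))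
  congr 1
  refine sum_congr rfl fun χ _ => ?_
  rw [key (fun n z => z * χ n) (by simp)]

lemma large_sieve_mul (α β : ℕ → ℂ) (M N R : ℕ) :
    ∑ r ∈ Icc 1 R, (r / r.totient : ℝ) * ∑ χ ∈ primitiveCharacters r,
        ‖∑ m ∈ range M, α m * χ m‖ * ‖∑ n ∈ range N, β n * χ n‖
      ≤ (4 + sumInvSq) * √((M + R ^ 2) * (N + R ^ 2)) *
        (√(∑ m ∈ range M, ‖α m‖ ^ 2) * √(∑ n ∈ range N, ‖β n‖ ^ 2)) := by
  set w : ℕ → ℝ := fun r => (r / r.totient : ℝ)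
  have hw : ∀ r, 0 ≤ w r := fun r => by positivity
  have e1 : ∀ F : (r : ℕ) → DirichletCharacter ℂ r → ℝ,
      ∑ r ∈ Icc 1 R, w r * ∑ χ ∈ primitiveCharacters r, F r χ
      = ∑ p ∈ (Icc 1 R).sigma primitiveCharacters, w p.1 * F p.1 p.2 := by
    intro F
    rw [Finset.sum_sigma]
    simp_rw [Finset.mul_sum]
  have hA := multiplicative_large_sieve α M R
  have hB := multiplicative_large_sieve β N R
  change ∑ r ∈ Icc 1 R, w r * _ ≤ _ at hA hB ⊢
  rw [e1 fun r χ => ‖∑ m ∈ range M, α m * χ m‖ ^ 2] at hA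
  rw [e1 fun r χ => ‖∑ m ∈ range N, β m * χ m‖ ^ 2] at hB
  rw [e1 fun r χ => ‖∑ m ∈ range M, α m * χ m‖ * ‖∑ n ∈ range N, β n * χ n‖]
  have h1 := Real.sum_mul_le_sqrt_mul_sqrt ((Icc 1 R).sigma primitiveCharacters)
    (fun p => √(w p.1) * ‖∑ m ∈ range M, α m * p.2 m‖)
    (fun p => √(w p.1) * ‖∑ m ∈ range N, β m * p.2 m‖)
  simp only [mul_pow, Real.sq_sqrt (hw _)] at h1
  have h2 : ∀ p ∈ (Icc 1 R).sigma primitiveCharacters,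
      w p.1 * (‖∑ m ∈ range M, α m * p.2 m‖ * ‖∑ n ∈ range N, β n * p.2 n‖)
      = √(w p.1) * ‖∑ m ∈ range M, α m * p.2 m‖ * (√(w p.1) * ‖∑ m ∈ range N, β m * p.2 m‖) := by
    intro p _
    rw [mul_mul_mul_comm, Real.mul_self_sqrt (hw _)]
  rw [sum_congr rfl h2]
  refine h1.trans ((mul_le_mul (Real.sqrt_le_sqrt hA) (Real.sqrt_le_sqrt hB)
    (Real.sqrt_nonneg _) (Real.sqrt_nonneg _)).trans (le_of_eq ?_))
  have hc : 0 ≤ 4 + sumInvSq := by have := sumInvSq_nonneg; positivity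
  rw [Real.sqrt_mul (by positivity), Real.sqrt_mul hc, Real.sqrt_mul (by positivity),
    Real.sqrt_mul hc, Real.sqrt_mul (by positivity)]
  have := Real.mul_self_sqrt hc
  linear_combination (√(M + R ^ 2 : ℝ) * √(N + R ^ 2 : ℝ) * √(∑ m ∈ range M, ‖α m‖ ^ 2) *
    √(∑ n ∈ range N, ‖β n‖ ^ 2)) * this

/-! ### Bilinear large sieve with a cutoff coupling the variables. -/

lemma sum_Icc_one_div_le (N : ℕ) : ∑ n ∈ Icc 1 N, (1 / n : ℝ) ≤ 1 + Real.log N := by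
  have h := harmonic_le_one_add_log N
  rw [harmonic_eq_sum_Icc] at h
  push_cast at h
  simpa only [one_div] using h

/-- An upper bound for the Fourier coefficients modulo `N` of the indicator function of an
initial segment of `{0, …, N - 1}`. -/
def cutoffWeight (N h : ℕ) : ℝ :=
  if h = 0 then N else N / 2 * (1 / h + 1 / ((N - h : ℕ) : ℝ))

lemma cutoffWeight_nonneg (N h : ℕ) : 0 ≤ cutoffWeight N h := by
  rw [cutoffWeight]; split_ifs <;> positivity

lemma norm_sum_expTwoPi_le_cutoffWeight {N h t : ℕ} (hh : h < N) (ht : t ≤ N) :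
    ‖∑ k ∈ range t, expTwoPi (k * (-(h / N) : ℝ))‖ ≤ cutoffWeight N h := by
  rw [cutoffWeight]
  split_ifs with h0
  · refine (norm_sum_expTwoPi_le _ _).trans (by exact_mod_cast ht)
  · have hN : (0 : ℝ) < N := by exact_mod_cast (by omega : 0 < N)
    have hhp : (0 : ℝ) < h := by exact_mod_cast Nat.pos_of_ne_zero h0
    have hsub : ((N - h : ℕ) : ℝ) = N - h := by rw [Nat.cast_sub hh.le]
    have hsp : (0 : ℝ) < ((N - h : ℕ) : ℝ) := by exact_mod_cast (by omega : 0 < N - h)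
    have h1 := norm_sum_expTwoPi_mul_le t (-(h / N) : ℝ)
    set z := round (-(h / N) : ℝ)
    set X := ‖∑ k ∈ range t, expTwoPi (k * (-(h / N) : ℝ))‖
    have hX : 0 ≤ X := norm_nonneg _
    -- Whichever integer z is, -(h/N) lies at distance at least h/N from it if z ≥ 0 and at least (N
    -- - h)/N if z ≤ -1; the two terms of `cutoffWeight` cover both cases.
    have hcase : (h / N : ℝ) ≤ |(-(h / N) : ℝ) - z| ∨
        (((N - h : ℕ) : ℝ) / N : ℝ) ≤ |(-(h / N) : ℝ) - z| := by
      rcases le_or_gt 0 z with hz | hz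
      · left
        rw [abs_sub_comm]
        have : (0 : ℝ) ≤ z := by exact_mod_cast hz
        refine le_trans ?_ (le_abs_self _)
        linarith
      · right
        have : (z : ℝ) ≤ -1 := by exact_mod_cast (by omega : z ≤ -1)
        refine le_trans ?_ (le_abs_self _)
        rw [hsub, sub_div, div_self hN.ne']
        linarith
    have hfin : ∀ y : ℝ, 0 < y → y / N ≤ |(-(h / N) : ℝ) - z| → X ≤ N / 2 * (1 / y) := by
      intro y hy hle
      have h2 : X * (2 * (y / N)) ≤ 1 :=
        le_trans (mul_le_mul_of_nonneg_left (by linarith) hX) h1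
      have h3 : X * (2 * (y / N)) = X * y * (2 / N) := by ring
      rw [h3, ← le_div_iff₀ (by positivity), one_div_div] at h2
      rw [mul_one_div, le_div_iff₀ hy]
      exact h2
    rcases hcase with h2 | h2
    · refine (hfin _ hhp h2).trans ?_
      gcongr
      exact le_add_of_nonneg_right (by positivity)
    · refine (hfin _ hsp h2).trans ?_
      gcongr
      exact le_add_of_nonneg_left (by positivity)

lemma sum_cutoffWeight_le {N : ℕ} (hN : 1 ≤ N) :
    ∑ h ∈ range N, cutoffWeight N h ≤ N * (2 + Real.log N) := by
  obtain ⟨n, rfl⟩ : ∃ n, N = n + 1 := ⟨N - 1, by omega⟩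
  rw [Finset.sum_range_succ']
  have h1 : ∀ h ∈ range n, cutoffWeight (n + 1) (h + 1)
      = ((n + 1 : ℕ) : ℝ) / 2 * (1 / ((h + 1 : ℕ) : ℝ) + 1 / ((n - 1 - h + 1 : ℕ) : ℝ)) := by
    intro h hh
    rw [mem_range] at hh
    rw [cutoffWeight, if_neg (by omega)]
    congr 4
    omega
  rw [sum_congr rfl h1, ← Finset.mul_sum, Finset.sum_add_distrib,
    Finset.sum_range_reflect (fun j => 1 / ((j + 1 : ℕ) : ℝ)), cutoffWeight, if_pos rfl]
  have h2 : ∑ h ∈ range n, 1 / ((h + 1 : ℕ) : ℝ) ≤ 1 + Real.log ((n + 1 : ℕ) : ℝ) := by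
    refine le_trans ?_ (sum_Icc_one_div_le (n + 1))
    rw [Finset.range_eq_Ico, Finset.sum_Ico_add' (fun j => 1 / ((j : ℕ) : ℝ)) 0 n 1]
    refine sum_le_sum_of_subset_of_nonneg ?_ fun _ _ _ => by positivity
    intro j hj
    simp only [mem_Ico, mem_Icc] at *
    omega
  have : (0 : ℝ) ≤ ((n + 1 : ℕ) : ℝ) := by positivity
  nlinarith

lemma sum_expTwoPi_orthogonality {N b k : ℕ} (hb : b < N) (hk : k < N) :
    ∑ h ∈ range N, expTwoPi (h * ((b - k) / N : ℝ)) = if b = k then (N : ℂ) else 0 := by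
  have hN : (0 : ℝ) < N := by exact_mod_cast (by omega : 0 < N)
  split_ifs with hbk
  · subst hbk
    simp [expTwoPi_zero]
  · set x : ℝ := (b - k) / N
    have h1 : (∑ h ∈ range N, expTwoPi (h * x)) * (expTwoPi x - 1) = 0 := by
      simp_rw [expTwoPi_natCast_mul]
      rw [geom_sum_mul, ← expTwoPi_natCast_mul]
      have : (N * x : ℝ) = ((b - k : ℤ) : ℝ) := by
        simp only [x]; push_cast; field_simp
      rw [this, expTwoPi_intCast, sub_self]
    rcases mul_eq_zero.mp h1 with h | h
    · exact h
    · exfalso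
      have h2 := norm_expTwoPi_sub_one_ge x
      rw [h, norm_zero] at h2
      have h3 : |x - round x| = 0 := le_antisymm (by linarith) (abs_nonneg _)
      rw [abs_eq_zero, sub_eq_zero] at h3
      have hbN : (b : ℝ) < N := by exact_mod_cast hb
      have hkN : (k : ℝ) < N := by exact_mod_cast hk
      have hb0 : (0 : ℝ) ≤ b := by positivity
      have hk0 : (0 : ℝ) ≤ k := by positivity
      have h4 : x < 1 := by rw [div_lt_one hN]; linarith
      have h5 : -1 < x := by rw [lt_div_iff₀ hN]; linarith
      rw [h3] at h4 h5
      have h6 : round x < 1 := by exact_mod_cast h4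
      have h7 : -1 < round x := by exact_mod_cast h5
      have h8 : round x = 0 := by omega
      rw [h8, Int.cast_zero, div_eq_zero_iff] at h3
      rcases h3 with h3 | h3
      · exact hbk (by exact_mod_cast sub_eq_zero.mp h3)
      · exact hN.ne' h3

/-- Fourier expansion modulo `N` of the indicator function of `{0, …, t - 1}`. -/
lemma indicator_eq_sum_expTwoPi {N t b : ℕ} (hb : b < N) (ht : t ≤ N) :
    (N : ℂ) * (if b < t then 1 else 0) = ∑ h ∈ range N,
      (∑ k ∈ range t, expTwoPi (k * (-(h / N) : ℝ))) * expTwoPi (b * (h / N : ℝ)) := by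
  simp_rw [Finset.sum_mul]
  rw [Finset.sum_comm]
  have h1 : ∀ k ∈ range t, ∑ h ∈ range N, expTwoPi (k * (-(h / N) : ℝ)) * expTwoPi (b * (h / N : ℝ))
      = if b = k then (N : ℂ) else 0 := by
    intro k hk
    rw [← sum_expTwoPi_orthogonality hb (lt_of_lt_of_le (mem_range.mp hk) ht)]
    refine sum_congr rfl fun h _ => ?_
    rw [← expTwoPi_add]
    congr 1; ring
  rw [sum_congr rfl h1]
  simp

/-- The condition n < t m is expanded in a Fourier series modulo N, which separates the variables.
The phase in n is unimodular and harmless; the coefficient depending on m is at most `cutoffWeight N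
h`, whose mean over h is at most 2 + log N. -/
lemma large_sieve_cutoff (α β : ℕ → ℂ) (M R : ℕ) {N : ℕ} (hN : 1 ≤ N) (t : ℕ → ℕ)
    (ht : ∀ m, t m ≤ N) :
    ∑ r ∈ Icc 1 R, (r / r.totient : ℝ) * ∑ χ ∈ primitiveCharacters r,
        ‖∑ m ∈ range M, ∑ n ∈ range N with n < t m, α m * β n * (χ m * χ n)‖
      ≤ (4 + sumInvSq) * √((M + R ^ 2) * (N + R ^ 2)) *
        (√(∑ m ∈ range M, ‖α m‖ ^ 2) * √(∑ n ∈ range N, ‖β n‖ ^ 2)) * (2 + Real.log N) := by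
  have hNp : (0 : ℝ) < N := by exact_mod_cast hN
  set c : ℕ → ℕ → ℂ := fun h m => ∑ k ∈ range (t m), expTwoPi (k * (-(h / N) : ℝ)) with hc
  set α' : ℕ → ℕ → ℂ := fun h m => α m * c h m
  set β' : ℕ → ℕ → ℂ := fun h n => β n * expTwoPi (n * (h / N : ℝ))
  set Z := (4 + sumInvSq) * √((M + R ^ 2) * (N + R ^ 2)) *
        (√(∑ m ∈ range M, ‖α m‖ ^ 2) * √(∑ n ∈ range N, ‖β n‖ ^ 2)) with hZ
  have hZ0 : 0 ≤ Z := by have := sumInvSq_nonneg; positivity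
  have h1 : ∀ (r : ℕ) (χ : DirichletCharacter ℂ r),
      N * ‖∑ m ∈ range M, ∑ n ∈ range N with n < t m, α m * β n * (χ m * χ n)‖
      ≤ ∑ h ∈ range N, ‖∑ m ∈ range M, α' h m * χ m‖ * ‖∑ n ∈ range N, β' h n * χ n‖ := by
    intro r χ
    have h2 : N * ∑ m ∈ range M, ∑ n ∈ range N with n < t m, α m * β n * (χ m * χ n)
        = ∑ h ∈ range N, (∑ m ∈ range M, α' h m * χ m) * (∑ n ∈ range N, β' h n * χ n) := by
      simp_rw [Finset.sum_mul_sum]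
      rw [Finset.sum_comm, Finset.mul_sum]
      refine sum_congr rfl fun m _ => ?_
      rw [Finset.sum_comm, Finset.mul_sum, Finset.sum_filter]
      refine sum_congr rfl fun n hn => ?_
      have h3 := indicator_eq_sum_expTwoPi (mem_range.mp hn) (ht m)
      have h4 : ∑ h ∈ range N, α' h m * χ m * (β' h n * χ n)
          = (α m * β n * (χ m * χ n)) * ∑ h ∈ range N, c h m * expTwoPi (n * (h / N : ℝ)) := by
        rw [Finset.mul_sum]
        exact sum_congr rfl fun h _ => by simp only [α', β']; ring
      rw [h4, ← h3]
      split_ifs <;> ring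
    have h5 := congrArg norm h2
    rw [norm_mul, Complex.norm_natCast] at h5
    rw [h5]
    refine (norm_sum_le _ _).trans (sum_le_sum fun h _ => ?_)
    rw [norm_mul]
  have h2 : ∀ h ∈ range N, ∑ r ∈ Icc 1 R, (r / r.totient : ℝ) * ∑ χ ∈ primitiveCharacters r,
      ‖∑ m ∈ range M, α' h m * χ m‖ * ‖∑ n ∈ range N, β' h n * χ n‖ ≤ Z * cutoffWeight N h := by
    intro h hh
    refine (large_sieve_mul (α' h) (β' h) M N R).trans ?_
    have h3 : ∑ n ∈ range N, ‖β' h n‖ ^ 2 = ∑ n ∈ range N, ‖β n‖ ^ 2 := by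
      refine sum_congr rfl fun n _ => ?_
      simp only [β', norm_mul, norm_expTwoPi, mul_one]
    have h4 : √(∑ m ∈ range M, ‖α' h m‖ ^ 2)
        ≤ √(∑ m ∈ range M, ‖α m‖ ^ 2) * cutoffWeight N h := by
      have hw := cutoffWeight_nonneg N h
      rw [← Real.sqrt_sq hw, ← Real.sqrt_mul (by positivity)]
      refine Real.sqrt_le_sqrt ?_
      rw [Finset.sum_mul]
      refine sum_le_sum fun m _ => ?_
      simp only [α', norm_mul, mul_pow]
      gcongr
      exact norm_sum_expTwoPi_le_cutoffWeight (mem_range.mp hh) (ht m)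
    rw [h3, hZ]
    have := sumInvSq_nonneg
    calc _ ≤ (4 + sumInvSq) * √((M + R ^ 2) * (N + R ^ 2)) *
          (√(∑ m ∈ range M, ‖α m‖ ^ 2) * cutoffWeight N h * √(∑ n ∈ range N, ‖β n‖ ^ 2)) := by
          gcongr
      _ = _ := by ring
  have h3 : N * ∑ r ∈ Icc 1 R, (r / r.totient : ℝ) * ∑ χ ∈ primitiveCharacters r,
        ‖∑ m ∈ range M, ∑ n ∈ range N with n < t m, α m * β n * (χ m * χ n)‖
      ≤ ∑ h ∈ range N, ∑ r ∈ Icc 1 R, (r / r.totient : ℝ) * ∑ χ ∈ primitiveCharacters r,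
      ‖∑ m ∈ range M, α' h m * χ m‖ * ‖∑ n ∈ range N, β' h n * χ n‖ := by
    rw [Finset.sum_comm, Finset.mul_sum]
    refine sum_le_sum fun r _ => ?_
    rw [mul_left_comm, ← Finset.mul_sum, Finset.sum_comm]
    refine mul_le_mul_of_nonneg_left ?_ (by positivity)
    rw [Finset.mul_sum]
    exact sum_le_sum fun χ _ => h1 r χ
  have h4 := h3.trans (sum_le_sum h2)
  rw [← Finset.mul_sum] at h4
  have h5 := h4.trans (mul_le_mul_of_nonneg_left (sum_cutoffWeight_le hN) hZ0)
  refine le_of_mul_le_mul_left ?_ hNp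
  linarith

/-! ### Dirichlet convolution and divisor sums. -/

lemma sum_Icc_divisorsAntidiagonal {M : Type*} [AddCommMonoid M] (F : ℕ → ℕ → M) (N : ℕ) :
    ∑ n ∈ Icc 1 N, ∑ p ∈ n.divisorsAntidiagonal, F p.1 p.2
      = ∑ a ∈ Icc 1 N, ∑ b ∈ Icc 1 (N / a), F a b := by
  rw [Finset.sum_sigma', Finset.sum_sigma']
  refine Finset.sum_bij' (fun x _ => ⟨x.2.1, x.2.2⟩) (fun x _ => ⟨x.1 * x.2, (x.1, x.2)⟩)
    ?_ ?_ ?_ ?_ ?_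
  · rintro ⟨n, a, b⟩ h
    simp only [mem_sigma, mem_Icc, Nat.mem_divisorsAntidiagonal] at h ⊢
    obtain ⟨⟨h1, h2⟩, rfl, h3⟩ := h
    have ha : 0 < a := Nat.pos_of_ne_zero (left_ne_zero_of_mul h3)
    have hb : 0 < b := Nat.pos_of_ne_zero (right_ne_zero_of_mul h3)
    refine ⟨⟨ha, le_trans (Nat.le_mul_of_pos_right a hb) h2⟩, hb, ?_⟩
    rw [Nat.le_div_iff_mul_le ha, mul_comm]
    exact h2
  · rintro ⟨a, b⟩ h
    simp only [mem_sigma, mem_Icc, Nat.mem_divisorsAntidiagonal] at h ⊢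
    obtain ⟨⟨h1, h2⟩, h3, h4⟩ := h
    rw [Nat.le_div_iff_mul_le h1, mul_comm] at h4
    have : 0 < a * b := Nat.mul_pos h1 h3
    exact ⟨⟨this, h4⟩, trivial, this.ne'⟩
  · rintro ⟨n, a, b⟩ h
    simp only [mem_sigma, mem_Icc, Nat.mem_divisorsAntidiagonal] at h
    obtain ⟨_, rfl, _⟩ := h
    rfl
  · rintro ⟨a, b⟩ _
    rfl
  · rintro ⟨n, a, b⟩ _
    rfl

/-- The Dirichlet convolution of two functions on `ℕ`. -/
def dirichletConv (u v : ℕ → ℂ) (n : ℕ) : ℂ :=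
  ∑ p ∈ n.divisorsAntidiagonal, u p.1 * v p.2

lemma card_divisors_mul_le (a b : ℕ) : #(a * b).divisors ≤ #a.divisors * #b.divisors := by
  rw [Nat.divisors_mul]
  exact Finset.card_mul_le

/-- This is n = ∑_{d ∣ n} φ(d) together with φ(d) ≤ φ(n). -/
lemma self_le_card_divisors_mul_totient (n : ℕ) : n ≤ #n.divisors * n.totient := by
  rcases Nat.eq_zero_or_pos n with rfl | hn
  · simp
  conv_lhs => rw [← Nat.sum_totient n]
  rw [← smul_eq_mul, ← Finset.sum_const]
  refine sum_le_sum fun d hd => ?_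
  exact Nat.le_of_dvd (Nat.totient_pos.mpr hn)
    (Nat.totient_dvd_of_dvd (Nat.dvd_of_mem_divisors hd))

lemma one_div_totient_le (n : ℕ) (hn : 1 ≤ n) :
    (1 / n.totient : ℝ) ≤ #n.divisors / n := by
  have h1 : (n : ℝ) ≤ #n.divisors * n.totient := by
    exact_mod_cast self_le_card_divisors_mul_totient n
  have h2 : (0 : ℝ) < n.totient := by exact_mod_cast Nat.totient_pos.mpr hn
  have h3 : (0 : ℝ) < n := by exact_mod_cast hn
  rw [div_le_div_iff₀ h2 h3]
  linarith

/-- Induction on `k`: one factor d(n) counts the factorizations n = ab, and d(ab) ≤ d(a)d(b)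
separates the rest, so each step squares the bound. -/
lemma sum_card_divisors_pow_div_le (k N : ℕ) :
    ∑ n ∈ Icc 1 N, (#n.divisors : ℝ) ^ k / n ≤ (1 + Real.log N) ^ 2 ^ k := by
  induction k with
  | zero => simpa using sum_Icc_one_div_le N
  | succ k ih =>
    have h1 : ∀ n ∈ Icc 1 N, (#n.divisors : ℝ) ^ (k + 1) / n ≤ ∑ p ∈ n.divisorsAntidiagonal,
        ((#p.1.divisors : ℝ) ^ k / p.1) * ((#p.2.divisors : ℝ) ^ k / p.2) := by
      intro n _
      have h2 : (#n.divisors : ℝ) ^ (k + 1) / n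
          = ∑ p ∈ n.divisorsAntidiagonal, (#n.divisors : ℝ) ^ k / n := by
        rw [Finset.sum_const, nsmul_eq_mul, pow_succ']
        have : #n.divisorsAntidiagonal = #n.divisors := by
          rw [← Nat.map_div_right_divisors, Finset.card_map]
        rw [this]; ring
      rw [h2]
      refine sum_le_sum fun p hp => ?_
      rw [← (Nat.mem_divisorsAntidiagonal.mp hp).1, div_mul_div_comm, ← mul_pow]
      push_cast
      gcongr
      exact_mod_cast card_divisors_mul_le _ _
    refine (sum_le_sum h1).trans ?_
    rw [sum_Icc_divisorsAntidiagonal fun a b =>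
      ((#a.divisors : ℝ) ^ k / a) * ((#b.divisors : ℝ) ^ k / b)]
    calc _ ≤ ∑ a ∈ Icc 1 N, ∑ b ∈ Icc 1 N,
          ((#a.divisors : ℝ) ^ k / a) * ((#b.divisors : ℝ) ^ k / b) := by
          refine sum_le_sum fun a _ => sum_le_sum_of_subset_of_nonneg ?_ fun _ _ _ => by positivity
          exact Icc_subset_Icc_right (Nat.div_le_self _ _)
      _ = (∑ n ∈ Icc 1 N, (#n.divisors : ℝ) ^ k / n) ^ 2 := by
          rw [← Finset.sum_mul_sum, sq]
      _ ≤ _ := by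
          rw [pow_succ 2 k, pow_mul]
          gcongr

lemma sum_one_div_totient_le (N : ℕ) :
    ∑ n ∈ Icc 1 N, (1 / n.totient : ℝ) ≤ (1 + Real.log N) ^ 2 := by
  refine le_trans (sum_le_sum fun n hn => ?_) (by simpa using sum_card_divisors_pow_div_le 1 N)
  exact one_div_totient_le n (mem_Icc.mp hn).1

/-! ### Discrepancies: elementary properties and trivial bounds. -/

/-- The coefficient with which `f n` enters the discrepancy `Δ(f, x; q, a)`. -/
def discrepancyWeight (q : ℕ) (a : ZMod q) (n : ℕ) : ℂ :=
  (if (n : ZMod q) = a then 1 else 0) - (1 / (q.totient : ℂ)) * (if n.Coprime q then 1 else 0)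

lemma discrepancy_eq_sum (h : ℕ → ℂ) (y : ℝ) (q : ℕ) (a : ZMod q) :
    discrepancy h y q a = ∑ n ∈ Icc 1 ⌊y⌋₊, h n * discrepancyWeight q a n := by
  rw [discrepancy, Finset.sum_filter, Finset.sum_filter, Finset.mul_sum, ← Finset.sum_sub_distrib]
  refine sum_congr rfl fun n _ => ?_
  rw [discrepancyWeight]
  split_ifs <;> ring

/-- By orthogonality the residue class indicator is an average over all characters; the subtracted
mean is exactly the contribution of the principal one. -/
lemma discrepancyWeight_eq_sum {q : ℕ} [NeZero q] (a : (ZMod q)ˣ) (n : ℕ) :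
    discrepancyWeight q a n = (1 / (q.totient : ℂ)) *
      ∑ χ ∈ (univ : Finset (DirichletCharacter ℂ q)).erase 1, χ⁻¹ a * χ n := by
  have hφ : (q.totient : ℂ) ≠ 0 := by
    exact_mod_cast (Nat.totient_pos.mpr (Nat.pos_of_ne_zero (NeZero.ne q))).ne'
  have h1 : ∑ χ : DirichletCharacter ℂ q, χ⁻¹ a * χ n
      = if (n : ZMod q) = a then (q.totient : ℂ) else 0 := by
    by_cases hn : IsUnit (n : ZMod q)
    · obtain ⟨v, hv⟩ := hn
      rw [← hv, sum_inv_apply_mul_apply]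
      simp [Units.val_inj, eq_comm]
    · have hne : (n : ZMod q) ≠ a := fun h => hn (by rw [h]; exact a.isUnit)
      rw [if_neg hne]
      exact sum_eq_zero fun χ _ => by rw [χ.map_nonunit hn, mul_zero]
  have h2 := Finset.add_sum_erase univ (fun χ : DirichletCharacter ℂ q => χ⁻¹ a * χ n) (mem_univ 1)
  rw [h1] at h2
  have h3 : (1 : DirichletCharacter ℂ q)⁻¹ a * (1 : DirichletCharacter ℂ q) n
      = if n.Coprime q then 1 else 0 := by
    rw [inv_one, MulChar.one_apply_coe, one_mul]
    split_ifs with h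
    · exact MulChar.one_apply ((ZMod.isUnit_iff_coprime n q).mpr h)
    · exact MulChar.map_nonunit _ (fun h' => h ((ZMod.isUnit_iff_coprime n q).mp h'))
  rw [h3] at h2
  rw [discrepancyWeight, eq_sub_of_add_eq' h2, mul_sub]
  congr 1
  split_ifs
  · field_simp
  · simp

lemma discrepancyWeight_eq_zero {q : ℕ} (a : (ZMod q)ˣ) {n : ℕ} (hn : ¬ n.Coprime q) :
    discrepancyWeight q a n = 0 := by
  rw [discrepancyWeight, if_neg hn, if_neg, mul_zero, sub_zero]
  intro h
  exact hn ((ZMod.isUnit_iff_coprime n q).mp (h ▸ a.isUnit))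

lemma discrepancyWeight_mul {q : ℕ} (a : (ZMod q)ˣ) {m : ℕ} (hm : m.Coprime q) (n : ℕ) :
    discrepancyWeight q a (m * n)
      = discrepancyWeight q ((a * (ZMod.unitOfCoprime m hm)⁻¹ : (ZMod q)ˣ) : ZMod q) n := by
  have h1 : (m * n).Coprime q ↔ n.Coprime q := by
    rw [Nat.coprime_mul_iff_left]
    exact and_iff_right hm
  simp only [discrepancyWeight, h1]
  congr 2
  rw [eq_iff_iff, Units.val_mul, Units.eq_mul_inv_iff_mul_eq, ZMod.coe_unitOfCoprime, Nat.cast_mul, mul_comm]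

/-- The largest discrepancy of `h` up to `y` over the residue classes coprime to `q`. -/
def maxDiscrepancy (h : ℕ → ℂ) (y : ℝ) (q : ℕ) : ℝ :=
  ⨆ a : (ZMod q)ˣ, ‖discrepancy h y q (a : ZMod q)‖

/-- The sum over moduli `q ≤ Q` of the largest discrepancy modulo `q`. -/
def totalDiscrepancy (h : ℕ → ℂ) (y : ℝ) (Q : ℕ) : ℝ :=
  ∑ q ∈ Icc 1 Q, maxDiscrepancy h y q

lemma norm_discrepancy_le_max (h : ℕ → ℂ) (y : ℝ) {q : ℕ} (hq : 1 ≤ q) (a : (ZMod q)ˣ) :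
    ‖discrepancy h y q a‖ ≤ maxDiscrepancy h y q := by
  have : NeZero q := ⟨by omega⟩
  exact le_ciSup (f := fun a : (ZMod q)ˣ => ‖discrepancy h y q (a : ZMod q)‖)
    (Set.finite_range _).bddAbove a

lemma maxDiscrepancy_le {h : ℕ → ℂ} {y : ℝ} {q : ℕ} {M : ℝ}
    (hM : ∀ a : (ZMod q)ˣ, ‖discrepancy h y q a‖ ≤ M) : maxDiscrepancy h y q ≤ M :=
  ciSup_le hM

lemma maxDiscrepancy_nonneg (h : ℕ → ℂ) (y : ℝ) (q : ℕ) : 0 ≤ maxDiscrepancy h y q :=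
  Real.iSup_nonneg fun _ => norm_nonneg _

lemma totalDiscrepancy_nonneg (h : ℕ → ℂ) (y : ℝ) (Q : ℕ) : 0 ≤ totalDiscrepancy h y Q :=
  sum_nonneg fun _ _ => maxDiscrepancy_nonneg _ _ _

lemma totalDiscrepancy_mono (h : ℕ → ℂ) (y : ℝ) {Q Q' : ℕ} (hQ : Q ≤ Q') :
    totalDiscrepancy h y Q ≤ totalDiscrepancy h y Q' :=
  sum_le_sum_of_subset_of_nonneg (Icc_subset_Icc_right hQ)
    fun _ _ _ => maxDiscrepancy_nonneg _ _ _

lemma totalDiscrepancy_floor (h : ℕ → ℂ) (y : ℝ) (Q : ℕ) :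
    totalDiscrepancy h (⌊y⌋₊ : ℝ) Q = totalDiscrepancy h y Q := by
  simp only [totalDiscrepancy, maxDiscrepancy, discrepancy_eq_sum, Nat.floor_natCast]

/-- If `h` is a linear combination of discrepancies of functions `k i`, then its total discrepancy
is bounded by that of the `k i`. -/
lemma totalDiscrepancy_le_sum {ι : Type*} (s : Finset ι) (c : ι → ℝ)
    (h : ℕ → ℂ) (y : ℝ) (k : ι → ℕ → ℂ) (z : ι → ℝ) (Q : ℕ)
    (hle : ∀ q ∈ Icc 1 Q, ∀ a : (ZMod q)ˣ,
      ‖discrepancy h y q a‖ ≤ ∑ i ∈ s, c i * maxDiscrepancy (k i) (z i) q) :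
    totalDiscrepancy h y Q ≤ ∑ i ∈ s, c i * totalDiscrepancy (k i) (z i) Q := by
  simp only [totalDiscrepancy, Finset.mul_sum]
  rw [Finset.sum_comm]
  exact sum_le_sum fun q hq => maxDiscrepancy_le (hle q hq)

lemma discrepancy_add (h k : ℕ → ℂ) (y : ℝ) (q : ℕ) (a : ZMod q) :
    discrepancy (fun n => h n + k n) y q a = discrepancy h y q a + discrepancy k y q a := by
  simp only [discrepancy_eq_sum, add_mul, Finset.sum_add_distrib]

lemma totalDiscrepancy_add_le (h k : ℕ → ℂ) (y : ℝ) (Q : ℕ) :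
    totalDiscrepancy (fun n => h n + k n) y Q
      ≤ totalDiscrepancy h y Q + totalDiscrepancy k y Q := by
  rw [totalDiscrepancy, totalDiscrepancy, totalDiscrepancy, ← Finset.sum_add_distrib]
  refine sum_le_sum fun q hq => maxDiscrepancy_le fun a => ?_
  have hq1 := (mem_Icc.mp hq).1
  rw [discrepancy_add]
  exact (norm_add_le _ _).trans (add_le_add (norm_discrepancy_le_max _ _ hq1 a)
    (norm_discrepancy_le_max _ _ hq1 a))

lemma totalDiscrepancy_neg (h : ℕ → ℂ) (y : ℝ) (Q : ℕ) :
    totalDiscrepancy (fun n => -h n) y Q = totalDiscrepancy h y Q := by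
  simp only [totalDiscrepancy, maxDiscrepancy, discrepancy_eq_sum, neg_mul, Finset.sum_neg_distrib,
    norm_neg]

lemma norm_discrepancyWeight_le (q : ℕ) (a : ZMod q) (n : ℕ) : ‖discrepancyWeight q a n‖ ≤ 2 := by
  rw [discrepancyWeight]
  refine (norm_sub_le _ _).trans ?_
  have h1 : ‖(if (n : ZMod q) = a then 1 else 0 : ℂ)‖ ≤ 1 := by split_ifs <;> simp
  have h2 : ‖(1 / (q.totient : ℂ)) * (if n.Coprime q then 1 else 0 : ℂ)‖ ≤ 1 := by
    rw [norm_mul, norm_div, norm_one, Complex.norm_natCast]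
    have h3 : ‖(if n.Coprime q then 1 else 0 : ℂ)‖ ≤ 1 := by split_ifs <;> simp
    have h4 : (1 / q.totient : ℝ) ≤ 1 := by
      rcases Nat.eq_zero_or_pos q.totient with h | h
      · rw [h]; simp
      · rw [div_le_one (by exact_mod_cast h)]; exact_mod_cast h
    calc _ ≤ (1 : ℝ) * 1 := by gcongr
      _ = 1 := one_mul 1
  linarith

lemma norm_discrepancy_le_sum (h : ℕ → ℂ) (y : ℝ) (q : ℕ) (a : ZMod q) :
    ‖discrepancy h y q a‖ ≤ 2 * ∑ n ∈ Icc 1 ⌊y⌋₊, ‖h n‖ := by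
  rw [discrepancy_eq_sum, Finset.mul_sum]
  refine (norm_sum_le _ _).trans (sum_le_sum fun n _ => ?_)
  rw [norm_mul, mul_comm]
  exact mul_le_mul_of_nonneg_right (norm_discrepancyWeight_le _ _ _) (norm_nonneg _)

lemma totalDiscrepancy_le_card_mul (h : ℕ → ℂ) (y : ℝ) (Q : ℕ) :
    totalDiscrepancy h y Q ≤ Q * (2 * ∑ n ∈ Icc 1 ⌊y⌋₊, ‖h n‖) := by
  rw [totalDiscrepancy]
  refine (sum_le_sum fun q _ => maxDiscrepancy_le fun a : (ZMod q)ˣ =>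
    norm_discrepancy_le_sum h y q (a : ZMod q)).trans ?_
  rw [Finset.sum_const, Nat.card_Icc, nsmul_eq_mul, Nat.add_sub_cancel]

lemma card_filter_natCast_eq_le (N : ℕ) {q : ℕ} (a : ZMod q) :
    #{n ∈ Icc 1 N | ((n : ℕ) : ZMod q) = a} ≤ N / q + 1 := by
  rw [← Finset.card_range (N / q + 1)]
  refine Finset.card_le_card_of_injOn (fun n => n / q) ?_ ?_
  · intro n hn
    simp only [coe_filter, Set.mem_ofPred_eq, mem_Icc] at hn
    simp only [coe_range, Set.mem_Iio]
    exact Nat.lt_succ_of_le (Nat.div_le_div_right hn.1.2)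
  · intro n hn m hm h
    simp only [coe_filter, Set.mem_ofPred_eq] at hn hm
    have h1 : (n : ZMod q) = m := hn.2.trans hm.2.symm
    rw [ZMod.natCast_eq_natCast_iff'] at h1
    rw [← Nat.div_add_mod n q, ← Nat.div_add_mod m q, h1]
    simp only at h
    rw [h]

lemma norm_discrepancy_le_of_bounded {h : ℕ → ℂ} {y W : ℝ} (hy : 0 ≤ y) (hW0 : 0 ≤ W)
    (hW : ∀ n ∈ Icc 1 ⌊y⌋₊, ‖h n‖ ≤ W) {q : ℕ} (hq : 1 ≤ q) (a : ZMod q) :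
    ‖discrepancy h y q a‖ ≤ W * (2 * y * (1 / q.totient) + 1) := by
  have hφ : (0 : ℝ) < q.totient := by exact_mod_cast Nat.totient_pos.mpr hq
  have hfl : (⌊y⌋₊ : ℝ) ≤ y := Nat.floor_le hy
  have key : ∀ s ⊆ Icc 1 ⌊y⌋₊, ‖∑ n ∈ s, h n‖ ≤ #s * W := by
    intro s hs
    refine (norm_sum_le _ _).trans ?_
    rw [← nsmul_eq_mul, ← Finset.sum_const]
    exact sum_le_sum fun n hn => hW n (hs hn)
  rw [discrepancy]
  refine (norm_sub_le _ _).trans ?_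
  have h1 := key _ (filter_subset (fun n : ℕ => (n : ZMod q) = a) _)
  have h2 := key _ (filter_subset (fun n : ℕ => n.Coprime q) (Icc 1 ⌊y⌋₊))
  have c1 : (#{n ∈ Icc 1 ⌊y⌋₊ | ((n : ℕ) : ZMod q) = a} : ℝ) ≤ y * (1 / q.totient) + 1 := by
    have h3 : (#{n ∈ Icc 1 ⌊y⌋₊ | ((n : ℕ) : ZMod q) = a} : ℝ) ≤ ((⌊y⌋₊ / q + 1 : ℕ) : ℝ) := by
      exact_mod_cast card_filter_natCast_eq_le _ a
    refine h3.trans ?_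
    push_cast
    have h4 : ((⌊y⌋₊ / q : ℕ) : ℝ) ≤ (⌊y⌋₊ : ℝ) / q := Nat.cast_div_le
    have h5 : (⌊y⌋₊ : ℝ) / q ≤ y / q.totient := by
      gcongr
      exact_mod_cast Nat.totient_le q
    rw [mul_one_div]
    linarith
  have c2 : (#{n ∈ Icc 1 ⌊y⌋₊ | Nat.Coprime n q} : ℝ) ≤ y := by
    refine le_trans ?_ hfl
    have := card_filter_le (Icc 1 ⌊y⌋₊) fun n => Nat.Coprime n q
    rw [Nat.card_Icc, Nat.add_sub_cancel] at this
    exact_mod_cast this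
  rw [norm_mul, norm_div, norm_one, Complex.norm_natCast]
  have h3 : (1 / q.totient : ℝ) * ‖∑ n ∈ Icc 1 ⌊y⌋₊ with Nat.Coprime n q, h n‖
      ≤ (1 / q.totient) * (y * W) := by
    refine mul_le_mul_of_nonneg_left (h2.trans ?_) (by positivity)
    gcongr
  have h4 := h1.trans (mul_le_mul_of_nonneg_right c1 hW0)
  calc _ ≤ (y * (1 / q.totient) + 1) * W + (1 / q.totient) * (y * W) := add_le_add h4 h3
    _ = _ := by ring

lemma totalDiscrepancy_le_of_bounded {h : ℕ → ℂ} {y W : ℝ} (hy : 0 ≤ y) (hW0 : 0 ≤ W)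
    (hW : ∀ n ∈ Icc 1 ⌊y⌋₊, ‖h n‖ ≤ W) (Q : ℕ) :
    totalDiscrepancy h y Q ≤ W * (2 * y * (1 + Real.log Q) ^ 2 + Q) := by
  rw [totalDiscrepancy]
  refine (sum_le_sum fun q hq => maxDiscrepancy_le fun a : (ZMod q)ˣ =>
    norm_discrepancy_le_of_bounded hy hW0 hW (mem_Icc.mp hq).1 (a : ZMod q)).trans ?_
  rw [← Finset.mul_sum, Finset.sum_add_distrib, ← Finset.mul_sum]
  simp only [Finset.sum_const, Nat.card_Icc, Nat.add_sub_cancel, nsmul_eq_mul, mul_one]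
  gcongr
  exact sum_one_div_totient_le Q

/-- Discrete summation by parts. -/
lemma sum_Icc_mul_by_parts {R : Type*} [CommRing R] (c w : ℕ → R) {N : ℕ} (hN : 1 ≤ N) :
    ∑ n ∈ Icc 1 N, c n * w n = w N * ∑ n ∈ Icc 1 N, c n
      - ∑ n ∈ Ico 1 N, (w (n + 1) - w n) * ∑ k ∈ Icc 1 n, c k := by
  induction N, hN using Nat.le_induction with
  | base => simp [mul_comm]
  | succ N hN ih =>
    rw [Finset.sum_Icc_succ_top (by omega), ih, Finset.sum_Ico_succ_top hN,
      Finset.sum_Icc_succ_top (by omega)]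
    ring

lemma discrepancy_mul_by_parts (h : ℕ → ℂ) (w : ℕ → ℂ) {N : ℕ} (hN : 1 ≤ N) (q : ℕ)
    (a : ZMod q) :
    discrepancy (fun n => h n * w n) N q a = w N * discrepancy h N q a
      - ∑ n ∈ Ico 1 N, (w (n + 1) - w n) * discrepancy h n q a := by
  simp only [discrepancy_eq_sum, Nat.floor_natCast]
  rw [← sum_Icc_mul_by_parts (fun n => h n * discrepancyWeight q a n) w hN]
  exact sum_congr rfl fun n _ => by ring

lemma totalDiscrepancy_mul_le (h : ℕ → ℂ) (w : ℕ → ℂ) {N : ℕ} (hN : 1 ≤ N) (Q : ℕ) :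
    totalDiscrepancy (fun n => h n * w n) N Q ≤ ‖w N‖ * totalDiscrepancy h N Q
      + ∑ n ∈ Ico 1 N, ‖w (n + 1) - w n‖ * totalDiscrepancy h n Q := by
  simp only [totalDiscrepancy, Finset.mul_sum]
  rw [Finset.sum_comm (s := Ico 1 N), ← Finset.sum_add_distrib]
  refine sum_le_sum fun q hq => maxDiscrepancy_le fun a => ?_
  have hq1 := (mem_Icc.mp hq).1
  rw [discrepancy_mul_by_parts h w hN]
  refine (norm_sub_le _ _).trans (add_le_add ?_ ((norm_sum_le _ _).trans (sum_le_sum fun n _ => ?_)))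
  all_goals
    rw [norm_mul]
    exact mul_le_mul_of_nonneg_left (norm_discrepancy_le_max _ _ hq1 a) (norm_nonneg _)

/-- Partial summation solved for its boundary term; this is what allows a weight such as log n to be
removed. -/
lemma mul_totalDiscrepancy_le (h : ℕ → ℂ) (w : ℕ → ℂ) {N : ℕ} (hN : 1 ≤ N) (Q : ℕ) :
    ‖w N‖ * totalDiscrepancy h N Q ≤ totalDiscrepancy (fun n => h n * w n) N Q
      + ∑ n ∈ Ico 1 N, ‖w (n + 1) - w n‖ * totalDiscrepancy h n Q := by
  simp only [totalDiscrepancy, Finset.mul_sum]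
  rw [Finset.sum_comm (s := Ico 1 N), ← Finset.sum_add_distrib]
  refine sum_le_sum fun q hq => ?_
  have hq1 := (mem_Icc.mp hq).1
  rw [maxDiscrepancy, Real.mul_iSup_of_nonneg (norm_nonneg _)]
  refine ciSup_le fun a => ?_
  have h1 : w N * discrepancy h N q a = discrepancy (fun n => h n * w n) N q a
      + ∑ n ∈ Ico 1 N, (w (n + 1) - w n) * discrepancy h n q a := by
    rw [discrepancy_mul_by_parts h w hN]; ring
  rw [← norm_mul, h1]
  refine (norm_add_le _ _).trans (add_le_add (norm_discrepancy_le_max _ _ hq1 a)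
    ((norm_sum_le _ _).trans (sum_le_sum fun n _ => ?_)))
  rw [norm_mul]
  exact mul_le_mul_of_nonneg_left (norm_discrepancy_le_max _ _ hq1 a) (norm_nonneg _)

lemma sum_dirichletConv_mul (u v : ℕ → ℂ) (W : ℕ → ℂ) (N : ℕ) :
    ∑ n ∈ Icc 1 N, dirichletConv u v n * W n
      = ∑ a ∈ Icc 1 N, u a * ∑ b ∈ Icc 1 (N / a), v b * W (a * b) := by
  simp only [Finset.mul_sum]
  rw [← sum_Icc_divisorsAntidiagonal fun a b => u a * (v b * W (a * b))]
  refine sum_congr rfl fun n _ => ?_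
  rw [dirichletConv, Finset.sum_mul]
  refine sum_congr rfl fun p hp => ?_
  rw [(Nat.mem_divisorsAntidiagonal.mp hp).1]
  ring

/-- For `a` coprime to `q` the inner sum is a discrepancy of `v` up to y/a, in the class divided by
`a`; for other `a` every weight vanishes. -/
lemma totalDiscrepancy_dirichletConv_le (u v : ℕ → ℂ) (y : ℝ) (Q : ℕ) :
    totalDiscrepancy (dirichletConv u v) y Q
      ≤ ∑ a ∈ Icc 1 ⌊y⌋₊, ‖u a‖ * totalDiscrepancy v (y / a) Q := by
  refine totalDiscrepancy_le_sum (Icc 1 ⌊y⌋₊) (fun a => ‖u a‖) _ _ (fun _ => v)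
    (fun a => y / a) Q fun q hq c => ?_
  have hq1 := (mem_Icc.mp hq).1
  rw [discrepancy_eq_sum, sum_dirichletConv_mul]
  refine (norm_sum_le _ _).trans (sum_le_sum fun a _ => ?_)
  rw [norm_mul]
  refine mul_le_mul_of_nonneg_left ?_ (norm_nonneg _)
  by_cases ha : a.Coprime q
  · simp_rw [discrepancyWeight_mul c ha]
    rw [← Nat.floor_div_natCast, ← discrepancy_eq_sum]
    exact norm_discrepancy_le_max _ _ hq1 _
  · rw [Finset.sum_eq_zero, norm_zero]
    · exact maxDiscrepancy_nonneg _ _ _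
    · intro b _
      rw [discrepancyWeight_eq_zero, mul_zero]
      exact fun h => ha (Nat.Coprime.coprime_mul_right h)

/-! ### Reduction to primitive characters. -/

lemma apply_eq_ite_primitiveCharacter {q : ℕ} (χ : DirichletCharacter ℂ q) (n : ℕ) :
    χ n = if n.Coprime q then χ.primitiveCharacter n else 0 := by
  split_ifs with h
  · have h1 := χ.primitiveCharacter_apply_of_isCoprime (a := (n : ℤ))
      (Nat.isCoprime_iff_coprime.mpr h)
    simpa using h1.symm
  · exact χ.map_nonunit fun h' => h ((ZMod.isUnit_iff_coprime n q).mp h')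

/-- ψ already vanishes at integers not coprime to `r`, so only coprimality to the cofactor `m` has
to be imposed. -/
lemma sum_filter_coprime_mul_apply {r : ℕ} (ψ : DirichletCharacter ℂ r) (h : ℕ → ℂ)
    (s : Finset ℕ) (m : ℕ) :
    ∑ n ∈ s with n.Coprime (m * r), h n * ψ n = ∑ n ∈ s with n.Coprime m, h n * ψ n := by
  rw [Finset.sum_filter, Finset.sum_filter]
  refine sum_congr rfl fun n _ => ?_
  by_cases hr : n.Coprime r
  · have h1 : n.Coprime (m * r) ↔ n.Coprime m := by
      rw [Nat.coprime_mul_iff_right]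
      exact and_iff_left hr
    simp only [h1]
  · rw [ψ.map_nonunit fun h' => hr ((ZMod.isUnit_iff_coprime n r).mp h')]
    simp

/-- Grouping the nonprincipal characters modulo `q` by the primitive characters inducing them. -/
lemma sum_nonprincipal_le {q : ℕ} [NeZero q] (h : ℕ → ℂ) (s : Finset ℕ) :
    ∑ χ ∈ (univ : Finset (DirichletCharacter ℂ q)).erase 1, ‖∑ n ∈ s, h n * χ n‖
      ≤ ∑ p ∈ q.divisorsAntidiagonal, if 1 < p.2 then
        ∑ ψ ∈ primitiveCharacters p.2, ‖∑ n ∈ s with n.Coprime p.1, h n * ψ n‖ else 0 := by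
  classical
  set G : (Σ r : ℕ, DirichletCharacter ℂ r) → ℝ :=
    fun p => ‖∑ n ∈ s with n.Coprime q, h n * p.2 n‖ with hG
  set i : DirichletCharacter ℂ q → (Σ r : ℕ, DirichletCharacter ℂ r) :=
    fun χ => ⟨χ.conductor, χ.primitiveCharacter⟩ with hi
  have hinj : Function.Injective i := by
    -- A left inverse: the primitive character induces χ back at level q. The value 1 at moduli not
    -- dividing q is never reached from the image of `i`.
    let j : (Σ r : ℕ, DirichletCharacter ℂ r) → DirichletCharacter ℂ q :=
      fun p => if hp : p.1 ∣ q then DirichletCharacter.changeLevel hp p.2 else 1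
    refine Function.LeftInverse.injective (g := j) fun χ => ?_
    simp only [j, hi]
    rw [dif_pos χ.conductor_dvd_level]
    exact χ.changeLevel_primitiveCharacter
  have h1 : ∀ χ ∈ (univ : Finset (DirichletCharacter ℂ q)).erase 1,
      ‖∑ n ∈ s, h n * χ n‖ = G (i χ) := by
    intro χ _
    simp only [hG, hi]
    rw [Finset.sum_filter]
    congr 1
    refine sum_congr rfl fun n _ => ?_
    rw [apply_eq_ite_primitiveCharacter χ n]
    split_ifs <;> simp
  have h2 : ∑ χ ∈ (univ : Finset (DirichletCharacter ℂ q)).erase 1, ‖∑ n ∈ s, h n * χ n‖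
      ≤ ∑ p ∈ (q.divisors.filter (1 < ·)).sigma primitiveCharacters, G p := by
    rw [sum_congr rfl h1, ← Finset.sum_image (g := i) (f := G) hinj.injOn]
    refine sum_le_sum_of_subset_of_nonneg ?_ fun _ _ _ => norm_nonneg _
    intro p hp
    obtain ⟨χ, hχ, rfl⟩ := mem_image.mp hp
    have hχ1 : χ ≠ 1 := ne_of_mem_erase hχ
    have hc0 : χ.conductor ≠ 0 := χ.conductor_ne_zero
    have : NeZero χ.conductor := ⟨hc0⟩
    have hc1 : χ.conductor ≠ 1 := fun hc => hχ1 (χ.eq_one_iff_conductor_eq_one.mpr hc)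
    rw [mem_sigma, mem_filter, Nat.mem_divisors]
    exact ⟨⟨⟨χ.conductor_dvd_level, NeZero.ne q⟩, by simp only [hi]; omega⟩,
      mem_primitiveCharacters.mpr χ.primitiveCharacter_isPrimitive⟩
  refine h2.trans (le_of_eq ?_)
  rw [Finset.sum_sigma, Finset.sum_filter]
  have h3 := Nat.sum_divisorsAntidiagonal' (n := q) (fun m r => if 1 < r then
        ∑ ψ ∈ primitiveCharacters r, ‖∑ n ∈ s with n.Coprime m, h n * ψ n‖ else 0)
  rw [h3]
  refine sum_congr rfl fun r hr => ?_
  split_ifs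
  · refine sum_congr rfl fun ψ _ => ?_
    simp only [hG]
    rw [← sum_filter_coprime_mul_apply ψ h s (q / r),
      Nat.div_mul_cancel (Nat.dvd_of_mem_divisors hr)]
  · rfl

lemma maxDiscrepancy_le_sum_characters (h : ℕ → ℂ) (y : ℝ) {q : ℕ} [NeZero q] :
    maxDiscrepancy h y q ≤ (1 / q.totient : ℝ) *
      ∑ χ ∈ (univ : Finset (DirichletCharacter ℂ q)).erase 1,
        ‖∑ n ∈ Icc 1 ⌊y⌋₊, h n * χ n‖ := by
  refine maxDiscrepancy_le fun a => ?_
  have h1 : discrepancy h y q a = (1 / (q.totient : ℂ)) *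
      ∑ χ ∈ (univ : Finset (DirichletCharacter ℂ q)).erase 1, χ⁻¹ a *
        ∑ n ∈ Icc 1 ⌊y⌋₊, h n * χ n := by
    rw [discrepancy_eq_sum]
    simp_rw [discrepancyWeight_eq_sum a, Finset.mul_sum]
    rw [Finset.sum_comm]
    exact sum_congr rfl fun χ _ => sum_congr rfl fun n _ => by ring
  rw [h1, norm_mul, norm_div, norm_one, Complex.norm_natCast]
  refine mul_le_mul_of_nonneg_left ((norm_sum_le _ _).trans (sum_le_sum fun χ _ => ?_))
    (by positivity)
  rw [norm_mul, DirichletCharacter.unit_norm_eq_one, one_mul]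

/-- Write q = m·r with r the conductor, r ≥ 2 for nonprincipal characters. Then φ(m)φ(r) ≤ φ(mr)
separates the weights, at the price of keeping the condition (n, m) = 1. -/
lemma totalDiscrepancy_le_sum_primitive (h : ℕ → ℂ) (y : ℝ) (Q : ℕ) :
    totalDiscrepancy h y Q ≤ ∑ m ∈ Icc 1 Q, (1 / m.totient : ℝ) *
      ∑ r ∈ Icc 2 Q, (1 / r.totient : ℝ) * ∑ ψ ∈ primitiveCharacters r,
        ‖∑ n ∈ Icc 1 ⌊y⌋₊ with n.Coprime m, h n * ψ n‖ := by
  set F : ℕ → ℕ → ℝ := fun m r => if 1 < r then (1 / m.totient : ℝ) * ((1 / r.totient : ℝ) *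
    ∑ ψ ∈ primitiveCharacters r, ‖∑ n ∈ Icc 1 ⌊y⌋₊ with n.Coprime m, h n * ψ n‖) else 0 with hF
  have hF0 : ∀ m r, 0 ≤ F m r := by
    intro m r
    simp only [hF]
    split_ifs
    · positivity
    · exact le_refl 0
  have h1 : totalDiscrepancy h y Q ≤ ∑ q ∈ Icc 1 Q, ∑ p ∈ q.divisorsAntidiagonal, F p.1 p.2 := by
    refine sum_le_sum fun q hq => ?_
    have : NeZero q := ⟨by have := (mem_Icc.mp hq).1; omega⟩
    refine (maxDiscrepancy_le_sum_characters h y).trans ((mul_le_mul_of_nonneg_left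
      (sum_nonprincipal_le h (Icc 1 ⌊y⌋₊)) (by positivity)).trans ?_)
    rw [Finset.mul_sum]
    refine sum_le_sum fun p hp => ?_
    obtain ⟨h2, h3⟩ := Nat.mem_divisorsAntidiagonal.mp hp
    simp only [hF]
    split_ifs
    · rw [← mul_assoc]
      refine mul_le_mul_of_nonneg_right ?_ (by positivity)
      rw [← h2] at h3 ⊢
      have h4 : 0 < p.1.totient :=
        Nat.totient_pos.mpr (Nat.pos_of_ne_zero (left_ne_zero_of_mul h3))
      have h5 : 0 < p.2.totient :=
        Nat.totient_pos.mpr (Nat.pos_of_ne_zero (right_ne_zero_of_mul h3))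
      have h6 : (p.1.totient * p.2.totient : ℝ) ≤ (p.1 * p.2).totient := by
        exact_mod_cast Nat.totient_super_multiplicative p.1 p.2
      rw [div_mul_div_comm, one_mul]
      gcongr
    · simp
  refine h1.trans ?_
  rw [sum_Icc_divisorsAntidiagonal]
  refine sum_le_sum fun m _ => ?_
  rw [Finset.mul_sum]
  calc _ ≤ ∑ r ∈ Icc 1 Q, F m r := sum_le_sum_of_subset_of_nonneg
        (Icc_subset_Icc_right (Nat.div_le_self _ _)) fun _ _ _ => hF0 _ _
    _ = ∑ r ∈ Icc 2 Q, F m r := by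
        symm
        refine sum_subset (Icc_subset_Icc_left (by omega)) fun r hr hr' => ?_
        simp only [mem_Icc] at hr hr'
        simp only [hF]
        rw [if_neg (by omega)]
    _ = _ := sum_congr rfl fun r hr => by
        simp only [hF]
        rw [if_pos (by have := (mem_Icc.mp hr).1; omega)]

/-! ### Bilinear sums against characters of large conductor. -/

/-- The large sieve output for dyadic lengths M, N and conductors of size ρ. Up to constants, it
expands into MN/ρ, (√M + √N)√(MN) and ρ√(MN). These give X/R₀ because ρ is at least R₀/2, X/√L
because neither length exceeds 4X/L, and √X·Q because ρ ≤ Q. -/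
lemma bilinear_dyadic_bound {M N ρ X L R₀ Q : ℝ} (hM : 0 ≤ M) (hN : 0 ≤ N) (hρ : 0 < ρ)
    (hX : 0 ≤ X) (hL : 0 < L) (hR₀ : 0 < R₀) (hMN : M * N ≤ 4 * X) (hML : M ≤ 4 * X / L)
    (hNL : N ≤ 4 * X / L) (hρ₀ : R₀ ≤ 2 * ρ) (hρQ : ρ ≤ Q) :
    √((M + (2 * ρ) ^ 2) * (N + (2 * ρ) ^ 2)) * (√M * √N) / ρ
      ≤ 16 * (X / R₀ + X / √L + √X * Q) := by
  have hl : 0 < √L := Real.sqrt_pos.mpr hL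
  have hs : 0 ≤ √X := Real.sqrt_nonneg X
  have hss : √X * √X = X := Real.mul_self_sqrt hX
  have ha : 0 ≤ √M := Real.sqrt_nonneg M
  have hb : 0 ≤ √N := Real.sqrt_nonneg N
  have hab : √M * √N ≤ 2 * √X := by
    rw [← Real.sqrt_mul hM, show (2 : ℝ) = √4 by
      rw [show (4 : ℝ) = 2 ^ 2 by norm_num]; exact (Real.sqrt_sq (by norm_num)).symm,
      ← Real.sqrt_mul (by norm_num)]
    exact Real.sqrt_le_sqrt hMN
  have key : ∀ Y, Y ≤ 4 * X / L → √Y ≤ 2 * √X / √L := by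
    intro Y hY
    refine (Real.sqrt_le_sqrt hY).trans (le_of_eq ?_)
    rw [Real.sqrt_div (by positivity), Real.sqrt_mul (by norm_num),
      show (4 : ℝ) = 2 ^ 2 by norm_num, Real.sqrt_sq (by norm_num)]
  have key2 : ∀ Y, 0 ≤ Y → √(Y + (2 * ρ) ^ 2) ≤ √Y + 2 * ρ := by
    intro Y hY
    rw [Real.sqrt_le_left (by positivity)]
    nlinarith [Real.sq_sqrt hY, Real.sqrt_nonneg Y]
  have h1 : √((M + (2 * ρ) ^ 2) * (N + (2 * ρ) ^ 2)) ≤ (√M + 2 * ρ) * (√N + 2 * ρ) := by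
    rw [Real.sqrt_mul (by positivity)]
    exact mul_le_mul (key2 M hM) (key2 N hN) (Real.sqrt_nonneg _) (by positivity)
  have e1 : (√M * √N) * (√M * √N) / ρ ≤ 8 * (X / R₀) := by
    rw [div_le_iff₀ hρ]
    have h2 : (√M * √N) * (√M * √N) ≤ (2 * √X) * (2 * √X) :=
      mul_le_mul hab hab (by positivity) (by positivity)
    have h3 : 1 ≤ 2 * ρ / R₀ := by rwa [le_div_iff₀ hR₀, one_mul]
    have h4 : 8 * (X / R₀) * ρ = 4 * X * (2 * ρ / R₀) := by ring
    rw [h4]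
    nlinarith
  have e2 : ∀ Y, Y ≤ 4 * X / L → √Y * (√M * √N) ≤ 4 * (X / √L) := by
    intro Y hY
    calc √Y * (√M * √N) ≤ (2 * √X / √L) * (2 * √X) :=
          mul_le_mul (key Y hY) hab (by positivity) (by positivity)
      _ = 4 * (√X * √X) / √L := by ring
      _ = _ := by rw [hss]; ring
  have e3 : ρ * (√M * √N) ≤ 2 * (√X * Q) := by
    calc ρ * (√M * √N) ≤ Q * (2 * √X) := mul_le_mul hρQ hab (by positivity) (by linarith)
      _ = _ := by ring
  have hXR : 0 ≤ X / R₀ := by positivity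
  calc _ ≤ (√M + 2 * ρ) * (√N + 2 * ρ) * (√M * √N) / ρ := by gcongr
    _ = (√M * √N) * (√M * √N) / ρ + 2 * (√M * (√M * √N)) + 2 * (√N * (√M * √N))
        + 4 * (ρ * (√M * √N)) := by field_simp; ring
    _ ≤ _ := by
        have := e2 M hML; have := e2 N hNL
        have : 0 ≤ √X * Q := by have : 0 ≤ Q := hρ.le.trans hρQ; positivity
        linarith

/-- The part `Nat.log 2 a = i` of the bilinear sum `∑_{ab ≤ X} u(a) v(b) χ(ab)`. -/
def dyadicBlock (u v : ℕ → ℂ) (X i : ℕ) {r : ℕ} (χ : DirichletCharacter ℂ r) : ℂ :=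
  ∑ a ∈ Icc 1 X with Nat.log 2 a = i, u a * ∑ b ∈ Icc 1 (X / a), v b * χ ((a * b : ℕ) : ZMod r)

lemma sum_dirichletConv_eq_sum_dyadicBlock (u v : ℕ → ℂ) (X : ℕ) {r : ℕ}
    (χ : DirichletCharacter ℂ r) :
    ∑ n ∈ Icc 1 X, dirichletConv u v n * χ n
      = ∑ i ∈ range (Nat.log 2 X + 1), dyadicBlock u v X i χ := by
  rw [sum_dirichletConv_mul u v (fun n => χ n)]
  symm
  refine Finset.sum_fiberwise_of_maps_to ?_ _
  intro a ha
  rw [mem_range]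
  exact Nat.lt_succ_of_le (Nat.log_mono_right (mem_Icc.mp ha).2)

/-- In the first case every `a` of the block is at most L, in the second every `b`. Hence only
blocks with both lengths beyond L (up to a factor 2) survive. -/
lemma dyadicBlock_eq_zero {u v : ℕ → ℂ} {X L i r : ℕ} (hu : ∀ n ≤ L, u n = 0)
    (hv : ∀ n ≤ L, v n = 0) (h : 2 ^ (i + 1) ≤ L ∨ X / 2 ^ i ≤ L) (χ : DirichletCharacter ℂ r) :
    dyadicBlock u v X i χ = 0 := by
  refine Finset.sum_eq_zero fun a ha => ?_
  rw [mem_filter, mem_Icc] at ha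
  obtain ⟨⟨ha1, -⟩, hai⟩ := ha
  rcases h with h | h
  · have : a < 2 ^ (i + 1) := hai ▸ Nat.lt_pow_succ_log_self (by norm_num) a
    rw [hu a (by omega), zero_mul]
  · have h2 : 2 ^ i ≤ a := hai ▸ Nat.pow_log_le_self 2 (by omega)
    have h3 : X / a ≤ X / 2 ^ i := Nat.div_le_div_left h2 (by positivity)
    rw [Finset.sum_eq_zero, mul_zero]
    intro b hb
    rw [hv b (by have := (mem_Icc.mp hb).2; omega), zero_mul]

/-- Puts a block in the shape of `large_sieve_cutoff`. The minimum with X / 2 ^ i + 1 changes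
nothing on the block, but makes the cutoff at most the length of the second variable for every `m`.
-/
lemma dyadicBlock_eq (u v : ℕ → ℂ) (X i : ℕ) {r : ℕ} (χ : DirichletCharacter ℂ r) :
    dyadicBlock u v X i χ = ∑ m ∈ range (2 ^ (i + 1)),
      ∑ n ∈ range (X / 2 ^ i + 1) with n < min (X / m + 1) (X / 2 ^ i + 1),
        (if 1 ≤ m ∧ m ≤ X ∧ Nat.log 2 m = i then u m else 0) * (if 1 ≤ n then v n else 0) *
          (χ m * χ n) := by
  have h1 : ∀ m ∈ range (2 ^ (i + 1)),
      ∑ n ∈ range (X / 2 ^ i + 1) with n < min (X / m + 1) (X / 2 ^ i + 1),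
        (if 1 ≤ m ∧ m ≤ X ∧ Nat.log 2 m = i then u m else 0) * (if 1 ≤ n then v n else 0) *
          (χ m * χ n)
      = if m ∈ (Icc 1 X).filter (fun a => Nat.log 2 a = i) then
        u m * ∑ b ∈ Icc 1 (X / m), v b * χ ((m * b : ℕ) : ZMod r) else 0 := by
    intro m _
    simp only [mem_filter, mem_Icc, and_assoc]
    split_ifs with hm
    · have h2 : 2 ^ i ≤ m := hm.2.2 ▸ Nat.pow_log_le_self 2 (by omega)
      have h3 : X / m ≤ X / 2 ^ i := Nat.div_le_div_left h2 (by positivity)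
      rw [Finset.mul_sum]
      symm
      refine Finset.sum_subset_zero_on_sdiff ?_ ?_ ?_
      · intro n hn
        simp only [mem_Icc, mem_filter, mem_range] at hn ⊢
        omega
      · intro n hn
        simp only [Finset.mem_sdiff, mem_Icc, mem_filter, mem_range] at hn
        rw [if_neg (by omega)]
        simp
      · intro n hn
        rw [if_pos (mem_Icc.mp hn).1, Nat.cast_mul, map_mul]
        ring
    · simp
  rw [sum_congr rfl h1, dyadicBlock, ← Finset.sum_filter]
  refine sum_congr ?_ fun _ _ => rfl
  ext m
  simp only [mem_filter, mem_Icc, mem_range]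
  constructor
  · rintro ⟨h2, h3⟩
    exact ⟨h3 ▸ Nat.lt_pow_succ_log_self (by norm_num) m, h2, h3⟩
  · exact fun h => h.2

/-- On the dyadic range 2^j ≤ r the weight 1/φ(r) is at most 2^(-j) times the large sieve weight
r/φ(r); the sum can then be extended to all r ≤ 2^(j+1). -/
lemma sum_dyadicBlock_le {u v : ℕ → ℂ} {X L i j Q R₀ : ℕ} {W : ℝ} (hW : 0 ≤ W) (hL : 1 ≤ L)
    (hR₀ : 1 ≤ R₀)
    (hu : ∀ n ≤ L, u n = 0) (hv : ∀ n ≤ L, v n = 0) (huW : ∀ n ∈ Icc 1 X, ‖u n‖ ≤ W)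
    (hvW : ∀ n ∈ Icc 1 X, ‖v n‖ ≤ W) :
    ∑ r ∈ Ioc R₀ Q with Nat.log 2 r = j, (1 / r.totient : ℝ) * ∑ χ ∈ primitiveCharacters r,
        ‖dyadicBlock u v X i χ‖
      ≤ (16 * (4 + sumInvSq)) * (W ^ 2 * (2 + Real.log (X + 1)) *
        (X / R₀ + X / √L + √X * Q)) := by
  have hc := sumInvSq_nonneg
  have hlog : 0 ≤ Real.log (X + 1) := Real.log_nonneg (by
    have : (0 : ℝ) ≤ X := by positivity
    linarith)
  have hpos : 0 ≤ (16 * (4 + sumInvSq)) * (W ^ 2 * (2 + Real.log (X + 1)) *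
        (X / R₀ + X / √L + √X * Q)) := by positivity
  by_cases hi : 2 ^ (i + 1) ≤ L ∨ X / 2 ^ i ≤ L
  · simp only [dyadicBlock_eq_zero hu hv hi, norm_zero, Finset.sum_const_zero, mul_zero]
    exact hpos
  push Not at hi
  rcases Finset.eq_empty_or_nonempty ((Ioc R₀ Q).filter fun r => Nat.log 2 r = j) with he | hne
  · rw [he, Finset.sum_empty]; exact hpos
  -- A single modulus in the range certifies R₀ ≤ 2·2^j and 2^j ≤ Q, as `bilinear_dyadic_bound`
  -- requires.
  obtain ⟨r₀, hr₀⟩ := hne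
  rw [mem_filter, mem_Ioc] at hr₀
  set α : ℕ → ℂ := fun m => if 1 ≤ m ∧ m ≤ X ∧ Nat.log 2 m = i then u m else 0 with hα
  set β : ℕ → ℂ := fun n => if 1 ≤ n then v n else 0 with hβ
  set M := 2 ^ (i + 1) with hM
  set N := X / 2 ^ i + 1 with hN
  set ρ : ℝ := 2 ^ j with hρ
  have hρ0 : 0 < ρ := by positivity
  have hLS := large_sieve_cutoff α β M (2 ^ (j + 1)) (N := N) (by omega)
    (fun m => min (X / m + 1) N) (fun m => min_le_right _ _)
  have h1 : ∑ r ∈ Ioc R₀ Q with Nat.log 2 r = j, (1 / r.totient : ℝ) *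
      ∑ χ ∈ primitiveCharacters r, ‖dyadicBlock u v X i χ‖
      ≤ (∑ r ∈ (Icc 1 (2 ^ (j + 1)) : Finset ℕ), (r / r.totient : ℝ) * ∑ χ ∈ primitiveCharacters r,
        ‖∑ m ∈ range M, ∑ n ∈ range N with n < min (X / m + 1) N,
          α m * β n * (χ m * χ n)‖) / ρ := by
    rw [Finset.sum_div]
    calc _ ≤ ∑ r ∈ Ioc R₀ Q with Nat.log 2 r = j, (r / r.totient : ℝ) *
        (∑ χ ∈ primitiveCharacters r, ‖∑ m ∈ range M, ∑ n ∈ range N with n < min (X / m + 1) N,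
          α m * β n * (χ m * χ n)‖) / ρ := by
          refine sum_le_sum fun r hr => ?_
          rw [mem_filter, mem_Ioc] at hr
          simp_rw [dyadicBlock_eq]
          have h2 : ρ ≤ r := by
            have : 2 ^ j ≤ r := hr.2 ▸ Nat.pow_log_le_self 2 (by omega)
            rw [hρ]; exact_mod_cast this
          rw [mul_div_right_comm]
          refine mul_le_mul_of_nonneg_right ?_ (by positivity)
          rw [div_div, mul_comm, ← div_div]
          gcongr
          rw [le_div_iff₀ hρ0]
          linarith
      _ ≤ _ := by
          refine sum_le_sum_of_subset_of_nonneg ?_ fun _ _ _ => by positivity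
          intro r hr
          rw [mem_filter, mem_Ioc] at hr
          rw [mem_Icc]
          exact ⟨by omega, (hr.2 ▸ Nat.lt_pow_succ_log_self (by norm_num) r : r < 2 ^ (j + 1)).le⟩
  refine h1.trans ?_
  have hsq : ∀ (K : ℕ) (γ : ℕ → ℂ), (∀ n, ‖γ n‖ ≤ W ∨ K ≤ n) →
      √(∑ n ∈ range K, ‖γ n‖ ^ 2) ≤ W * √K := by
    intro K γ hγ
    rw [Real.sqrt_le_left (by positivity), mul_pow, Real.sq_sqrt (by positivity)]
    calc _ ≤ ∑ n ∈ range K, W ^ 2 := by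
          refine sum_le_sum fun n hn => ?_
          rcases hγ n with h | h
          · gcongr
          · rw [mem_range] at hn; omega
      _ = _ := by simp [mul_comm]
  have hA : √(∑ m ∈ range M, ‖α m‖ ^ 2) ≤ W * √M := hsq _ _ fun n => by
    left
    simp only [hα]
    split_ifs with h
    · exact huW n (mem_Icc.mpr ⟨h.1, h.2.1⟩)
    · simpa using hW
  have hB : √(∑ n ∈ range N, ‖β n‖ ^ 2) ≤ W * √N := hsq _ _ fun n => by
    simp only [hβ]
    rcases Nat.lt_or_ge n N with h | h
    · left
      split_ifs with h'
      · refine hvW n (mem_Icc.mpr ⟨h', ?_⟩)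
        have := Nat.div_le_self X (2 ^ i)
        omega
      · simpa using hW
    · right; exact h
  have hlogN : Real.log N ≤ Real.log (X + 1) := by
    refine Real.log_le_log (by exact_mod_cast (by omega : 0 < N)) ?_
    exact_mod_cast (by have := Nat.div_le_self X (2 ^ i); omega : N ≤ X + 1)
  have hLp : (0 : ℝ) < L := by exact_mod_cast hL
  have h2i : (0 : ℝ) < 2 ^ i := by positivity
  have hXi : ((X / 2 ^ i : ℕ) : ℝ) ≤ X / 2 ^ i := by
    have := Nat.cast_div_le (α := ℝ) (m := X) (n := 2 ^ i)
    push_cast at this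
    exact this
  have hXi1 : (L : ℝ) + 1 ≤ ((X / 2 ^ i : ℕ) : ℝ) := by exact_mod_cast hi.2
  have hMr : (M : ℝ) = 2 * 2 ^ i := by rw [hM]; push_cast; ring
  have hNr : (N : ℝ) ≤ 2 * (X / 2 ^ i) := by
    rw [hN]; push_cast
    have : (1 : ℝ) ≤ L := by exact_mod_cast hL
    linarith
  have hLM : (L : ℝ) ≤ 2 * 2 ^ i := by rw [← hMr]; exact_mod_cast hi.1.le
  have hbound := bilinear_dyadic_bound (M := M) (N := N) (ρ := ρ) (X := X) (L := L) (R₀ := R₀)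
    (Q := Q) (by positivity) (by positivity) hρ0 (by positivity) hLp (by exact_mod_cast hR₀)
    (by
      rw [hMr]
      calc (2 * 2 ^ i * N : ℝ) ≤ 2 * 2 ^ i * (2 * (X / 2 ^ i)) := by gcongr
        _ = 4 * X := by field_simp; ring)
    (by
      rw [hMr, le_div_iff₀ hLp]
      have h3 : (L : ℝ) ≤ X / 2 ^ i := by linarith
      rw [le_div_iff₀ h2i] at h3
      have : (0 : ℝ) ≤ X := by positivity
      nlinarith)
    (by
      refine hNr.trans ?_
      rw [le_div_iff₀ hLp]
      calc (2 * (X / 2 ^ i) * L : ℝ) ≤ 2 * (X / 2 ^ i) * (2 * 2 ^ i) := by gcongr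
        _ = 4 * X := by field_simp; ring)
    (by
      have : r₀ < 2 ^ (j + 1) := hr₀.2 ▸ Nat.lt_pow_succ_log_self (by norm_num) r₀
      have h4 : R₀ ≤ 2 * 2 ^ j := by rw [← pow_succ']; omega
      rw [hρ]; exact_mod_cast h4)
    (by
      have : 2 ^ j ≤ r₀ := hr₀.2 ▸ Nat.pow_log_le_self 2 (by omega)
      rw [hρ]; exact_mod_cast this.trans hr₀.1.2)
  have h2ρ : ((2 ^ (j + 1) : ℕ) : ℝ) = 2 * ρ := by rw [hρ]; push_cast; ring
  rw [h2ρ] at hLS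
  calc _ ≤ (4 + sumInvSq) * √((M + (2 * ρ) ^ 2) * (N + (2 * ρ) ^ 2)) *
        ((W * √M) * (W * √N)) * (2 + Real.log (X + 1)) / ρ := by
        gcongr
        refine hLS.trans ?_
        have : 0 ≤ Real.log N := Real.log_nonneg (by exact_mod_cast (by omega : 1 ≤ N))
        gcongr
    _ = (4 + sumInvSq) * (W ^ 2 * (2 + Real.log (X + 1)) *
        (√((M + (2 * ρ) ^ 2) * (N + (2 * ρ) ^ 2)) * (√M * √N) / ρ)) := by ring
    _ ≤ (4 + sumInvSq) * (W ^ 2 * (2 + Real.log (X + 1)) *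
        (16 * (X / R₀ + X / √L + √X * Q))) := by gcongr
    _ = _ := by ring

/-- The contribution of characters of large conductor to a bilinear sum. -/
lemma sum_large_conductor_le {u v : ℕ → ℂ} {X L Q R₀ : ℕ} {W : ℝ} (hW : 0 ≤ W) (hL : 1 ≤ L)
    (hR₀ : 1 ≤ R₀)
    (hu : ∀ n ≤ L, u n = 0) (hv : ∀ n ≤ L, v n = 0) (huW : ∀ n ∈ Icc 1 X, ‖u n‖ ≤ W)
    (hvW : ∀ n ∈ Icc 1 X, ‖v n‖ ≤ W) :
    ∑ r ∈ Ioc R₀ Q, (1 / r.totient : ℝ) * ∑ χ ∈ primitiveCharacters r,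
        ‖∑ n ∈ Icc 1 X, dirichletConv u v n * χ n‖
      ≤ (Nat.log 2 Q + 1) * ((Nat.log 2 X + 1) * ((16 * (4 + sumInvSq)) *
        (W ^ 2 * (2 + Real.log (X + 1)) * (X / R₀ + X / √L + √X * Q)))) := by
  set Z := (16 * (4 + sumInvSq)) *
        (W ^ 2 * (2 + Real.log (X + 1)) * (X / R₀ + X / √L + √X * Q))
  have h1 : ∀ r ∈ Ioc R₀ Q, (1 / r.totient : ℝ) * ∑ χ ∈ primitiveCharacters r,
        ‖∑ n ∈ Icc 1 X, dirichletConv u v n * χ n‖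
      ≤ ∑ i ∈ range (Nat.log 2 X + 1), (1 / r.totient : ℝ) * ∑ χ ∈ primitiveCharacters r,
        ‖dyadicBlock u v X i χ‖ := by
    intro r _
    rw [← Finset.mul_sum, Finset.sum_comm]
    refine mul_le_mul_of_nonneg_left (sum_le_sum fun χ _ => ?_) (by positivity)
    rw [sum_dirichletConv_eq_sum_dyadicBlock]
    exact norm_sum_le _ _
  refine (sum_le_sum h1).trans ?_
  have h2 : ∀ r ∈ Ioc R₀ Q, Nat.log 2 r ∈ range (Nat.log 2 Q + 1) := by
    intro r hr
    rw [mem_range]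
    exact Nat.lt_succ_of_le (Nat.log_mono_right (mem_Ioc.mp hr).2)
  rw [← Finset.sum_fiberwise_of_maps_to h2]
  calc _ ≤ ∑ j ∈ range (Nat.log 2 Q + 1), ∑ i ∈ range (Nat.log 2 X + 1), Z := by
        refine sum_le_sum fun j _ => ?_
        rw [Finset.sum_comm]
        exact sum_le_sum fun i _ => sum_dyadicBlock_le hW hL hR₀ hu hv huW hvW
    _ = _ := by simp

/-! ### Bilinear sums against characters of small conductor. -/

/-- Dirichlet's hyperbola method. -/
lemma sum_hyperbola (F G : ℕ → ℂ) (X : ℕ) :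
    ∑ a ∈ Icc 1 X, F a * ∑ b ∈ Icc 1 (X / a), G b
      = ∑ a ∈ Icc 1 X.sqrt, F a * ∑ b ∈ Icc 1 (X / a), G b
        + ∑ b ∈ Icc 1 X.sqrt, G b * (∑ a ∈ Icc 1 (X / b), F a - ∑ a ∈ Icc 1 X.sqrt, F a) := by
  set s := X.sqrt with hs
  have hsX : s ≤ X := Nat.sqrt_le_self X
  have hdisj : ∀ k, s ≤ k → ∀ H : ℕ → ℂ,
      ∑ a ∈ Icc 1 k, H a = ∑ a ∈ Icc 1 s, H a + ∑ a ∈ Ioc s k, H a := by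
    intro k hk H
    rw [← Finset.sum_union (Finset.disjoint_left.mpr fun a ha hb => by
      simp only [mem_Icc, mem_Ioc] at ha hb; omega)]
    congr 1
    ext a
    simp only [mem_Icc, mem_union, mem_Ioc]
    omega
  rw [hdisj X hsX]
  congr 1
  simp only [Finset.mul_sum]
  rw [Finset.sum_comm' (t' := Icc 1 s) (s' := fun b => Ioc s (X / b))]
  · refine sum_congr rfl fun b hb => ?_
    rw [mem_Icc] at hb
    have h1 : s ≤ X / b := by
      rw [Nat.le_div_iff_mul_le hb.1]
      exact (Nat.mul_le_mul_left s hb.2).trans (Nat.sqrt_le X)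
    rw [hdisj _ h1 F, add_sub_cancel_left, Finset.mul_sum]
    exact sum_congr rfl fun a _ => mul_comm _ _
  · intro a b
    simp only [mem_Ioc, mem_Icc]
    have hX : X < (s + 1) * (s + 1) := Nat.lt_succ_sqrt X
    constructor
    · rintro ⟨⟨h1, h2⟩, h3, h4⟩
      rw [Nat.le_div_iff_mul_le (by omega)] at h4
      have h5 : b ≤ s := by
        by_contra hcon
        have : (s + 1) * (s + 1) ≤ b * a := Nat.mul_le_mul (by omega) (by omega)
        omega
      refine ⟨⟨h1, ?_⟩, h3, h5⟩
      rw [Nat.le_div_iff_mul_le h3, mul_comm]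
      exact h4
    · rintro ⟨⟨h1, h2⟩, h3, h4⟩
      rw [Nat.le_div_iff_mul_le h3] at h2
      refine ⟨⟨h1, (Nat.le_mul_of_pos_right a h3).trans h2⟩, h3, ?_⟩
      rw [Nat.le_div_iff_mul_le (by omega), mul_comm]
      exact h2

/-- A function restricted to the integers exceeding `L`. -/
def truncateBelow (L : ℕ) (F : ℕ → ℂ) (n : ℕ) : ℂ := if n ≤ L then 0 else F n

lemma norm_truncateBelow_le (L : ℕ) (F : ℕ → ℂ) (n : ℕ) : ‖truncateBelow L F n‖ ≤ ‖F n‖ := by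
  rw [truncateBelow]; split_ifs <;> simp

lemma norm_sum_truncateBelow_le {F : ℕ → ℂ} {X L k : ℕ} {W Y : ℝ} (hW : 0 ≤ W)
    (hF : ∀ n ∈ Icc 1 X, ‖F n‖ ≤ W) (hk : k ≤ X) (hY : ‖∑ n ∈ Icc 1 k, F n‖ ≤ Y) :
    ‖∑ n ∈ Icc 1 k, truncateBelow L F n‖ ≤ Y + W * L := by
  have h1 : ∑ n ∈ Icc 1 k, truncateBelow L F n
      = ∑ n ∈ Icc 1 k, F n - ∑ n ∈ Icc 1 k with n ≤ L, F n := by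
    rw [Finset.sum_filter, ← Finset.sum_sub_distrib]
    refine sum_congr rfl fun n _ => ?_
    rw [truncateBelow]
    split_ifs <;> simp
  rw [h1]
  refine (norm_sub_le _ _).trans (add_le_add hY ?_)
  calc _ ≤ ∑ n ∈ Icc 1 k with n ≤ L, W := by
        refine (norm_sum_le _ _).trans (sum_le_sum fun n hn => hF n ?_)
        simp only [mem_filter, mem_Icc] at hn ⊢
        omega
    _ ≤ _ := by
        rw [Finset.sum_const, nsmul_eq_mul, mul_comm]
        refine mul_le_mul_of_nonneg_left ?_ hW
        have : #{n ∈ Icc 1 k | n ≤ L} ≤ #(Icc 1 L) := card_le_card fun n hn => by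
          simp only [mem_filter, mem_Icc] at hn ⊢
          omega
        rw [Nat.card_Icc, Nat.add_sub_cancel] at this
        exact_mod_cast this

/-- In both halves of the hyperbola the inner sum has length at least √X, so cancellation is only
needed for long sums. Truncation at `L` costs at most W·L for each initial sum, hence the term √X·L.
-/
lemma norm_sum_hyperbola_truncateBelow_le {F G : ℕ → ℂ} {X L : ℕ} {W B : ℝ} (hB : 0 ≤ B)
    (hWX : 1 + Real.log X ≤ W)
    (hF : ∀ n ∈ Icc 1 X, ‖F n‖ ≤ W) (hG : ∀ n ∈ Icc 1 X, ‖G n‖ ≤ W)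
    (hFB : ∀ k, X.sqrt ≤ k → k ≤ X → ‖∑ n ∈ Icc 1 k, F n‖ ≤ B * k)
    (hGB : ∀ k, X.sqrt ≤ k → k ≤ X → ‖∑ n ∈ Icc 1 k, G n‖ ≤ B * k) :
    ‖∑ a ∈ Icc 1 X, truncateBelow L F a * ∑ b ∈ Icc 1 (X / a), truncateBelow L G b‖
      ≤ 3 * W ^ 2 * (B * X + X.sqrt * L) := by
  have hlogX : 0 ≤ Real.log X := Real.log_natCast_nonneg X
  have hW1 : 1 ≤ W := by linarith
  have hW : 0 ≤ W := by linarith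
  set s := X.sqrt with hs
  have hsX : s ≤ X := Nat.sqrt_le_self X
  have hdiv : ∀ a ∈ Icc 1 s, s ≤ X / a ∧ X / a ≤ X ∧ ((X / a : ℕ) : ℝ) ≤ X * (1 / a) := by
    intro a ha
    rw [mem_Icc] at ha
    refine ⟨?_, Nat.div_le_self _ _, ?_⟩
    · rw [Nat.le_div_iff_mul_le ha.1]
      exact (Nat.mul_le_mul_left s ha.2).trans (Nat.sqrt_le X)
    · rw [mul_one_div]; exact Nat.cast_div_le
  have hharm : ∑ a ∈ Icc 1 s, (1 / a : ℝ) ≤ W := by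
    refine (sum_Icc_one_div_le s).trans (le_trans ?_ hWX)
    rcases Nat.eq_zero_or_pos s with h | h
    · rw [h]; simpa using hlogX
    · have : Real.log s ≤ Real.log X :=
        Real.log_le_log (by exact_mod_cast h) (by exact_mod_cast hsX)
      linarith
  have hss : (s : ℝ) * s ≤ X := by exact_mod_cast Nat.sqrt_le X
  rw [sum_hyperbola]
  have h1 : ‖∑ a ∈ Icc 1 s, truncateBelow L F a * ∑ b ∈ Icc 1 (X / a), truncateBelow L G b‖
      ≤ W * (B * X * W + s * (W * L)) := by
    calc _ ≤ ∑ a ∈ Icc 1 s, W * (B * (X * (1 / a)) + W * L) := by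
          refine (norm_sum_le _ _).trans (sum_le_sum fun a ha => ?_)
          obtain ⟨d1, d2, d3⟩ := hdiv a ha
          rw [norm_mul]
          refine mul_le_mul ((norm_truncateBelow_le _ _ _).trans (hF a ?_))
            (norm_sum_truncateBelow_le hW hG d2 ((hGB _ d1 d2).trans ?_)) (norm_nonneg _) hW
          · rw [mem_Icc] at ha ⊢; omega
          · gcongr
      _ = W * (B * X * (∑ a ∈ Icc 1 s, (1 / a : ℝ)) + s * (W * L)) := by
          rw [← Finset.mul_sum, Finset.sum_add_distrib, ← Finset.mul_sum, ← Finset.mul_sum]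
          simp only [Finset.sum_const, Nat.card_Icc, Nat.add_sub_cancel, nsmul_eq_mul]
          ring
      _ ≤ _ := by gcongr
  have h2 : ‖∑ b ∈ Icc 1 s, truncateBelow L G b *
      (∑ a ∈ Icc 1 (X / b), truncateBelow L F a - ∑ a ∈ Icc 1 s, truncateBelow L F a)‖
      ≤ W * (B * X * W + s * (W * L + (B * s + W * L))) := by
    calc _ ≤ ∑ b ∈ Icc 1 s, W * (B * (X * (1 / b)) + W * L + (B * s + W * L)) := by
          refine (norm_sum_le _ _).trans (sum_le_sum fun a ha => ?_)
          obtain ⟨d1, d2, d3⟩ := hdiv a ha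
          rw [norm_mul]
          refine mul_le_mul ((norm_truncateBelow_le _ _ _).trans (hG a ?_))
            ((norm_sub_le _ _).trans (add_le_add
              (norm_sum_truncateBelow_le hW hF d2 ((hFB _ d1 d2).trans ?_))
              (norm_sum_truncateBelow_le hW hF hsX (hFB _ le_rfl hsX)))) (norm_nonneg _) hW
          · rw [mem_Icc] at ha ⊢; omega
          · gcongr
      _ = W * (B * X * (∑ a ∈ Icc 1 s, (1 / a : ℝ)) + s * (W * L + (B * s + W * L))) := by
          rw [← Finset.mul_sum, Finset.sum_add_distrib, Finset.sum_add_distrib, ← Finset.mul_sum,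
            ← Finset.mul_sum]
          simp only [Finset.sum_const, Nat.card_Icc, Nat.add_sub_cancel, nsmul_eq_mul]
          ring
      _ ≤ _ := by gcongr
  refine (norm_add_le _ _).trans ((add_le_add h1 h2).trans ?_)
  have h3 : B * (s * s) ≤ B * X := by gcongr
  have hBX : 0 ≤ B * X := by positivity
  have h4 : W * (B * (s * s)) ≤ W ^ 2 * (B * X) := by
    calc W * (B * (s * s)) ≤ W * (B * X) := by gcongr
      _ ≤ W ^ 2 * (B * X) := by
          refine mul_le_mul_of_nonneg_right ?_ hBX
          nlinarith
  nlinarith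

/-- The sum of `u χ` over the integers `n ≤ y` coprime to `m` saves an arbitrary power of the
logarithm, uniformly in the nonprincipal character `χ` and with polynomial dependence on the
modulus of `χ`. -/
def CharacterSumBound (u : ℕ → ℂ) : Prop :=
  ∀ A : ℝ, 0 < A → ∃ C : ℝ, 0 ≤ C ∧ ∀ y : ℝ, 2 ≤ y → ∀ r : ℕ, 1 ≤ r →
    ∀ χ : DirichletCharacter ℂ r, χ ≠ 1 → ∀ m : ℕ, 1 ≤ m →
      ‖∑ n ∈ Icc 1 ⌊y⌋₊ with n.Coprime m, u n * χ n‖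
        ≤ C * r * (#m.divisors : ℝ) ^ 2 * (y / Real.log y ^ A)

/-- A function restricted to the integers coprime to `m`. -/
def restrictCoprime (m : ℕ) (u : ℕ → ℂ) (n : ℕ) : ℂ := if n.Coprime m then u n else 0

lemma norm_restrictCoprime_le (m : ℕ) (u : ℕ → ℂ) (n : ℕ) : ‖restrictCoprime m u n‖ ≤ ‖u n‖ := by
  rw [restrictCoprime]; split_ifs <;> simp

lemma dirichletConv_restrictCoprime (m : ℕ) (u v : ℕ → ℂ) (n : ℕ) :
    dirichletConv (restrictCoprime m u) (restrictCoprime m v) n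
      = if n.Coprime m then dirichletConv u v n else 0 := by
  have h1 : ∀ p ∈ n.divisorsAntidiagonal, restrictCoprime m u p.1 * restrictCoprime m v p.2
      = if n.Coprime m then u p.1 * v p.2 else 0 := by
    intro p hp
    rw [← (Nat.mem_divisorsAntidiagonal.mp hp).1]
    simp only [Nat.coprime_mul_iff_left, restrictCoprime]
    split_ifs <;> simp_all
  rw [dirichletConv, sum_congr rfl h1]
  split_ifs
  · rfl
  · simp

lemma norm_sum_dirichletConv_truncateBelow_le {u v : ℕ → ℂ} {X L m r : ℕ} {W B : ℝ} (hB : 0 ≤ B)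
    (hWX : 1 + Real.log X ≤ W)
    (hu : ∀ n ∈ Icc 1 X, ‖u n‖ ≤ W) (hv : ∀ n ∈ Icc 1 X, ‖v n‖ ≤ W) (χ : DirichletCharacter ℂ r)
    (huB : ∀ k, X.sqrt ≤ k → k ≤ X → ‖∑ n ∈ Icc 1 k with n.Coprime m, u n * χ n‖ ≤ B * k)
    (hvB : ∀ k, X.sqrt ≤ k → k ≤ X → ‖∑ n ∈ Icc 1 k with n.Coprime m, v n * χ n‖ ≤ B * k) :
    ‖∑ n ∈ Icc 1 X with n.Coprime m,
        dirichletConv (truncateBelow L u) (truncateBelow L v) n * χ n‖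
      ≤ 3 * W ^ 2 * (B * X + X.sqrt * L) := by
  have hbd : ∀ w : ℕ → ℂ, (∀ n ∈ Icc 1 X, ‖w n‖ ≤ W) →
      ∀ n ∈ Icc 1 X, ‖restrictCoprime m w n * χ n‖ ≤ W := by
    intro w hw n hn
    rw [norm_mul]
    calc _ ≤ ‖w n‖ * 1 := mul_le_mul (norm_restrictCoprime_le _ _ _)
          (DirichletCharacter.norm_le_one χ _) (norm_nonneg _) (norm_nonneg _)
      _ ≤ W := by rw [mul_one]; exact hw n hn
  have hsum : ∀ (w : ℕ → ℂ) k, ∑ n ∈ Icc 1 k, restrictCoprime m w n * χ n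
      = ∑ n ∈ Icc 1 k with n.Coprime m, w n * χ n := by
    intro w k
    rw [Finset.sum_filter]
    refine sum_congr rfl fun n _ => ?_
    rw [restrictCoprime]; split_ifs <;> simp
  have key := norm_sum_hyperbola_truncateBelow_le (L := L)
    (F := fun n => restrictCoprime m u n * χ n) (G := fun n => restrictCoprime m v n * χ n)
    hB hWX (hbd u hu) (hbd v hv)
    (fun k h1 h2 => by rw [hsum]; exact huB k h1 h2)
    (fun k h1 h2 => by rw [hsum]; exact hvB k h1 h2)
  refine le_trans (le_of_eq ?_) key
  congr 1
  rw [← hsum, sum_congr rfl fun n _ => by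
    rw [restrictCoprime, ← dirichletConv_restrictCoprime], sum_dirichletConv_mul _ _ fun n => χ n]
  refine sum_congr rfl fun a _ => ?_
  rw [Finset.mul_sum, Finset.mul_sum]
  refine sum_congr rfl fun b _ => ?_
  simp only [truncateBelow, restrictCoprime, Nat.cast_mul, map_mul]
  split_ifs <;> ring

/-- The factor d(m)² of `CharacterSumBound` and 1/φ(m) ≤ d(m)/m combine to d(m)³/m, whence the
exponent 8 = 2³. -/
lemma sum_le_of_totient_weight {Q : ℕ} {g : ℕ → ℝ} {Y : ℝ} (hY : 0 ≤ Y)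
    (hg : ∀ m ∈ Icc 1 Q, g m ≤ (#m.divisors : ℝ) ^ 2 * Y) :
    ∑ m ∈ Icc 1 Q, (1 / m.totient : ℝ) * g m ≤ (1 + Real.log Q) ^ 8 * Y := by
  have h1 := sum_card_divisors_pow_div_le 3 Q
  norm_num at h1
  refine le_trans ?_ (mul_le_mul_of_nonneg_right h1 hY)
  rw [Finset.sum_mul]
  refine sum_le_sum fun m hm => ?_
  calc _ ≤ (1 / m.totient : ℝ) * ((#m.divisors : ℝ) ^ 2 * Y) :=
        mul_le_mul_of_nonneg_left (hg m hm) (by positivity)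
    _ ≤ (#m.divisors / m : ℝ) * ((#m.divisors : ℝ) ^ 2 * Y) :=
        mul_le_mul_of_nonneg_right (one_div_totient_le m (mem_Icc.mp hm).1) (by positivity)
    _ = _ := by ring

lemma ne_one_of_mem_primitiveCharacters {r : ℕ} (hr : 2 ≤ r) {χ : DirichletCharacter ℂ r}
    (hχ : χ ∈ primitiveCharacters r) : χ ≠ 1 := by
  have : NeZero r := ⟨by omega⟩
  rw [mem_primitiveCharacters, DirichletCharacter.isPrimitive_def] at hχ
  rintro rfl
  rw [DirichletCharacter.conductor_one] at hχ
  omega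

/-! ### Convolutions with both variables large. -/

/-- A bound for the total discrepancy of a convolution of two functions supported beyond `L`. -/
lemma totalDiscrepancy_bilinear_le {u v : ℕ → ℂ} {x : ℝ} {L Q R₀ : ℕ} {W D : ℝ} (hL : 1 ≤ L)
    (hR₀ : 1 ≤ R₀) (hD : 0 ≤ D) (hWX : 1 + Real.log ⌊x⌋₊ ≤ W)
    (hu : ∀ n ∈ Icc 1 ⌊x⌋₊, ‖u n‖ ≤ W) (hv : ∀ n ∈ Icc 1 ⌊x⌋₊, ‖v n‖ ≤ W)
    (huD : ∀ m, 1 ≤ m → ∀ r ∈ Icc 2 R₀, ∀ χ : DirichletCharacter ℂ r, χ ≠ 1 →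
      ∀ k, ⌊x⌋₊.sqrt ≤ k → k ≤ ⌊x⌋₊ →
      ‖∑ n ∈ Icc 1 k with n.Coprime m, u n * χ n‖ ≤ D * (#m.divisors : ℝ) ^ 2 * k)
    (hvD : ∀ m, 1 ≤ m → ∀ r ∈ Icc 2 R₀, ∀ χ : DirichletCharacter ℂ r, χ ≠ 1 →
      ∀ k, ⌊x⌋₊.sqrt ≤ k → k ≤ ⌊x⌋₊ →
      ‖∑ n ∈ Icc 1 k with n.Coprime m, v n * χ n‖ ≤ D * (#m.divisors : ℝ) ^ 2 * k) :
    totalDiscrepancy (dirichletConv (truncateBelow L u) (truncateBelow L v)) x Q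
      ≤ (1 + Real.log Q) ^ 8 * (R₀ * (3 * W ^ 2 * (D * ⌊x⌋₊ + ⌊x⌋₊.sqrt * L)) +
        (Nat.log 2 Q + 1) * ((Nat.log 2 ⌊x⌋₊ + 1) * ((16 * (4 + sumInvSq)) *
        (W ^ 2 * (2 + Real.log (⌊x⌋₊ + 1)) * (⌊x⌋₊ / R₀ + ⌊x⌋₊ / √L + √⌊x⌋₊ * Q))))) := by
  set X := ⌊x⌋₊ with hX
  have hlogX : 0 ≤ Real.log X := Real.log_natCast_nonneg X
  have hW0 : 0 ≤ W := by linarith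
  set Z := (Nat.log 2 Q + 1) * ((Nat.log 2 X + 1) * ((16 * (4 + sumInvSq)) *
        (W ^ 2 * (2 + Real.log (X + 1)) * (X / R₀ + X / √L + √X * Q)))) with hZ
  set T := dirichletConv (truncateBelow L u) (truncateBelow L v) with hT
  have hZ0 : 0 ≤ Z := by
    have := sumInvSq_nonneg
    have : 0 ≤ Real.log (X + 1) := by exact_mod_cast Real.log_natCast_nonneg (X + 1)
    positivity
  refine (totalDiscrepancy_le_sum_primitive T x Q).trans
    (sum_le_of_totient_weight (by positivity) fun m hm => ?_)
  have hm1 := (mem_Icc.mp hm).1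
  have hd1 : (1 : ℝ) ≤ (#m.divisors : ℝ) ^ 2 := by
    refine one_le_pow₀ ?_
    exact_mod_cast Finset.card_pos.mpr ⟨1, Nat.one_mem_divisors.mpr (by omega)⟩
  set d := (#m.divisors : ℝ) ^ 2
  have hsub : Icc 2 Q ⊆ Icc 2 R₀ ∪ Ioc R₀ Q := fun r hr => by
    simp only [mem_union, mem_Icc, mem_Ioc] at *; omega
  have hdisj : Disjoint (Icc 2 R₀) (Ioc R₀ Q) := Finset.disjoint_left.mpr fun r h1 h2 => by
    simp only [mem_Icc, mem_Ioc] at *; omega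
  -- Conductors up to R₀ use the assumed cancellation, character by character; the others use the
  -- large sieve.
  refine (sum_le_sum_of_subset_of_nonneg hsub fun _ _ _ => by positivity).trans ?_
  rw [Finset.sum_union hdisj, mul_add]
  refine add_le_add ?_ ?_
  · have h1 : ∀ r ∈ Icc 2 R₀, (1 / r.totient : ℝ) * ∑ ψ ∈ primitiveCharacters r,
        ‖∑ n ∈ Icc 1 X with n.Coprime m, T n * ψ n‖ ≤ d * (3 * W ^ 2 * (D * X + X.sqrt * L)) := by
      intro r hr
      have hr2 := (mem_Icc.mp hr).1
      have hφ : (0 : ℝ) < r.totient := by exact_mod_cast Nat.totient_pos.mpr (by omega)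
      rw [one_div_mul_eq_div, div_le_iff₀ hφ]
      calc _ ≤ ∑ ψ ∈ primitiveCharacters r, d * (3 * W ^ 2 * (D * X + X.sqrt * L)) := by
            refine sum_le_sum fun ψ hψ => ?_
            have hψ1 := ne_one_of_mem_primitiveCharacters hr2 hψ
            refine (norm_sum_dirichletConv_truncateBelow_le (B := D * d) (by positivity) hWX hu hv ψ
              (huD m hm1 r hr ψ hψ1) (hvD m hm1 r hr ψ hψ1)).trans ?_
            have : (X.sqrt : ℝ) * L ≤ d * (X.sqrt * L) :=
              le_mul_of_one_le_left (by positivity) hd1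
            calc _ ≤ 3 * W ^ 2 * (D * d * X + d * (X.sqrt * L)) := by gcongr
              _ = _ := by ring
        _ ≤ _ := by
            rw [Finset.sum_const, nsmul_eq_mul, mul_comm]
            refine mul_le_mul_of_nonneg_left ?_ (by positivity)
            exact_mod_cast card_primitiveCharacters_le r
    calc _ ≤ ∑ r ∈ Icc 2 R₀, d * (3 * W ^ 2 * (D * X + X.sqrt * L)) := sum_le_sum h1
      _ ≤ R₀ * (d * (3 * W ^ 2 * (D * X + X.sqrt * L))) := by
          rw [Finset.sum_const, nsmul_eq_mul]
          refine mul_le_mul_of_nonneg_right ?_ (by positivity)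
          rw [Nat.card_Icc]
          exact_mod_cast (by omega : R₀ + 1 - 2 ≤ R₀)
      _ = _ := by ring
  · refine le_trans ?_ (le_mul_of_one_le_left hZ0 hd1)
    have h2 := sum_large_conductor_le (u := restrictCoprime m (truncateBelow L u))
      (v := restrictCoprime m (truncateBelow L v)) (X := X) (L := L) (Q := Q) (R₀ := R₀) hW0 hL hR₀
      (fun n hn => by simp [restrictCoprime, truncateBelow, hn])
      (fun n hn => by simp [restrictCoprime, truncateBelow, hn])
      (fun n hn => (norm_restrictCoprime_le _ _ _).trans
        ((norm_truncateBelow_le _ _ _).trans (hu n hn)))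
      (fun n hn => (norm_restrictCoprime_le _ _ _).trans
        ((norm_truncateBelow_le _ _ _).trans (hv n hn)))
    refine le_trans (le_of_eq (sum_congr rfl fun r _ => ?_)) h2
    congr 1
    refine sum_congr rfl fun χ _ => ?_
    rw [Finset.sum_filter]
    congr 1
    refine sum_congr rfl fun n _ => ?_
    rw [dirichletConv_restrictCoprime]
    split_ifs <;> simp [hT]

lemma eventually_log_rpow_le (P : ℝ) {s : ℝ} (hs : 0 < s) :
    ∀ᶠ x : ℝ in atTop, Real.log x ^ P ≤ x ^ s := by
  have h := (isLittleO_log_rpow_rpow_atTop P hs).bound (c := 1) one_pos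
  filter_upwards [h, eventually_ge_atTop 1] with x hx hx1
  rw [one_mul, Real.norm_of_nonneg (Real.rpow_nonneg (Real.log_nonneg hx1) _),
    Real.norm_of_nonneg (Real.rpow_nonneg (by linarith) _)] at hx
  exact hx

lemma eventually_log_ge (c : ℝ) : ∀ᶠ x : ℝ in atTop, c ≤ Real.log x :=
  Real.tendsto_log_atTop.eventually_ge_atTop c

lemma half_le_floor {t : ℝ} (ht : 1 ≤ t) : t / 2 ≤ ⌊t⌋₊ := by
  have h1 : (1 : ℝ) ≤ ⌊t⌋₊ := by exact_mod_cast (Nat.one_le_floor_iff t).mpr ht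
  have h2 := Nat.lt_floor_add_one t
  linarith

lemma natLog_two_le {n : ℕ} {t : ℝ} (hn : Real.log n ≤ t) : (Nat.log 2 n : ℝ) ≤ 2 * t := by
  have h1 := Real.natLog_le_logb n 2
  rw [← Real.log_div_log] at h1
  have h2 : (1 / 2 : ℝ) ≤ Real.log 2 := by have := Real.log_two_gt_d9; linarith
  have h3 : Real.log n / Real.log (2 : ℕ) ≤ t / (1 / 2) := by
    push_cast
    have h4 : 0 ≤ Real.log n := Real.log_natCast_nonneg n
    gcongr
    linarith
  linarith

lemma rpow_quarter_le_sqrt_floor {x : ℝ} (h : x ^ (1 / 4 : ℝ) + 1 ≤ √x) :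
    x ^ (1 / 4 : ℝ) ≤ ⌊x⌋₊.sqrt := by
  have h1 : ⌊x⌋₊ + 1 ≤ (⌊x⌋₊.sqrt + 1) * (⌊x⌋₊.sqrt + 1) := Nat.lt_succ_sqrt _
  have h2 : x ≤ ((⌊x⌋₊.sqrt : ℝ) + 1) ^ 2 := by
    have h3 : ((⌊x⌋₊ : ℝ) + 1) ≤ ((⌊x⌋₊.sqrt : ℝ) + 1) * (⌊x⌋₊.sqrt + 1) := by exact_mod_cast h1
    have := Nat.lt_floor_add_one x
    nlinarith
  have h4 := Real.sqrt_le_sqrt h2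
  rw [Real.sqrt_sq (by positivity)] at h4
  linarith

set_option maxHeartbeats 400000 in
/-- The total discrepancy of the part of a convolution where both variables exceed a large power
of the logarithm. -/
lemma totalDiscrepancy_bilinear_eventually_le {u v : ℕ → ℂ}
    (hu : ∀ n : ℕ, 1 ≤ n → ‖u n‖ ≤ 1 + Real.log n) (hv : ∀ n : ℕ, 1 ≤ n → ‖v n‖ ≤ 1 + Real.log n)
    (hSu : CharacterSumBound u) (hSv : CharacterSumBound v) {A : ℝ} (hA : 0 < A) :
    ∃ K B C : ℝ, 0 < K ∧ 0 ≤ B ∧ 0 ≤ C ∧ ∀ᶠ x : ℝ in atTop, ∀ Q : ℕ,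
      (Q : ℝ) ≤ √x / Real.log x ^ B →
      totalDiscrepancy (dirichletConv (truncateBelow ⌊Real.log x ^ K⌋₊ u)
        (truncateBelow ⌊Real.log x ^ K⌋₊ v)) x Q ≤ C * (x / Real.log x ^ A) := by
  -- With t = log x, the large conductor part carries t^13: eight powers from (1 + log Q)^8, two
  -- from the dyadic counts, two from W² and one from 2 + log(X + 1). Taking R₀ ≈ t^P, L ≈ t^(2P)
  -- and Q ≤ √x/t^P turns each of its three terms into x/t^A. The small conductor part carries t^10,
  -- a factor R₀ from the number of moduli and another from `D`; this fixes A₁. The term √X·L there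
  -- requires t^(10 + 3P + A) ≤ √x.
  set P := A + 13 with hP
  set A₁ := 2 * P + 10 + A with hA₁
  obtain ⟨Cu, hCu0, hCu⟩ := hSu A₁ (by positivity)
  obtain ⟨Cv, hCv0, hCv⟩ := hSv A₁ (by positivity)
  have hc := sumInvSq_nonneg
  set C := Cu + Cv with hC
  refine ⟨2 * P, P, 3072 * (C * 4 ^ A₁ + 1) + 184320 * (16 * (4 + sumInvSq)), by positivity,
    by positivity, by positivity, ?_⟩
  have hsmall : ∀ᶠ x : ℝ in atTop, x ^ (1 / 4 : ℝ) + 1 ≤ √x := by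
    have h1 : ∀ᶠ x : ℝ in atTop, 2 ≤ x ^ (1 / 4 : ℝ) :=
      (tendsto_rpow_atTop (by norm_num)).eventually_ge_atTop 2
    filter_upwards [h1, eventually_gt_atTop 0] with x hx hx0
    rw [Real.sqrt_eq_rpow, show (1 / 2 : ℝ) = 1 / 4 + 1 / 4 by norm_num, Real.rpow_add hx0]
    nlinarith
  filter_upwards [eventually_ge_atTop 16, eventually_log_ge 1,
    eventually_log_rpow_le (10 + 3 * P + A) (s := 1 / 2) (by norm_num), hsmall]
    with x hx16 hlog1 hpow hquart Q hQ
  set t := Real.log x with ht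
  have ht0 : 0 < t := by linarith
  have hx0 : 0 < x := by linarith
  set X := ⌊x⌋₊ with hX
  have hXx : (X : ℝ) ≤ x := Nat.floor_le hx0.le
  have hX1 : 1 ≤ X := (Nat.one_le_floor_iff x).mpr (by linarith)
  set a := t ^ A with ha
  have ha1 : 1 ≤ a := Real.one_le_rpow hlog1 hA.le
  set p := t ^ P with hp
  have hpa : p = a * t ^ 13 := by
    rw [hp, hP, Real.rpow_add ht0, ha]; norm_cast
  have hp1 : 1 ≤ p := Real.one_le_rpow hlog1 (by positivity)
  have hp2 : t ^ (2 * P) = p ^ 2 := by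
    rw [hp, mul_comm, Real.rpow_mul ht0.le]; norm_cast
  have hpA₁ : t ^ A₁ = a * p ^ 2 * t ^ 10 := by
    rw [hA₁, Real.rpow_add ht0, Real.rpow_add ht0, hp2]
    have : t ^ (10 : ℝ) = t ^ 10 := by norm_cast
    rw [this]; ring
  have hpow' : t ^ 10 * p ^ 3 * a ≤ √x := by
    rw [Real.sqrt_eq_rpow]
    refine le_trans (le_of_eq ?_) hpow
    rw [Real.rpow_add ht0, Real.rpow_add ht0]
    have h1 : t ^ (10 : ℝ) = t ^ 10 := by norm_cast
    have h2 : t ^ (3 * P) = p ^ 3 := by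
      rw [hp, mul_comm, Real.rpow_mul ht0.le]; norm_cast
    rw [h1, h2]
  rw [hp2]
  set L := ⌊p ^ 2⌋₊ with hL
  set R₀ := ⌊p⌋₊ with hR₀
  have hL1 : 1 ≤ L := (Nat.one_le_floor_iff _).mpr (one_le_pow₀ hp1)
  have hR1 : 1 ≤ R₀ := (Nat.one_le_floor_iff _).mpr hp1
  have hLle : (L : ℝ) ≤ p ^ 2 := Nat.floor_le (by positivity)
  have hRle : (R₀ : ℝ) ≤ p := Nat.floor_le (by positivity)
  have hlogX : Real.log X ≤ t := Real.log_le_log (by exact_mod_cast hX1) hXx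
  have hQx : (Q : ℝ) ≤ √x / p := hQ
  have hQx' : (Q : ℝ) ≤ x := by
    refine hQx.trans ((div_le_self (Real.sqrt_nonneg x) hp1).trans ?_)
    rw [Real.sqrt_le_left hx0.le]
    exact le_self_pow₀ (by linarith) (by norm_num)
  have hlogQ : Real.log Q ≤ t := by
    rcases Nat.eq_zero_or_pos Q with h | h
    · rw [h]; simpa using ht0.le
    · exact Real.log_le_log (by exact_mod_cast h) hQx'
  have hlogQ0 : 0 ≤ Real.log Q := Real.log_natCast_nonneg Q
  set s := X.sqrt with hs
  have hsx : x ^ (1 / 4 : ℝ) ≤ s := rpow_quarter_le_sqrt_floor hquart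
  have hq2 : (2 : ℝ) ≤ x ^ (1 / 4 : ℝ) := by
    have : (2 : ℝ) = 16 ^ (1 / 4 : ℝ) := by
      rw [show (16 : ℝ) = 2 ^ (4 : ℝ) by norm_num, ← Real.rpow_mul (by norm_num)]; norm_num
    rw [this]
    gcongr
  have hs2 : (s : ℝ) ≤ √x := by
    refine Real.le_sqrt_of_sq_le ?_
    have : s * s ≤ X := Nat.sqrt_le X
    have h2 : (s : ℝ) * s ≤ X := by exact_mod_cast this
    rw [sq]
    exact h2.trans hXx
  -- Only lengths k ≥ x^(1/4) occur, so log k ≥ t/4; this is the source of 4^A₁.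
  set D := C * R₀ * (4 ^ A₁ / t ^ A₁) with hD
  have hDbound : ∀ (w : ℕ → ℂ) (Cw : ℝ), 0 ≤ Cw → Cw ≤ C → (∀ y : ℝ, 2 ≤ y → ∀ r : ℕ, 1 ≤ r →
      ∀ χ : DirichletCharacter ℂ r, χ ≠ 1 → ∀ m : ℕ, 1 ≤ m →
      ‖∑ n ∈ Icc 1 ⌊y⌋₊ with n.Coprime m, w n * χ n‖
        ≤ Cw * r * (#m.divisors : ℝ) ^ 2 * (y / Real.log y ^ A₁)) →
      ∀ m, 1 ≤ m → ∀ r ∈ Icc 2 R₀, ∀ χ : DirichletCharacter ℂ r, χ ≠ 1 →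
      ∀ k, s ≤ k → k ≤ X →
      ‖∑ n ∈ Icc 1 k with n.Coprime m, w n * χ n‖ ≤ D * (#m.divisors : ℝ) ^ 2 * k := by
    intro w Cw hCw0 hCwC hw m hm r hr χ hχ k hk _
    rw [mem_Icc] at hr
    have hkx : x ^ (1 / 4 : ℝ) ≤ k := hsx.trans (by exact_mod_cast hk)
    have h1 := hw k (hq2.trans hkx) r (by omega) χ hχ m hm
    rw [Nat.floor_natCast] at h1
    refine h1.trans ?_
    have h2 : t / 4 ≤ Real.log k := by
      have := Real.log_le_log (by positivity) hkx
      rw [Real.log_rpow hx0] at this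
      linarith
    have h3 : t ^ A₁ / 4 ^ A₁ ≤ Real.log k ^ A₁ := by
      rw [← Real.div_rpow ht0.le (by norm_num)]
      exact Real.rpow_le_rpow (by positivity) h2 (by positivity)
    have h4 : (k : ℝ) / Real.log k ^ A₁ ≤ k * (4 ^ A₁ / t ^ A₁) := by
      rw [← one_div_div (t ^ A₁) (4 ^ A₁), mul_one_div]
      gcongr
    have h5 : (r : ℝ) ≤ R₀ := by exact_mod_cast hr.2
    calc _ ≤ C * R₀ * (#m.divisors : ℝ) ^ 2 * (k * (4 ^ A₁ / t ^ A₁)) := by gcongr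
      _ = _ := by rw [hD]; ring
  have hbd : ∀ w : ℕ → ℂ, (∀ n : ℕ, 1 ≤ n → ‖w n‖ ≤ 1 + Real.log n) →
      ∀ n ∈ Icc 1 X, ‖w n‖ ≤ 1 + t := by
    intro w hw n hn
    rw [mem_Icc] at hn
    refine (hw n hn.1).trans ?_
    have : Real.log n ≤ t := Real.log_le_log (by exact_mod_cast hn.1)
      ((by exact_mod_cast hn.2 : (n : ℝ) ≤ X).trans hXx)
    linarith
  have main := totalDiscrepancy_bilinear_le (x := x) (L := L) (Q := Q) (R₀ := R₀) (W := 1 + t)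
    (D := D) hL1 hR1 (by positivity) (by linarith) (hbd u hu) (hbd v hv)
    (hDbound u Cu hCu0 (by linarith) hCu) (hDbound v Cv hCv0 (by linarith) hCv)
  refine main.trans ?_
  rw [← hX]
  have b1 : 1 + Real.log Q ≤ 2 * t := by linarith
  have b2 : 1 + t ≤ 2 * t := by linarith
  have b3 : (Nat.log 2 Q : ℝ) + 1 ≤ 3 * t := by have := natLog_two_le hlogQ; linarith
  have b4 : (Nat.log 2 X : ℝ) + 1 ≤ 3 * t := by have := natLog_two_le hlogX; linarith
  have b5 : 2 + Real.log (X + 1) ≤ 4 * t := by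
    have h1 : Real.log (X + 1) ≤ Real.log (x * 2) :=
      Real.log_le_log (by positivity) (by linarith)
    rw [Real.log_mul hx0.ne' (by norm_num)] at h1
    have := Real.log_two_lt_d9
    linarith
  have b5' : 0 ≤ Real.log (X + 1) := by exact_mod_cast Real.log_natCast_nonneg (X + 1)
  have b6 : (X : ℝ) / R₀ ≤ 2 * (x / p) := by
    have h1 : p / 2 ≤ R₀ := half_le_floor hp1
    calc (X : ℝ) / R₀ ≤ x / (p / 2) := by gcongr
      _ = _ := by field_simp
  have b7 : (X : ℝ) / √L ≤ 2 * (x / p) := by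
    have h1 : p ^ 2 / 2 ≤ L := half_le_floor (one_le_pow₀ hp1)
    have h2 : p / 2 ≤ √L := by
      refine Real.le_sqrt_of_sq_le (le_trans ?_ h1)
      rw [div_pow]
      exact div_le_div_of_nonneg_left (sq_nonneg p) (by norm_num) (by norm_num)
    calc (X : ℝ) / √L ≤ x / (p / 2) := by gcongr
      _ = _ := by field_simp
  have hsqx : √x * √x = x := Real.mul_self_sqrt hx0.le
  have b8 : √X * Q ≤ x / p := by
    calc √X * Q ≤ √x * (√x / p) := by gcongr
      _ = (√x * √x) / p := by ring
      _ = _ := by rw [hsqx]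
  have e1 : (1 + Real.log Q) ^ 8 * (R₀ * (3 * (1 + t) ^ 2 * (D * X + s * L)))
      ≤ 3072 * (C * 4 ^ A₁ + 1) * (x / a) := by
    have h1 : D * X ≤ C * 4 ^ A₁ * (x / (a * p * t ^ 10)) := by
      rw [hD, hpA₁]
      calc C * R₀ * (4 ^ A₁ / (a * p ^ 2 * t ^ 10)) * X
          ≤ C * p * (4 ^ A₁ / (a * p ^ 2 * t ^ 10)) * x := by gcongr
        _ = _ := by field_simp
    have h2 : (s : ℝ) * L ≤ x / (a * p * t ^ 10) := by
      rw [le_div_iff₀ (by positivity)]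
      calc (s : ℝ) * L * (a * p * t ^ 10) ≤ √x * p ^ 2 * (a * p * t ^ 10) := by gcongr
        _ = √x * (t ^ 10 * p ^ 3 * a) := by ring
        _ ≤ √x * √x := by gcongr
        _ = x := hsqx
    calc _ ≤ (2 * t) ^ 8 * (p * (3 * (2 * t) ^ 2 *
          (C * 4 ^ A₁ * (x / (a * p * t ^ 10)) + x / (a * p * t ^ 10)))) := by gcongr
      _ = _ := by field_simp; ring
  have e2 : (1 + Real.log Q) ^ 8 * (((Nat.log 2 Q : ℝ) + 1) * (((Nat.log 2 X : ℝ) + 1) *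
      ((16 * (4 + sumInvSq)) * ((1 + t) ^ 2 * (2 + Real.log (X + 1)) *
        (X / R₀ + X / √L + √X * Q))))) ≤ 184320 * (16 * (4 + sumInvSq)) * (x / a) := by
    calc _ ≤ (2 * t) ^ 8 * ((3 * t) * ((3 * t) *
      ((16 * (4 + sumInvSq)) * ((2 * t) ^ 2 * (4 * t) *
        (2 * (x / p) + 2 * (x / p) + x / p))))) := by gcongr
      _ = _ := by rw [hpa]; field_simp; ring
  rw [mul_add]
  calc _ ≤ 3072 * (C * 4 ^ A₁ + 1) * (x / a) + 184320 * (16 * (4 + sumInvSq)) * (x / a) :=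
        add_le_add e1 e2
    _ = _ := by ring

/-! ### Bombieri–Vinogradov bounds with a tracked exponent, and partial summation. -/

/-- The bound `∑_{q ≤ Q} max_a |Δ(h, x; q, a)| ≪ x / (log x)^A` for all large `x` and all
`Q ≤ √x / (log x)^B`, for some `B`. -/
def BVBound (h : ℕ → ℂ) (A : ℝ) : Prop :=
  ∃ B C : ℝ, 0 ≤ B ∧ 0 ≤ C ∧ ∀ᶠ x : ℝ in atTop, ∀ Q : ℕ, (Q : ℝ) ≤ √x / Real.log x ^ B →
    totalDiscrepancy h x Q ≤ C * (x / Real.log x ^ A)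

/-- A version of `BVBound` that is uniform in the length of the sum. -/
def BVUniform (h : ℕ → ℂ) (A : ℝ) : Prop :=
  ∀ K : ℝ, ∃ B C : ℝ, 0 ≤ B ∧ 0 ≤ C ∧ ∀ᶠ x : ℝ in atTop, ∀ Q : ℕ,
    (Q : ℝ) ≤ √x / Real.log x ^ B → ∀ y : ℝ, 1 ≤ y → y ≤ x →
      totalDiscrepancy h y Q ≤ C * (y / Real.log x ^ A + x / Real.log x ^ K)

lemma div_rpow_mono {x t A A' : ℝ} (hx : 0 ≤ x) (ht : 1 ≤ t) (hA : A ≤ A') :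
    x / t ^ A' ≤ x / t ^ A := by
  have h1 : 0 < t ^ A := Real.rpow_pos_of_pos (by linarith) _
  have h2 : t ^ A ≤ t ^ A' := Real.rpow_le_rpow_of_exponent_le ht hA
  gcongr

lemma BVBound.mono {h : ℕ → ℂ} {A A' : ℝ} (hh : BVBound h A') (hA : A ≤ A') : BVBound h A := by
  obtain ⟨B, C, hB, hC, hev⟩ := hh
  refine ⟨B, C, hB, hC, ?_⟩
  filter_upwards [hev, eventually_log_ge 1, eventually_ge_atTop 0] with x hx hlog hx0 Q hQ
  exact (hx Q hQ).trans (mul_le_mul_of_nonneg_left (div_rpow_mono hx0 hlog hA) hC)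

lemma BVBound.of_le {h k : ℕ → ℂ} {A B₀ C₀ : ℝ} (hk : BVBound k A)
    (hle : ∀ᶠ x : ℝ in atTop, ∀ Q : ℕ, (Q : ℝ) ≤ √x / Real.log x ^ B₀ →
      totalDiscrepancy h x Q ≤ totalDiscrepancy k x Q + C₀ * (x / Real.log x ^ A)) :
    BVBound h A := by
  obtain ⟨B, C, hB, hC, hev⟩ := hk
  refine ⟨max B B₀, C + |C₀|, le_max_of_le_left hB, by positivity, ?_⟩
  filter_upwards [hev, hle, eventually_log_ge 1, eventually_ge_atTop 0] with x hx hle hlog hx0 Q hQ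
  have h1 := hle Q (hQ.trans (div_rpow_mono (Real.sqrt_nonneg x) hlog (le_max_right _ _)))
  have h2 := hx Q (hQ.trans (div_rpow_mono (Real.sqrt_nonneg x) hlog (le_max_left _ _)))
  have h3 : 0 ≤ x / Real.log x ^ A := by
    have : 0 ≤ Real.log x := by linarith
    positivity
  have h4 : C₀ * (x / Real.log x ^ A) ≤ |C₀| * (x / Real.log x ^ A) :=
    mul_le_mul_of_nonneg_right (le_abs_self _) h3
  linarith

lemma bvBound_of_hypothesis {h : ℕ → ℂ} (hh : BombieriVinogradovHypothesis h) (A : ℝ) :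
    BVBound h A := by
  refine BVBound.mono (A' := max A 1) ?_ (le_max_left _ _)
  obtain ⟨B, C, hBC⟩ := hh (max A 1) (by positivity)
  refine ⟨max B 0, max C 0, le_max_right _ _, le_max_right _ _, ?_⟩
  filter_upwards [eventually_ge_atTop 2, eventually_log_ge 1] with x hx2 hlog Q hQ
  have h1 : Q ≤ ⌊√x / Real.log x ^ B⌋₊ := by
    refine Nat.le_floor (hQ.trans ?_)
    exact div_rpow_mono (Real.sqrt_nonneg x) hlog (le_max_left _ _)
  have h3 : 0 ≤ x / Real.log x ^ max A 1 := by
    have : 0 ≤ Real.log x := by linarith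
    positivity
  exact (totalDiscrepancy_mono h x h1).trans ((hBC x hx2).trans
    (mul_le_mul_of_nonneg_right (le_max_left _ _) h3))

/-- On the remaining bounded range of `x` the trivial bound is absorbed into the constant; log x ≥
log 2 keeps the range of moduli bounded there. -/
lemma hypothesis_of_bvBound {h : ℕ → ℂ} (hh : ∀ A : ℝ, 0 < A → BVBound h A) :
    BombieriVinogradovHypothesis h := by
  intro A hA
  obtain ⟨B, C, hB, hC, hev⟩ := hh A hA
  obtain ⟨x₀, hx₀⟩ := eventually_atTop.mp hev
  set x₁ := max x₀ 2 with hx₁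
  set S := 2 * ∑ n ∈ Icc 1 ⌊x₁⌋₊, ‖h n‖ with hS
  have hS0 : 0 ≤ S := by positivity
  have hl2 : 0 < Real.log 2 := Real.log_pos (by norm_num)
  have hx₁2 : 2 ≤ x₁ := le_max_right _ _
  have hl1 : 0 < Real.log x₁ := Real.log_pos (by linarith)
  set C' := (√x₁ / Real.log 2 ^ B * S) * (Real.log x₁ ^ A / 2) with hC'
  have hC'0 : 0 ≤ C' := by positivity
  refine ⟨B, C + C', fun x hx => ?_⟩
  change totalDiscrepancy h x ⌊√x / Real.log x ^ B⌋₊ ≤ _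
  have hl : 0 < Real.log x := Real.log_pos (by linarith)
  have hpos : 0 ≤ x / Real.log x ^ A := by positivity
  rcases le_or_gt x₁ x with hxx | hxx
  · have h1 := hx₀ x ((le_max_left _ _).trans hxx) ⌊√x / Real.log x ^ B⌋₊
      (Nat.floor_le (by positivity))
    refine h1.trans (mul_le_mul_of_nonneg_right ?_ hpos)
    linarith
  · have h1 : (⌊√x / Real.log x ^ B⌋₊ : ℝ) ≤ √x₁ / Real.log 2 ^ B := by
      refine (Nat.floor_le (by positivity)).trans ?_
      gcongr
    have h2 : 2 * ∑ n ∈ Icc 1 ⌊x⌋₊, ‖h n‖ ≤ S := by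
      rw [hS]
      refine mul_le_mul_of_nonneg_left ?_ (by norm_num)
      exact sum_le_sum_of_subset_of_nonneg (Icc_subset_Icc_right (Nat.floor_mono hxx.le))
        fun _ _ _ => norm_nonneg _
    have h3 : 1 ≤ (Real.log x₁ ^ A / 2) * (x / Real.log x ^ A) := by
      have : Real.log x ^ A ≤ Real.log x₁ ^ A :=
        Real.rpow_le_rpow hl.le (Real.log_le_log (by linarith) hxx.le) hA.le
      rw [div_mul_div_comm, le_div_iff₀ (by positivity), one_mul]
      nlinarith [Real.rpow_nonneg hl.le A]
    calc _ ≤ √x₁ / Real.log 2 ^ B * S := by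
          refine (totalDiscrepancy_le_card_mul h x _).trans ?_
          gcongr
      _ ≤ (√x₁ / Real.log 2 ^ B * S) * ((Real.log x₁ ^ A / 2) * (x / Real.log x ^ A)) :=
          le_mul_of_one_le_right (by positivity) h3
      _ = C' * (x / Real.log x ^ A) := by rw [hC']; ring
      _ ≤ _ := mul_le_mul_of_nonneg_right (by linarith) hpos

/-- The absolute value is there because negative exponents occur at the start of the bootstrapping.
-/
lemma div_rpow_le_of_half_le {y t l : ℝ} (A : ℝ) (hy : 0 ≤ y) (hl : 0 < l) (h1 : l / 2 ≤ t)
    (h2 : t ≤ l) : y / t ^ A ≤ 2 ^ |A| * (y / l ^ A) := by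
  have ht : 0 < t := by linarith
  rcases le_or_gt 0 A with hA | hA
  · rw [abs_of_nonneg hA]
    have h3 : (l / 2) ^ A ≤ t ^ A := Real.rpow_le_rpow (by positivity) h1 hA
    rw [Real.div_rpow hl.le (by norm_num)] at h3
    calc y / t ^ A ≤ y / (l ^ A / 2 ^ A) := by gcongr
      _ = _ := by field_simp
  · have h3 : l ^ A ≤ t ^ A := Real.rpow_le_rpow_of_nonpos ht h2 hA.le
    calc y / t ^ A ≤ y / l ^ A := by gcongr
      _ ≤ _ := le_mul_of_one_le_left (by positivity)
          (Real.one_le_rpow (by norm_num) (abs_nonneg _))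

/-- The trivial bound for the total discrepancy. -/
lemma totalDiscrepancy_trivial {h : ℕ → ℂ} (hh : ∀ n : ℕ, 1 ≤ n → ‖h n‖ ≤ 1 + Real.log n)
    {x y : ℝ} (hx : 1 ≤ x) (hlog : 1 ≤ Real.log x) (hy : 0 ≤ y) (hyx : y ≤ x) {Q : ℕ}
    (hQ : (Q : ℝ) ≤ √x) :
    totalDiscrepancy h y Q ≤ 16 * (y * Real.log x ^ 3) + 2 * (Real.log x * √x) := by
  set t := Real.log x
  have hW : ∀ n ∈ Icc 1 ⌊y⌋₊, ‖h n‖ ≤ 1 + t := by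
    intro n hn
    rw [mem_Icc] at hn
    refine (hh n hn.1).trans ?_
    have h1 : (n : ℝ) ≤ x := le_trans (by exact_mod_cast hn.2) ((Nat.floor_le hy).trans hyx)
    have := Real.log_le_log (by exact_mod_cast hn.1) h1
    linarith
  refine (totalDiscrepancy_le_of_bounded hy (by linarith) hW Q).trans ?_
  have hlogQ : Real.log Q ≤ t := by
    rcases Nat.eq_zero_or_pos Q with h | h
    · rw [h]; simp; linarith
    · refine Real.log_le_log (by exact_mod_cast h) (hQ.trans ?_)
      rw [Real.sqrt_le_left (by linarith)]
      exact le_self_pow₀ hx (by norm_num)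
  have hlogQ0 : 0 ≤ Real.log Q := Real.log_natCast_nonneg Q
  calc _ ≤ (2 * t) * (2 * y * (2 * t) ^ 2 + √x) := by
        gcongr
        · linarith
        · linarith
    _ = _ := by ring

lemma BVBound.uniform {h : ℕ → ℂ} (hh : ∀ n : ℕ, 1 ≤ n → ‖h n‖ ≤ 1 + Real.log n) {A : ℝ}
    (hA : BVBound h A) : BVUniform h A := by
  intro K
  obtain ⟨B, C, hB, hC, hev⟩ := hA
  obtain ⟨x₀, hx₀⟩ := eventually_atTop.mp hev
  -- For y ≥ x/(log x)^K' the bound is applied at y itself: log y is comparable to log x, and √y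
  -- loses at most (log x)^(K'/2), which is added to B. For shorter y the trivial bound suffices,
  -- the 3 in K' paying for its factor (log x)³.
  set K' := |K| + 3 with hK'
  have hK'0 : 0 ≤ K' := by positivity
  refine ⟨B + K' / 2, C * 2 ^ |A| + 18, by positivity, by positivity, ?_⟩
  have hsqrt : ∀ᶠ x : ℝ in atTop, max x₀ 1 ≤ √x :=
    (Real.tendsto_sqrt_atTop).eventually_ge_atTop _
  filter_upwards [eventually_log_ge 1, hsqrt, eventually_ge_atTop 1,
    eventually_log_rpow_le K' (s := 1 / 2) (by norm_num),
    eventually_log_rpow_le (1 + K) (s := 1 / 2) (by norm_num)]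
    with x hlog hsq hx1 hpow hpow2 Q hQ y hy1 hyx
  rw [← Real.sqrt_eq_rpow] at hpow hpow2
  set t := Real.log x with ht
  have ht0 : 0 < t := by linarith
  have hx0 : 0 < x := by linarith
  have hsqx : √x * √x = x := Real.mul_self_sqrt hx0.le
  have hK1 : 0 < t ^ K' := Real.rpow_pos_of_pos ht0 _
  have hKp : 0 < t ^ K := Real.rpow_pos_of_pos ht0 _
  have hAp : 0 < t ^ A := Real.rpow_pos_of_pos ht0 _
  rcases le_or_gt (x / t ^ K') y with hy | hy
  · have hysq : √x ≤ y := by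
      refine le_trans ?_ hy
      rw [le_div_iff₀ hK1]
      exact (mul_le_mul_of_nonneg_left hpow (Real.sqrt_nonneg x)).trans_eq hsqx
    have hly : t / 2 ≤ Real.log y := by
      have h1 := Real.log_le_log (Real.sqrt_pos.mpr hx0) hysq
      rwa [Real.log_sqrt hx0.le] at h1
    have hly' : Real.log y ≤ t := Real.log_le_log (by linarith) hyx
    have hly0 : 0 < Real.log y := by linarith
    have hQy : (Q : ℝ) ≤ √y / Real.log y ^ B := by
      refine hQ.trans ?_
      have h1 : √(x / t ^ K') ≤ √y := Real.sqrt_le_sqrt hy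
      have h2 : √(x / t ^ K') = √x / t ^ (K' / 2) := by
        rw [Real.sqrt_div hx0.le, Real.sqrt_eq_rpow (t ^ K'), ← Real.rpow_mul ht0.le]
        congr 2; ring
      rw [h2] at h1
      have h3 : Real.log y ^ B ≤ t ^ B := Real.rpow_le_rpow hly0.le hly' hB
      rw [Real.rpow_add ht0, mul_comm, ← div_div]
      gcongr
    have h1 := hx₀ y (((le_max_left _ _).trans hsq).trans hysq) Q hQy
    have h2 := div_rpow_le_of_half_le A (by linarith : (0 : ℝ) ≤ y) ht0 hly hly'
    have h3 : 0 ≤ y / t ^ A := by positivity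
    have h4 : 0 ≤ x / t ^ K := by positivity
    have h5 : 0 ≤ C * 2 ^ |A| := by positivity
    calc _ ≤ C * (y / Real.log y ^ A) := h1
      _ ≤ C * (2 ^ |A| * (y / t ^ A)) := mul_le_mul_of_nonneg_left h2 hC
      _ = C * 2 ^ |A| * (y / t ^ A) := by ring
      _ ≤ (C * 2 ^ |A| + 18) * (y / t ^ A + x / t ^ K) :=
          mul_le_mul (by linarith) (by linarith) h3 (by linarith)
  · have hQx : (Q : ℝ) ≤ √x := hQ.trans (div_le_self (Real.sqrt_nonneg x)
      (Real.one_le_rpow hlog (by positivity)))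
    have h1 := totalDiscrepancy_trivial hh hx1 hlog (by linarith) hyx hQx
    have h2 : y * t ^ 3 ≤ x / t ^ K := by
      have h3 : t ^ K' = t ^ |K| * t ^ 3 := by
        rw [hK', Real.rpow_add ht0]; norm_cast
      rw [h3] at hy
      have h4 : t ^ K ≤ t ^ |K| := Real.rpow_le_rpow_of_exponent_le hlog (le_abs_self K)
      calc y * t ^ 3 ≤ x / (t ^ |K| * t ^ 3) * t ^ 3 := by gcongr
        _ = x / t ^ |K| := by field_simp
        _ ≤ _ := by gcongr
    have h3 : t * √x ≤ x / t ^ K := by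
      rw [le_div_iff₀ hKp]
      calc t * √x * t ^ K = √x * (t * t ^ K) := by ring
        _ = √x * t ^ (1 + K) := by rw [Real.rpow_add ht0, Real.rpow_one]
        _ ≤ √x * √x := by gcongr
        _ = x := hsqx
    have h4 : 0 ≤ y / t ^ A := by positivity
    have h5 : 0 ≤ x / t ^ K := by positivity
    have h6 : 0 ≤ C * 2 ^ |A| := by positivity
    calc _ ≤ 18 * (x / t ^ K) := by linarith
      _ ≤ (C * 2 ^ |A| + 18) * (y / t ^ A + x / t ^ K) :=
          mul_le_mul (by linarith) (by linarith) h5 (by linarith)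

lemma norm_log_succ_sub_log_le {n : ℕ} (hn : 1 ≤ n) :
    ‖((Real.log (n + 1 : ℕ) : ℝ) : ℂ) - (Real.log n : ℝ)‖ ≤ 1 / n := by
  have hn0 : (0 : ℝ) < n := by exact_mod_cast hn
  rw [← Complex.ofReal_sub, Complex.norm_real]
  have h1 : Real.log n ≤ Real.log (n + 1 : ℕ) := Real.log_le_log hn0 (by push_cast; linarith)
  rw [Real.norm_of_nonneg (by linarith), ← Real.log_div (by positivity) hn0.ne']
  refine (Real.log_le_sub_one_of_pos (by positivity)).trans (le_of_eq ?_)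
  push_cast
  field_simp
  ring

lemma sum_Ico_one_div_le {x : ℝ} (hlog : 1 ≤ Real.log x) (hx : 1 ≤ x) :
    ∑ n ∈ Ico 1 ⌊x⌋₊, (1 / n : ℝ) ≤ 2 * Real.log x := by
  have h1 : ∑ n ∈ Ico 1 ⌊x⌋₊, (1 / n : ℝ) ≤ ∑ n ∈ Icc 1 ⌊x⌋₊, (1 / n : ℝ) :=
    sum_le_sum_of_subset_of_nonneg Ico_subset_Icc_self fun _ _ _ => by positivity
  have h2 := sum_Icc_one_div_le ⌊x⌋₊
  have h3 : Real.log ⌊x⌋₊ ≤ Real.log x :=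
    Real.log_le_log (by exact_mod_cast (Nat.one_le_floor_iff x).mpr hx)
      (Nat.floor_le (by linarith))
  linarith

lemma BVUniform.mul_log {h : ℕ → ℂ} {A : ℝ} (hU : BVUniform h (A + 1)) :
    BVBound (fun n => h n * (Real.log n : ℝ)) A := by
  obtain ⟨B, C, hB, hC, hev⟩ := hU (A + 1)
  refine ⟨B, 6 * C, hB, by positivity, ?_⟩
  filter_upwards [hev, eventually_log_ge 1, eventually_ge_atTop 2] with x hx hlog hx2 Q hQ
  set t := Real.log x with ht
  have ht0 : 0 < t := by linarith
  have hx0 : 0 ≤ x := by linarith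
  have hN : 1 ≤ ⌊x⌋₊ := (Nat.one_le_floor_iff x).mpr (by linarith)
  have hNx : (⌊x⌋₊ : ℝ) ≤ x := Nat.floor_le hx0
  have hA1 : t ^ (A + 1) = t ^ A * t := by rw [Real.rpow_add ht0, Real.rpow_one]
  have hAp : 0 < t ^ A := Real.rpow_pos_of_pos ht0 _
  have hbd : ∀ n ∈ Icc 1 ⌊x⌋₊, totalDiscrepancy h n Q ≤ 2 * C * (x / t ^ A) / t := by
    intro n hn
    rw [mem_Icc] at hn
    have hnx : (n : ℝ) ≤ x := le_trans (by exact_mod_cast hn.2) hNx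
    refine (hx Q hQ n (by exact_mod_cast hn.1) hnx).trans ?_
    rw [hA1]
    calc C * (n / (t ^ A * t) + x / (t ^ A * t))
        ≤ C * (x / (t ^ A * t) + x / (t ^ A * t)) := by gcongr
      _ = _ := by field_simp; ring
  rw [← totalDiscrepancy_floor]
  refine (totalDiscrepancy_mul_le h (fun n => ((Real.log n : ℝ) : ℂ)) hN Q).trans ?_
  set Y := 2 * C * (x / t ^ A) / t with hY
  have hY0 : 0 ≤ Y := by positivity
  have h1 : ‖((Real.log ⌊x⌋₊ : ℝ) : ℂ)‖ * totalDiscrepancy h ⌊x⌋₊ Q ≤ t * Y := by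
    rw [Complex.norm_real, Real.norm_of_nonneg (Real.log_natCast_nonneg _)]
    refine mul_le_mul ?_ (hbd _ (mem_Icc.mpr ⟨hN, le_rfl⟩)) (totalDiscrepancy_nonneg _ _ _) ht0.le
    exact Real.log_le_log (by exact_mod_cast hN) hNx
  have h2 : ∑ n ∈ Ico 1 ⌊x⌋₊, ‖((Real.log (n + 1 : ℕ) : ℝ) : ℂ) - (Real.log n : ℝ)‖ *
      totalDiscrepancy h n Q ≤ 2 * t * Y := by
    calc _ ≤ ∑ n ∈ Ico 1 ⌊x⌋₊, (1 / n : ℝ) * Y := by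
          refine sum_le_sum fun n hn => ?_
          exact mul_le_mul (norm_log_succ_sub_log_le (mem_Ico.mp hn).1)
            (hbd n (Ico_subset_Icc_self hn)) (totalDiscrepancy_nonneg _ _ _) (by positivity)
      _ ≤ _ := by
          rw [← Finset.sum_mul]
          exact mul_le_mul_of_nonneg_right (sum_Ico_one_div_le hlog (by linarith)) hY0
  calc _ ≤ t * Y + 2 * t * Y := add_le_add h1 h2
    _ = _ := by rw [hY]; field_simp; ring

/-- A full power of log x is gained. In the partial summation the differences of log are at most
1/n, and against them the main term n/(log x)^A sums to x/(log x)^A without a logarithm. The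
secondary term is taken with exponent A + 1 to pay for ∑ 1/n. -/
lemma BVUniform.of_mul_log {h : ℕ → ℂ} {A : ℝ} (hU : BVUniform h A)
    (hL : BVBound (fun n => h n * (Real.log n : ℝ)) A) : BVBound h (A + 1) := by
  obtain ⟨B, C, hB, hC, hev⟩ := hU (A + 1)
  obtain ⟨B', C', hB', hC', hev'⟩ := hL
  refine ⟨max B B', 2 * (C' + 3 * C), le_max_of_le_left hB, by positivity, ?_⟩
  filter_upwards [hev, hev', eventually_log_ge 1, eventually_ge_atTop 4]
    with x hx hx' hlog hx4 Q hQ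
  set t := Real.log x with ht
  have ht0 : 0 < t := by linarith
  have hx0 : 0 ≤ x := by linarith
  have hN : 1 ≤ ⌊x⌋₊ := (Nat.one_le_floor_iff x).mpr (by linarith)
  have hNx : (⌊x⌋₊ : ℝ) ≤ x := Nat.floor_le hx0
  have hA1 : t ^ (A + 1) = t ^ A * t := by rw [Real.rpow_add ht0, Real.rpow_one]
  have hAp : 0 < t ^ A := Real.rpow_pos_of_pos ht0 _
  have hQ1 := hQ.trans (div_rpow_mono (Real.sqrt_nonneg x) hlog (le_max_left B B'))
  have hQ2 := hQ.trans (div_rpow_mono (Real.sqrt_nonneg x) hlog (le_max_right B B'))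
  have h1 := mul_totalDiscrepancy_le h (fun n => ((Real.log n : ℝ) : ℂ)) hN Q
  rw [totalDiscrepancy_floor, totalDiscrepancy_floor] at h1
  have h2 : ∑ n ∈ Ico 1 ⌊x⌋₊, ‖((Real.log (n + 1 : ℕ) : ℝ) : ℂ) - (Real.log n : ℝ)‖ *
      totalDiscrepancy h n Q ≤ 3 * C * (x / t ^ A) := by
    calc _ ≤ ∑ n ∈ Ico 1 ⌊x⌋₊, (C / t ^ A + C * (x / t ^ A) / t * (1 / n : ℝ)) := by
          refine sum_le_sum fun n hn => ?_
          rw [mem_Ico] at hn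
          have hn0 : (0 : ℝ) < n := by exact_mod_cast hn.1
          have hnx : (n : ℝ) ≤ x := le_trans (by exact_mod_cast hn.2.le) hNx
          refine (mul_le_mul (norm_log_succ_sub_log_le hn.1)
            (hx Q hQ1 n (by exact_mod_cast hn.1) hnx) (totalDiscrepancy_nonneg _ _ _)
            (by positivity)).trans (le_of_eq ?_)
          rw [hA1]
          field_simp
      _ ≤ x * (C / t ^ A) + C * (x / t ^ A) / t * (2 * t) := by
          rw [Finset.sum_add_distrib, ← Finset.mul_sum, Finset.sum_const, nsmul_eq_mul,
            Nat.card_Ico]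
          have h3 : ((⌊x⌋₊ - 1 : ℕ) : ℝ) ≤ x := le_trans (by exact_mod_cast Nat.sub_le _ _) hNx
          have h4 := sum_Ico_one_div_le hlog (by linarith : 1 ≤ x)
          gcongr
      _ = _ := by field_simp; ring
  have h3 := hx' Q hQ2
  have hlogN : t / 2 ≤ ‖((Real.log ⌊x⌋₊ : ℝ) : ℂ)‖ := by
    rw [Complex.norm_real, Real.norm_of_nonneg (Real.log_natCast_nonneg _), ht,
      ← Real.log_sqrt hx0]
    refine Real.log_le_log (Real.sqrt_pos.mpr (by linarith)) ?_
    have h5 : √x ≤ x / 2 := by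
      rw [Real.sqrt_le_left (by linarith)]
      nlinarith
    exact h5.trans (half_le_floor (by linarith))
  have h4 : t / 2 * totalDiscrepancy h x Q ≤ (C' + 3 * C) * (x / t ^ A) := by
    refine (mul_le_mul_of_nonneg_right hlogN (totalDiscrepancy_nonneg _ _ _)).trans ?_
    linarith
  rw [hA1]
  calc totalDiscrepancy h x Q = (2 / t) * (t / 2 * totalDiscrepancy h x Q) := by field_simp
    _ ≤ (2 / t) * ((C' + 3 * C) * (x / t ^ A)) := by gcongr
    _ = _ := by field_simp

/-- From n = 2 on the sum telescopes. At n = 1 the convention 1 / log 1 = 0 makes the first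
difference 1 / log 2 ≤ 2. -/
lemma sum_abs_inv_log_sub_le {N : ℕ} (hN : 2 ≤ N) :
    ∑ n ∈ Ico 1 N, |1 / Real.log (n + 1 : ℕ) - 1 / Real.log n| ≤ 4 - 1 / Real.log N := by
  induction N, hN using Nat.le_induction with
  | base =>
    have h2 : 1 / Real.log 2 ≤ 2 := by
      have := Real.log_two_gt_d9
      rw [div_le_iff₀ (by linarith)]; linarith
    have h3 : 0 ≤ 1 / Real.log 2 := by have := Real.log_two_gt_d9; positivity
    rw [show Ico 1 2 = {1} from rfl, Finset.sum_singleton]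
    norm_num
    rw [one_div] at h2 h3
    have := Real.log_two_gt_d9
    rw [abs_of_pos (by positivity)]
    linarith
  | succ N hN ih =>
    rw [Finset.sum_Ico_succ_top (by omega)]
    have h1 : 0 < Real.log N := Real.log_pos (by exact_mod_cast hN)
    have h2 : 1 / Real.log (N + 1 : ℕ) ≤ 1 / Real.log N := by
      refine one_div_le_one_div_of_le h1 (Real.log_le_log ?_ (by push_cast; linarith))
      exact_mod_cast (by omega : 0 < N)
    rw [abs_of_nonpos (by linarith)]
    linarith

lemma BVUniform.div_log {h : ℕ → ℂ} {A : ℝ} (hU : BVUniform h A) :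
    BVBound (fun n => h n * ((1 / Real.log n : ℝ) : ℂ)) A := by
  obtain ⟨B, C, hB, hC, hev⟩ := hU A
  refine ⟨B, 8 * C, hB, by positivity, ?_⟩
  filter_upwards [hev, eventually_log_ge 1, eventually_ge_atTop 2] with x hx hlog hx2 Q hQ
  set t := Real.log x with ht
  have ht0 : 0 < t := by linarith
  have hx0 : 0 ≤ x := by linarith
  have hN : 2 ≤ ⌊x⌋₊ := Nat.le_floor (by exact_mod_cast hx2)
  have hNx : (⌊x⌋₊ : ℝ) ≤ x := Nat.floor_le hx0
  have hAp : 0 < t ^ A := Real.rpow_pos_of_pos ht0 _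
  set Y := 2 * C * (x / t ^ A) with hY
  have hY0 : 0 ≤ Y := by positivity
  have hbd : ∀ n ∈ Icc 1 ⌊x⌋₊, totalDiscrepancy h n Q ≤ Y := by
    intro n hn
    rw [mem_Icc] at hn
    have hnx : (n : ℝ) ≤ x := le_trans (by exact_mod_cast hn.2) hNx
    refine (hx Q hQ n (by exact_mod_cast hn.1) hnx).trans ?_
    calc C * (n / t ^ A + x / t ^ A) ≤ C * (x / t ^ A + x / t ^ A) := by gcongr
      _ = _ := by rw [hY]; ring
  rw [← totalDiscrepancy_floor]
  refine (totalDiscrepancy_mul_le h (fun n => ((1 / Real.log n : ℝ) : ℂ))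
    (by omega : 1 ≤ ⌊x⌋₊) Q).trans ?_
  have hw0 : 0 ≤ 1 / Real.log ⌊x⌋₊ := one_div_nonneg.mpr (Real.log_natCast_nonneg _)
  have h1 : ‖((1 / Real.log ⌊x⌋₊ : ℝ) : ℂ)‖ * totalDiscrepancy h ⌊x⌋₊ Q
      ≤ 1 / Real.log ⌊x⌋₊ * Y := by
    rw [Complex.norm_real, Real.norm_of_nonneg hw0]
    exact mul_le_mul_of_nonneg_left (hbd _ (mem_Icc.mpr ⟨by omega, le_rfl⟩)) hw0
  have h2 : ∑ n ∈ Ico 1 ⌊x⌋₊, ‖((1 / Real.log (n + 1 : ℕ) : ℝ) : ℂ) - (1 / Real.log n : ℝ)‖ *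
      totalDiscrepancy h n Q ≤ (4 - 1 / Real.log ⌊x⌋₊) * Y := by
    calc _ ≤ ∑ n ∈ Ico 1 ⌊x⌋₊, |1 / Real.log (n + 1 : ℕ) - 1 / Real.log n| * Y := by
          refine sum_le_sum fun n hn => ?_
          rw [← Complex.ofReal_sub, Complex.norm_real, Real.norm_eq_abs]
          exact mul_le_mul_of_nonneg_left (hbd n (Ico_subset_Icc_self hn)) (abs_nonneg _)
      _ ≤ _ := by
          rw [← Finset.sum_mul]
          exact mul_le_mul_of_nonneg_right (sum_abs_inv_log_sub_le hN) hY0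
  calc _ ≤ 1 / Real.log ⌊x⌋₊ * Y + (4 - 1 / Real.log ⌊x⌋₊) * Y := add_le_add h1 h2
    _ = _ := by rw [hY]; ring

/-! ### Bombieri–Vinogradov bounds for a convolution. -/

/-- A function restricted to the integers not exceeding `L`. -/
def truncateAbove (L : ℕ) (F : ℕ → ℂ) (n : ℕ) : ℂ := if n ≤ L then F n else 0

lemma dirichletConv_comm (u v : ℕ → ℂ) (n : ℕ) : dirichletConv u v n = dirichletConv v u n := by
  rw [dirichletConv, dirichletConv]
  conv_lhs => rw [← Nat.map_swap_divisorsAntidiagonal, Finset.sum_map]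
  exact sum_congr rfl fun p _ => mul_comm _ _

/-- Pairs with both variables at most `L` are counted in the first piece, which is why the second
carries `truncateBelow L u`. -/
lemma dirichletConv_split (L : ℕ) (u v : ℕ → ℂ) :
    dirichletConv u v = fun n => (dirichletConv (truncateAbove L u) v n +
      dirichletConv (truncateAbove L v) (truncateBelow L u) n) +
      dirichletConv (truncateBelow L u) (truncateBelow L v) n := by
  funext n
  rw [dirichletConv_comm (truncateAbove L v)]
  simp only [dirichletConv, ← Finset.sum_add_distrib]
  refine sum_congr rfl fun p _ => ?_
  simp only [truncateAbove, truncateBelow]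
  split_ifs <;> ring

lemma totalDiscrepancy_truncateBelow_le (u : ℕ → ℂ) (L : ℕ) {y : ℝ} (hy : 0 ≤ y) (Q : ℕ) :
    totalDiscrepancy (truncateBelow L u) y Q
      ≤ totalDiscrepancy u y Q + totalDiscrepancy u (min y L) Q := by
  rw [totalDiscrepancy, totalDiscrepancy, totalDiscrepancy, ← Finset.sum_add_distrib]
  refine sum_le_sum fun q hq => maxDiscrepancy_le fun a => ?_
  have hq1 := (mem_Icc.mp hq).1
  have h1 : discrepancy (truncateBelow L u) y q a
      = discrepancy u y q a - discrepancy u (min y L) q a := by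
    simp only [discrepancy_eq_sum]
    have h2 : Icc 1 ⌊min y L⌋₊ = (Icc 1 ⌊y⌋₊).filter (· ≤ L) := by
      ext n
      simp only [mem_Icc, mem_filter, Nat.le_floor_iff (le_min hy (Nat.cast_nonneg L)),
        Nat.le_floor_iff hy, le_min_iff, Nat.cast_le]
      tauto
    rw [h2, Finset.sum_filter, ← Finset.sum_sub_distrib]
    refine sum_congr rfl fun n _ => ?_
    rw [truncateBelow]
    split_ifs <;> simp
  rw [h1]
  exact (norm_sub_le _ _).trans (add_le_add (norm_discrepancy_le_max _ _ hq1 a)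
    (norm_discrepancy_le_max _ _ hq1 a))

lemma totalDiscrepancy_truncateAbove_conv_le (u v : ℕ → ℂ) (L : ℕ) (y : ℝ) (Q : ℕ) :
    totalDiscrepancy (dirichletConv (truncateAbove L u) v) y Q
      ≤ ∑ a ∈ Icc 1 L, ‖u a‖ * totalDiscrepancy v (y / a) Q := by
  refine (totalDiscrepancy_dirichletConv_le _ v y Q).trans ?_
  have h1 : ∑ a ∈ Icc 1 ⌊y⌋₊, ‖truncateAbove L u a‖ * totalDiscrepancy v (y / a) Q
      = ∑ a ∈ Icc 1 ⌊y⌋₊ with a ≤ L, ‖u a‖ * totalDiscrepancy v (y / a) Q := by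
    rw [Finset.sum_filter]
    refine sum_congr rfl fun a _ => ?_
    rw [truncateAbove]
    split_ifs <;> simp
  rw [h1]
  refine sum_le_sum_of_subset_of_nonneg (fun a ha => ?_)
    fun _ _ _ => mul_nonneg (norm_nonneg _) (totalDiscrepancy_nonneg _ _ _)
  simp only [mem_filter, mem_Icc] at ha ⊢
  omega

/-- The logarithm of the cut is of size log log x, so its square is below any positive power of log
x; the power 1/2 is the loss in the convolution step. -/
lemma eventually_one_add_log_floor_sq_le {K : ℝ} (hK : 0 < K) :
    ∀ᶠ x : ℝ in atTop,
      (1 + Real.log ⌊Real.log x ^ K⌋₊) ^ 2 ≤ Real.log x ^ (1 / 2 : ℝ) := by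
  have h1 : ∀ᶠ t : ℝ in atTop, (1 + Real.log ⌊t ^ K⌋₊) ^ 2 ≤ t ^ (1 / 2 : ℝ) := by
    have h2 : ∀ᶠ t : ℝ in atTop, 1 + K ≤ t ^ (1 / 8 : ℝ) :=
      (tendsto_rpow_atTop (by norm_num)).eventually_ge_atTop _
    filter_upwards [h2, eventually_log_rpow_le 1 (s := 1 / 8) (by norm_num),
      eventually_ge_atTop 1] with t h2 h3 ht
    have ht0 : 0 < t := by linarith
    rw [Real.rpow_one] at h3
    have hp1 : 1 ≤ t ^ K := Real.one_le_rpow ht hK.le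
    have h4 : Real.log ⌊t ^ K⌋₊ ≤ K * Real.log t := by
      rw [← Real.log_rpow ht0]
      refine Real.log_le_log ?_ (Nat.floor_le (by positivity))
      exact_mod_cast (Nat.one_le_floor_iff _).mpr hp1
    set z := t ^ (1 / 8 : ℝ) with hz
    have hz1 : 1 ≤ z := by linarith
    have h5 : 1 + Real.log ⌊t ^ K⌋₊ ≤ z ^ 2 := by
      calc 1 + Real.log ⌊t ^ K⌋₊ ≤ 1 * z + K * z := by
            have : K * Real.log t ≤ K * z := by gcongr
            linarith
        _ = (1 + K) * z := by ring
        _ ≤ z * z := by gcongr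
        _ = z ^ 2 := by ring
    have h6 : t ^ (1 / 2 : ℝ) = (z ^ 2) ^ 2 := by
      rw [hz, ← pow_mul, ← Real.rpow_natCast, ← Real.rpow_mul ht0.le]
      norm_num
    rw [h6]
    have h7 : 0 ≤ Real.log ⌊t ^ K⌋₊ := Real.log_natCast_nonneg _
    gcongr
  exact Real.tendsto_log_atTop.eventually h1

lemma sum_norm_mul_le {u : ℕ → ℂ} (hu : ∀ n : ℕ, 1 ≤ n → ‖u n‖ ≤ 1 + Real.log n) (L : ℕ)
    {Y Z : ℝ} (hY : 0 ≤ Y) (hZ : 0 ≤ Z) {g : ℕ → ℝ}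
    (hg : ∀ a ∈ Icc 1 L, g a ≤ Y * (1 / a) + Z) :
    ∑ a ∈ Icc 1 L, ‖u a‖ * g a ≤ (1 + Real.log L) ^ 2 * (Y + L * Z) := by
  have hl : 0 ≤ Real.log L := Real.log_natCast_nonneg L
  calc _ ≤ ∑ a ∈ Icc 1 L, (1 + Real.log L) * (Y * (1 / a) + Z) := by
        refine sum_le_sum fun a ha => ?_
        have ha1 := (mem_Icc.mp ha).1
        have h1 : ‖u a‖ ≤ 1 + Real.log L := by
          refine (hu a ha1).trans ?_
          have := Real.log_le_log (by exact_mod_cast ha1 : (0 : ℝ) < a)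
            (by exact_mod_cast (mem_Icc.mp ha).2 : (a : ℝ) ≤ L)
          linarith
        exact (mul_le_mul_of_nonneg_left (hg a ha) (norm_nonneg _)).trans
          (mul_le_mul_of_nonneg_right h1 (by positivity))
    _ = (1 + Real.log L) * (Y * (∑ a ∈ Icc 1 L, (1 / a : ℝ)) + L * Z) := by
        rw [← Finset.mul_sum, Finset.sum_add_distrib, ← Finset.mul_sum, Finset.sum_const,
          nsmul_eq_mul, Nat.card_Icc, Nat.add_sub_cancel]
    _ ≤ (1 + Real.log L) * (Y * (1 + Real.log L) + L * Z * (1 + Real.log L)) := by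
        have h2 := sum_Icc_one_div_le L
        have h3 : L * Z ≤ L * Z * (1 + Real.log L) :=
          le_mul_of_one_le_right (by positivity) (by linarith)
        gcongr
    _ = _ := by ring

/-- Bounds of Bombieri–Vinogradov type for two functions pass to their convolution, provided that
character sums over these functions of small modulus are small. -/
lemma BVUniform.dirichletConv {u v : ℕ → ℂ}
    (hu : ∀ n : ℕ, 1 ≤ n → ‖u n‖ ≤ 1 + Real.log n) (hv : ∀ n : ℕ, 1 ≤ n → ‖v n‖ ≤ 1 + Real.log n)
    (hSu : CharacterSumBound u) (hSv : CharacterSumBound v) {A : ℝ} (hUu : BVUniform u A)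
    (hUv : BVUniform v A) : BVBound (_root_.dirichletConv u v) (A - 1 / 2) := by
  -- `A` may be negative here, whereas the bilinear estimate needs a positive exponent.
  obtain ⟨K, B₀, C₀, hK, hB₀, hC₀, hev₀⟩ :=
    totalDiscrepancy_bilinear_eventually_le hu hv hSu hSv (A := max A 1) (by positivity)
  -- The secondary term of the uniform bound is summed over at most (log x)^K values of a, hence the
  -- exponent A + K.
  obtain ⟨Bu, Cu, hBu, hCu, hevu⟩ := hUu (A + K)
  obtain ⟨Bv, Cv, hBv, hCv, hevv⟩ := hUv (A + K)
  refine ⟨max B₀ (max Bu Bv), 2 * Cv + 4 * Cu + C₀, le_max_of_le_left hB₀, by positivity, ?_⟩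
  filter_upwards [hev₀, hevu, hevv, eventually_one_add_log_floor_sq_le hK, eventually_log_ge 1,
    eventually_ge_atTop 1, eventually_log_rpow_le K (s := 1) one_pos]
    with x hx₀ hxu hxv hL2 hlog hx1 hKx Q hQ
  set t := Real.log x with ht
  have ht0 : 0 < t := by linarith
  have hx0 : 0 ≤ x := by linarith
  rw [Real.rpow_one] at hKx
  have hQ₀ := hQ.trans (div_rpow_mono (Real.sqrt_nonneg x) hlog (le_max_left B₀ (max Bu Bv)))
  have hQu := hQ.trans (div_rpow_mono (Real.sqrt_nonneg x) hlog
    ((le_max_left Bu Bv).trans (le_max_right B₀ (max Bu Bv))))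
  have hQv := hQ.trans (div_rpow_mono (Real.sqrt_nonneg x) hlog
    ((le_max_right Bu Bv).trans (le_max_right B₀ (max Bu Bv))))
  have hAp : 0 < t ^ A := Real.rpow_pos_of_pos ht0 _
  have hKp : 0 < t ^ K := Real.rpow_pos_of_pos ht0 _
  have hAK : t ^ (A + K) = t ^ A * t ^ K := Real.rpow_add ht0 _ _
  rw [hAK] at hxu hxv
  set L := ⌊t ^ K⌋₊ with hL
  have hLK : (L : ℝ) ≤ t ^ K := Nat.floor_le hKp.le
  have hdiv : ∀ a ∈ Icc 1 L, 1 ≤ x / a ∧ x / a ≤ x := by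
    intro a ha
    have ha0 : (0 : ℝ) < a := by exact_mod_cast (mem_Icc.mp ha).1
    have haL : (a : ℝ) ≤ L := by exact_mod_cast (mem_Icc.mp ha).2
    refine ⟨?_, div_le_self hx0 (by exact_mod_cast (mem_Icc.mp ha).1)⟩
    rw [le_div_iff₀ ha0, one_mul]
    exact haL.trans (hLK.trans hKx)
  set Z := x / (t ^ A * t ^ K) with hZ
  have hZ0 : 0 ≤ Z := by positivity
  have hhalf : t ^ (A - 1 / 2) = t ^ A / t ^ (1 / 2 : ℝ) := Real.rpow_sub ht0 _ _
  have hhp : 0 < t ^ (1 / 2 : ℝ) := Real.rpow_pos_of_pos ht0 _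
  have hfin : ∀ c : ℝ, 0 ≤ c → (1 + Real.log L) ^ 2 * (c * (x / t ^ A) + L * (c * Z))
      ≤ 2 * c * (x / t ^ (A - 1 / 2)) := by
    intro c hc
    calc _ ≤ t ^ (1 / 2 : ℝ) * (c * (x / t ^ A) + t ^ K * (c * Z)) := by gcongr
      _ = _ := by rw [hZ, hhalf]; field_simp; ring
  have e1 : totalDiscrepancy (_root_.dirichletConv (truncateAbove L u) v) x Q
      ≤ 2 * Cv * (x / t ^ (A - 1 / 2)) := by
    refine (totalDiscrepancy_truncateAbove_conv_le u v L x Q).trans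
      ((sum_norm_mul_le hu L (Y := Cv * (x / t ^ A)) (Z := Cv * Z) (by positivity)
        (by positivity) fun a ha => ?_).trans (hfin Cv hCv))
    obtain ⟨d1, d2⟩ := hdiv a ha
    refine (hxv Q hQv _ d1 d2).trans (le_of_eq ?_)
    ring
  have e2 : totalDiscrepancy (_root_.dirichletConv (truncateAbove L v) (truncateBelow L u)) x Q
      ≤ 2 * (2 * Cu) * (x / t ^ (A - 1 / 2)) := by
    refine (totalDiscrepancy_truncateAbove_conv_le v _ L x Q).trans
      ((sum_norm_mul_le hv L (Y := 2 * Cu * (x / t ^ A)) (Z := 2 * Cu * Z) (by positivity)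
        (by positivity) fun a ha => ?_).trans (hfin (2 * Cu) (by positivity)))
    obtain ⟨d1, d2⟩ := hdiv a ha
    have hL1 : (1 : ℝ) ≤ L := by
      rw [mem_Icc] at ha
      exact_mod_cast ha.1.trans ha.2
    refine (totalDiscrepancy_truncateBelow_le u L (by linarith) Q).trans ?_
    have h1 := hxu Q hQu _ d1 d2
    have h2 := hxu Q hQu (min (x / a) L) (le_min d1 hL1) ((min_le_left _ _).trans d2)
    have h3 : min (x / a) L / t ^ A ≤ x / a / t ^ A := by
      gcongr
      exact min_le_left _ _
    have h4 : Cu * (min (x / a) L / t ^ A + Z) ≤ Cu * (x / a / t ^ A + Z) := by gcongr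
    calc _ ≤ Cu * (x / a / t ^ A + Z) + Cu * (x / a / t ^ A + Z) :=
          add_le_add h1 (h2.trans h4)
      _ = _ := by ring
  have e3 := hx₀ Q hQ₀
  have e4 : x / t ^ max A 1 ≤ x / t ^ (A - 1 / 2) :=
    div_rpow_mono hx0 hlog (by have := le_max_left A 1; linarith)
  rw [dirichletConv_split L u v]
  refine (totalDiscrepancy_add_le _ _ x Q).trans ((add_le_add_left
    (totalDiscrepancy_add_le _ _ x Q) _).trans ?_)
  have e5 := mul_le_mul_of_nonneg_left e4 hC₀
  linarith

/-! ### Character sums from the Siegel–Walfisz criterion. -/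

/-- The mean subtracted in the discrepancy does not depend on the class, so a nonprincipal character
annihilates it. Discrepancies therefore control character sums at the cost of a factor φ(r) ≤ r. -/
lemma sum_units_mul_discrepancyWeight {r : ℕ} [NeZero r] {χ : DirichletCharacter ℂ r}
    (hχ : χ ≠ 1) (n : ℕ) :
    ∑ c : (ZMod r)ˣ, χ c * discrepancyWeight r c n = χ n := by
  have h0 : ∑ c : (ZMod r)ˣ, χ c = 0 := by
    rw [← MulChar.sum_eq_zero_of_ne_one hχ]
    symm
    rw [← Finset.sum_subset (s₁ := univ.map ⟨fun u : (ZMod r)ˣ => (u : ZMod r),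
      Units.val_injective⟩) (subset_univ _), Finset.sum_map]
    · rfl
    · intro b _ hb
      refine χ.map_nonunit ?_
      rintro ⟨u, hu⟩
      exact hb (by rw [Finset.mem_map]; exact ⟨u, mem_univ _, hu⟩)
  simp only [discrepancyWeight, mul_sub, Finset.sum_sub_distrib, ← Finset.sum_mul, h0, zero_mul,
    sub_zero]
  by_cases hn : IsUnit (n : ZMod r)
  · obtain ⟨v, hv⟩ := hn
    rw [← hv]
    simp [Units.val_inj]
  · rw [χ.map_nonunit hn]
    refine Finset.sum_eq_zero fun c _ => ?_
    have hne : (n : ZMod r) ≠ c := fun h => hn (by rw [h]; exact c.isUnit)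
    rw [if_neg hne, mul_zero]

lemma norm_sum_mul_character_le {h : ℕ → ℂ} {y M : ℝ} {r : ℕ} (hr : 1 ≤ r)
    {χ : DirichletCharacter ℂ r} (hχ : χ ≠ 1) (hM0 : 0 ≤ M)
    (hM : ∀ a : (ZMod r)ˣ, ‖discrepancy h y r a‖ ≤ M) :
    ‖∑ n ∈ Icc 1 ⌊y⌋₊, h n * χ n‖ ≤ r * M := by
  have : NeZero r := ⟨by omega⟩
  have h1 : ∑ n ∈ Icc 1 ⌊y⌋₊, h n * χ n
      = ∑ c : (ZMod r)ˣ, χ c * discrepancy h y r c := by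
    simp only [discrepancy_eq_sum, Finset.mul_sum]
    rw [Finset.sum_comm]
    refine sum_congr rfl fun n _ => ?_
    rw [← sum_units_mul_discrepancyWeight hχ n, Finset.mul_sum]
    exact sum_congr rfl fun c _ => by ring
  rw [h1]
  calc _ ≤ ∑ c : (ZMod r)ˣ, M := by
        refine (norm_sum_le _ _).trans (sum_le_sum fun c _ => ?_)
        rw [norm_mul, DirichletCharacter.unit_norm_eq_one, one_mul]
        exact hM c
    _ = r.totient * M := by
        rw [Finset.sum_const, nsmul_eq_mul, Finset.card_univ, ZMod.card_units_eq_totient]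
    _ ≤ _ := by
        gcongr
        exact_mod_cast Nat.totient_le r

lemma log_rpow_le_mul_rpow_quarter {A : ℝ} (hA : 0 < A) {y : ℝ} (hy : 1 ≤ y) :
    Real.log y ^ A ≤ (4 * A) ^ A * y ^ (1 / 4 : ℝ) := by
  have h1 := Real.log_le_rpow_div (by linarith : (0 : ℝ) ≤ y)
    (ε := 1 / (4 * A)) (by positivity)
  have h2 := Real.rpow_le_rpow (Real.log_nonneg hy) h1 hA.le
  refine h2.trans (le_of_eq ?_)
  rw [div_div_eq_mul_div, div_one, Real.mul_rpow (by positivity) (by positivity),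
    ← Real.rpow_mul (by linarith), mul_comm]
  congr 2
  field_simp

lemma rpow_three_quarters_le {A : ℝ} (hA : 0 < A) {y : ℝ} (hy : 2 ≤ y) :
    y ^ (3 / 4 : ℝ) ≤ (4 * A) ^ A * (y / Real.log y ^ A) := by
  have hl : 0 < Real.log y := Real.log_pos (by linarith)
  have hy0 : 0 < y := by linarith
  rw [← mul_div_assoc, le_div_iff₀ (Real.rpow_pos_of_pos hl _)]
  calc y ^ (3 / 4 : ℝ) * Real.log y ^ A
      ≤ y ^ (3 / 4 : ℝ) * ((4 * A) ^ A * y ^ (1 / 4 : ℝ)) := by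
        gcongr
        exact log_rpow_le_mul_rpow_quarter hA (by linarith)
    _ = (4 * A) ^ A * (y ^ (3 / 4 : ℝ) * y ^ (1 / 4 : ℝ)) := by ring
    _ = _ := by rw [← Real.rpow_add hy0]; norm_num

lemma div_log_rpow_le {A : ℝ} (hA : 0 < A) {y k : ℝ} (hy : 1 < y) (hk : √y ≤ k) :
    k / Real.log k ^ A ≤ 2 ^ A * (k / Real.log y ^ A) := by
  have hl : 0 < Real.log y := Real.log_pos hy
  have hs : 0 < √y := Real.sqrt_pos.mpr (by linarith)
  have hk0 : 0 < k := hs.trans_le hk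
  have h1 : Real.log y / 2 ≤ Real.log k := by
    rw [← Real.log_sqrt (by linarith)]
    exact Real.log_le_log hs hk
  have h2 := Real.rpow_le_rpow (by positivity) h1 hA.le
  rw [Real.div_rpow hl.le (by norm_num)] at h2
  calc k / Real.log k ^ A ≤ k / (Real.log y ^ A / 2 ^ A) := by gcongr
    _ = _ := by field_simp

lemma norm_sum_mul_character_le_floor {h : ℕ → ℂ} (hh : ∀ n, ‖h n‖ ≤ 1) {y : ℝ} (hy : 0 ≤ y)
    {r : ℕ} (χ : DirichletCharacter ℂ r) (m : ℕ) :
    ‖∑ n ∈ Icc 1 ⌊y⌋₊ with n.Coprime m, h n * χ n‖ ≤ y := by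
  calc _ ≤ ∑ n ∈ Icc 1 ⌊y⌋₊ with n.Coprime m, (1 : ℝ) := by
        refine (norm_sum_le _ _).trans (sum_le_sum fun n _ => ?_)
        rw [norm_mul]
        exact mul_le_one₀ (hh n) (norm_nonneg _) (DirichletCharacter.norm_le_one χ _)
    _ ≤ ⌊y⌋₊ := by
        rw [Finset.sum_const, nsmul_eq_mul, mul_one]
        have := card_filter_le (Icc 1 ⌊y⌋₊) fun n => n.Coprime m
        rw [Nat.card_Icc, Nat.add_sub_cancel] at this
        exact_mod_cast this
    _ ≤ y := Nat.floor_le hy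

lemma SiegelWalfiszCriterion.norm_character_sum_le {h : ℕ → ℂ} (hh : SiegelWalfiszCriterion h) {A : ℝ}
    (hA : 0 < A) : ∃ C : ℝ, 0 ≤ C ∧ ∀ y : ℝ, 2 ≤ y → ∀ r : ℕ, 1 ≤ r →
      ∀ χ : DirichletCharacter ℂ r, χ ≠ 1 →
        ‖∑ n ∈ Icc 1 ⌊y⌋₊, h n * χ n‖ ≤ C * r * (y / Real.log y ^ A) := by
  obtain ⟨C, hC⟩ := hh A hA
  refine ⟨|C|, abs_nonneg _, fun y hy r hr χ hχ => ?_⟩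
  have hl : 0 < Real.log y := Real.log_pos (by linarith)
  have hp : 0 ≤ y / Real.log y ^ A := by positivity
  refine (norm_sum_mul_character_le hr hχ (M := |C| * (y / Real.log y ^ A)) (by positivity)
    fun a => (hC y hy r hr a).trans ?_).trans (le_of_eq (by ring))
  exact mul_le_mul_of_nonneg_right (le_abs_self C) hp

lemma one_le_card_divisors_sq {m : ℕ} (hm : 1 ≤ m) : (1 : ℝ) ≤ (#m.divisors : ℝ) ^ 2 := by
  refine one_le_pow₀ ?_
  exact_mod_cast Finset.card_pos.mpr ⟨1, Nat.one_mem_divisors.mpr (by omega)⟩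

/-- Partial summation needs all lengths k ≤ y. Below √y the trivial bound suffices; above it log k
is at least (log y)/2. The exponent A + 1 pays for the logarithmic weight. -/
lemma CharacterSumBound.mul_log {h : ℕ → ℂ} (hh : ∀ n, ‖h n‖ ≤ 1) (hS : CharacterSumBound h) :
    CharacterSumBound fun n => h n * (Real.log n : ℝ) := by
  intro A hA
  obtain ⟨C, hC0, hC⟩ := hS (A + 1) (by linarith)
  set C' := C * 2 ^ (A + 1) + (4 * (A + 1)) ^ (A + 1) with hC'
  have hC'0 : 0 ≤ C' := by positivity
  refine ⟨4 * C', by positivity, fun y hy r hr χ hχ m hm => ?_⟩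
  have hl : 0 < Real.log y := Real.log_pos (by linarith)
  have hy0 : 0 < y := by linarith
  set d := (#m.divisors : ℝ) ^ 2
  have hd1 : 1 ≤ d := one_le_card_divisors_sq hm
  have hr1 : (1 : ℝ) ≤ r := by exact_mod_cast hr
  have hrd : 1 ≤ r * d := one_le_mul_of_one_le_of_one_le hr1 hd1
  set Y := C' * (r * d) * (y / Real.log y ^ (A + 1)) with hY
  have hp : 0 ≤ y / Real.log y ^ (A + 1) := by positivity
  have hY0 : 0 ≤ Y := by positivity
  set c : ℕ → ℂ := fun n => if n.Coprime m then h n * χ n else 0 with hc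
  have hN : 1 ≤ ⌊y⌋₊ := (Nat.one_le_floor_iff y).mpr (by linarith)
  have hpart : ∀ k ∈ Icc 1 ⌊y⌋₊, ‖∑ n ∈ Icc 1 k, c n‖ ≤ Y := by
    intro k hk
    rw [mem_Icc] at hk
    have hky : (k : ℝ) ≤ y := le_trans (by exact_mod_cast hk.2) (Nat.floor_le hy0.le)
    simp only [hc]
    rw [← Finset.sum_filter]
    rcases le_or_gt √y k with hsk | hsk
    · have hk2 : (2 : ℝ) ≤ k := by
        have h1 : (1 : ℝ) < √y := by rw [Real.lt_sqrt (by norm_num)]; linarith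
        have h2 : 1 < k := by exact_mod_cast h1.trans_le hsk
        exact_mod_cast h2
      have h1 := hC k hk2 r hr χ hχ m hm
      rw [Nat.floor_natCast] at h1
      have h2 := div_log_rpow_le (A := A + 1) (by linarith) (by linarith) hsk
      calc _ ≤ C * r * d * (2 ^ (A + 1) * (k / Real.log y ^ (A + 1))) := by
            refine h1.trans ?_
            gcongr
        _ ≤ C * r * d * (2 ^ (A + 1) * (y / Real.log y ^ (A + 1))) := by gcongr
        _ = C * 2 ^ (A + 1) * (r * d) * (y / Real.log y ^ (A + 1)) := by ring
        _ ≤ Y := by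
            rw [hY, hC']
            gcongr
            exact le_add_of_nonneg_right (by positivity)
    · have h1 := norm_sum_mul_character_le_floor hh (Nat.cast_nonneg (α := ℝ) k) χ m
      rw [Nat.floor_natCast] at h1
      have h2 := rpow_three_quarters_le (A := A + 1) (by linarith) hy
      have h3 : √y ≤ y ^ (3 / 4 : ℝ) := by
        rw [Real.sqrt_eq_rpow]
        exact Real.rpow_le_rpow_of_exponent_le (by linarith) (by norm_num)
      calc _ ≤ (4 * (A + 1)) ^ (A + 1) * (y / Real.log y ^ (A + 1)) :=
            h1.trans (hsk.le.trans (h3.trans h2))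
        _ ≤ C' * (y / Real.log y ^ (A + 1)) := by
            rw [hC']
            gcongr
            exact le_add_of_nonneg_left (by positivity)
        _ ≤ C' * (r * d) * (y / Real.log y ^ (A + 1)) := by
            gcongr
            exact le_mul_of_one_le_right hC'0 hrd
  have h1 : ∑ n ∈ Icc 1 ⌊y⌋₊ with n.Coprime m, h n * (Real.log n : ℝ) * χ n
      = ∑ n ∈ Icc 1 ⌊y⌋₊, c n * ((Real.log n : ℝ) : ℂ) := by
    rw [Finset.sum_filter]
    refine sum_congr rfl fun n _ => ?_
    simp only [hc]
    split_ifs <;> ring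
  have hlogN : Real.log ⌊y⌋₊ ≤ Real.log y :=
    Real.log_le_log (by exact_mod_cast hN) (Nat.floor_le hy0.le)
  rw [h1, sum_Icc_mul_by_parts c (fun n => ((Real.log n : ℝ) : ℂ)) hN]
  have e1 : ‖((Real.log ⌊y⌋₊ : ℝ) : ℂ) * ∑ n ∈ Icc 1 ⌊y⌋₊, c n‖ ≤ Real.log y * Y := by
    rw [norm_mul, Complex.norm_real, Real.norm_of_nonneg (Real.log_natCast_nonneg _)]
    exact mul_le_mul hlogN (hpart _ (mem_Icc.mpr ⟨hN, le_rfl⟩)) (norm_nonneg _) hl.le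
  have e2 : ‖∑ n ∈ Ico 1 ⌊y⌋₊, (((Real.log (n + 1 : ℕ) : ℝ) : ℂ) - (Real.log n : ℝ)) *
      ∑ k ∈ Icc 1 n, c k‖ ≤ (1 + Real.log y) * Y := by
    calc _ ≤ ∑ n ∈ Icc 1 ⌊y⌋₊, (1 / n : ℝ) * Y := by
          refine (norm_sum_le _ _).trans ((sum_le_sum fun n hn => ?_).trans
            (sum_le_sum_of_subset_of_nonneg Ico_subset_Icc_self fun _ _ _ => by positivity))
          rw [norm_mul]
          exact mul_le_mul (norm_log_succ_sub_log_le (mem_Ico.mp hn).1)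
            (hpart n (Ico_subset_Icc_self hn)) (norm_nonneg _) (by positivity)
      _ ≤ _ := by
          rw [← Finset.sum_mul]
          refine mul_le_mul_of_nonneg_right ((sum_Icc_one_div_le _).trans ?_) hY0
          linarith
  have hl2 : 1 ≤ 2 * Real.log y := by
    have := Real.log_two_gt_d9
    have := Real.log_le_log (by norm_num) hy
    linarith
  calc _ ≤ Real.log y * Y + (1 + Real.log y) * Y := (norm_sub_le _ _).trans (add_le_add e1 e2)
    _ = (1 + 2 * Real.log y) * Y := by ring
    _ ≤ (4 * Real.log y) * Y := by gcongr; linarith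
    _ = _ := by
        rw [hY, Real.rpow_add hl, Real.rpow_one]
        field_simp

lemma CharacterSumBound.add_small {u w : ℕ → ℂ} (hu : CharacterSumBound u)
    (hw : ∀ y : ℝ, 2 ≤ y → ∑ n ∈ Icc 1 ⌊y⌋₊, ‖w n‖ ≤ 2 * √y * Real.log y) :
    CharacterSumBound fun n => u n + w n := by
  intro A hA
  obtain ⟨C, hC0, hC⟩ := hu A hA
  refine ⟨C + 2 * (4 * (A + 1)) ^ (A + 1), by positivity, fun y hy r hr χ hχ m hm => ?_⟩
  have hl : 0 < Real.log y := Real.log_pos (by linarith)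
  have hy0 : 0 < y := by linarith
  have hrd : 1 ≤ (r : ℝ) * (#m.divisors : ℝ) ^ 2 :=
    one_le_mul_of_one_le_of_one_le (by exact_mod_cast hr) (one_le_card_divisors_sq hm)
  simp only [add_mul, Finset.sum_add_distrib]
  have h1 := hC y hy r hr χ hχ m hm
  have h2 : ‖∑ n ∈ Icc 1 ⌊y⌋₊ with n.Coprime m, w n * χ n‖ ≤ 2 * √y * Real.log y := by
    refine le_trans ((norm_sum_le _ _).trans ?_) (hw y hy)
    refine le_trans (sum_le_sum fun n _ => ?_)
      (sum_le_sum_of_subset_of_nonneg (filter_subset _ _) fun _ _ _ => norm_nonneg _)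
    rw [norm_mul]
    exact mul_le_of_le_one_right (norm_nonneg _) (DirichletCharacter.norm_le_one χ _)
  have h3 : √y * Real.log y ≤ (4 * (A + 1)) ^ (A + 1) * (y / Real.log y ^ A) := by
    have h4 := rpow_three_quarters_le (A := A + 1) (by linarith) hy
    have h5 : √y ≤ y ^ (3 / 4 : ℝ) := by
      rw [Real.sqrt_eq_rpow]
      exact Real.rpow_le_rpow_of_exponent_le (by linarith) (by norm_num)
    calc √y * Real.log y
        ≤ (4 * (A + 1)) ^ (A + 1) * (y / Real.log y ^ (A + 1)) * Real.log y := by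
          gcongr
          exact h5.trans h4
      _ = _ := by
          rw [Real.rpow_add hl, Real.rpow_one]
          field_simp
  have hp : 0 ≤ y / Real.log y ^ A := by positivity
  calc _ ≤ C * r * (#m.divisors : ℝ) ^ 2 * (y / Real.log y ^ A)
        + 2 * ((4 * (A + 1)) ^ (A + 1) * (y / Real.log y ^ A)) := by
        refine (norm_add_le _ _).trans (add_le_add h1 (h2.trans ?_))
        linarith
    _ ≤ C * r * (#m.divisors : ℝ) ^ 2 * (y / Real.log y ^ A)
        + 2 * ((4 * (A + 1)) ^ (A + 1) * (y / Real.log y ^ A)) * (r * (#m.divisors : ℝ) ^ 2) := by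
        exact add_le_add le_rfl (le_mul_of_one_le_right (by positivity) hrd)
    _ = _ := by ring

/-- The sum is at most the Euler product of (1 - p^(-1/2))⁻¹ over p ∣ m, and each factor is at most
4 ≤ (v_p(m) + 1)², because p^(-1/2) ≤ 3/4. -/
lemma sum_factoredNumbers_inv_sqrt_le {m : ℕ} (hm : 1 ≤ m) (N : ℕ) :
    ∑ a ∈ Icc 1 N with a ∈ Nat.factoredNumbers m.primeFactors, (√(a : ℝ))⁻¹
      ≤ (#m.divisors : ℝ) ^ 2 := by
  classical
  let F : ℕ →* ℝ :=
    { toFun := fun n => (√(n : ℝ))⁻¹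
      map_one' := by simp
      map_mul' := fun a b => by
        rw [Nat.cast_mul, Real.sqrt_mul (Nat.cast_nonneg a), mul_inv] }
  have hF0 : ∀ n, 0 ≤ F n := fun n => inv_nonneg.mpr (Real.sqrt_nonneg _)
  have hF : ∀ {p : ℕ}, p.Prime → F p ≤ 3 / 4 := by
    intro p hp
    have h2 : (4 / 3 : ℝ) ≤ √(p : ℝ) := by
      refine Real.le_sqrt_of_sq_le ?_
      have : (2 : ℝ) ≤ p := by exact_mod_cast hp.two_le
      linarith
    change (√(p : ℝ))⁻¹ ≤ 3 / 4
    rw [inv_le_comm₀ (by linarith) (by norm_num)]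
    linarith
  have h1 := (EulerProduct.summable_and_hasSum_factoredNumbers_prod_filter_prime_geometric
    (f := F) (fun {p} hp => by
      rw [Real.norm_of_nonneg (hF0 p)]
      linarith [hF hp]) m.primeFactors).2
  set T : Finset ℕ := (Icc 1 N).filter (· ∈ Nat.factoredNumbers m.primeFactors) with hT
  have h2 : ∑ a ∈ T, F a = ∑ a ∈ T.attach.map ⟨fun a =>
      (⟨a.1, (mem_filter.mp a.2).2⟩ : Nat.factoredNumbers m.primeFactors),
      fun a b hab => Subtype.ext (by simpa using hab)⟩, F a := by
    rw [Finset.sum_map]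
    exact (Finset.sum_attach T F).symm
  change ∑ a ∈ T, F a ≤ _
  rw [h2]
  refine (sum_le_hasSum _ (fun _ _ => hF0 _) h1).trans ?_
  have h3 : m.primeFactors.filter Nat.Prime = m.primeFactors :=
    filter_true_of_mem fun p hp => Nat.prime_of_mem_primeFactors hp
  rw [h3, Nat.card_divisors (by omega), Nat.cast_prod, ← Finset.prod_pow]
  refine Finset.prod_le_prod (fun p hp => ?_) fun p hp => ?_
  · have := hF (Nat.prime_of_mem_primeFactors hp)
    exact inv_nonneg.mpr (by linarith)
  · have h4 := hF (Nat.prime_of_mem_primeFactors hp)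
    have h5 : (1 - F p)⁻¹ ≤ 4 := by
      rw [inv_le_comm₀ (by linarith) (by norm_num)]
      linarith
    have h6 : 1 ≤ m.factorization p :=
      (Nat.prime_of_mem_primeFactors hp).factorization_pos_of_dvd (by omega)
        (Nat.dvd_of_mem_primeFactors hp)
    have h7 : (2 : ℝ) ≤ ((m.factorization p + 1 : ℕ) : ℝ) := by
      exact_mod_cast Nat.succ_le_succ h6
    have : (2 : ℝ) ^ 2 ≤ ((m.factorization p + 1 : ℕ) : ℝ) ^ 2 := by gcongr
    linarith

/-- The restriction of `g` to the integers composed of primes in `S`. -/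
def restrictFactored (S : Finset ℕ) (g : ArithmeticFunction ℂ) : ArithmeticFunction ℂ :=
  ⟨fun n => Set.indicator (Nat.factoredNumbers S) g n, by
    by_cases h : 0 ∈ Nat.factoredNumbers S <;> simp [h]⟩

lemma restrictFactored_apply (S : Finset ℕ) (g : ArithmeticFunction ℂ) (n : ℕ) :
    restrictFactored S g n = Set.indicator (Nat.factoredNumbers S) g n := rfl

lemma mul_mem_factoredNumbers_iff {S : Finset ℕ} {a b : ℕ} :
    a * b ∈ Nat.factoredNumbers S ↔ a ∈ Nat.factoredNumbers S ∧ b ∈ Nat.factoredNumbers S := by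
  refine ⟨fun h => ?_, fun h => Nat.mul_mem_factoredNumbers h.1 h.2⟩
  simp only [Nat.mem_factoredNumbers'] at h ⊢
  exact ⟨fun p hp hpa => h p hp (hpa.mul_right b), fun p hp hpb => h p hp (hpb.mul_left a)⟩

lemma isMultiplicative_restrictFactored (S : Finset ℕ) {g : ArithmeticFunction ℂ}
    (hg : g.IsMultiplicative) : (restrictFactored S g).IsMultiplicative := by
  classical
  rw [ArithmeticFunction.IsMultiplicative.iff_ne_zero]
  have h1 : 1 ∈ Nat.factoredNumbers S := by
    rw [Nat.mem_factoredNumbers]; simp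
  refine ⟨by rw [restrictFactored_apply, Set.indicator_of_mem h1, hg.map_one], ?_⟩
  intro a b _ _ hab
  simp only [restrictFactored_apply, Set.indicator_apply, mul_mem_factoredNumbers_iff]
  by_cases h2 : a ∈ Nat.factoredNumbers S <;> by_cases h3 : b ∈ Nat.factoredNumbers S <;>
    simp [h2, h3, hg.map_mul_of_coprime hab]

lemma arithmeticFunction_mul_congr_left {u v w : ArithmeticFunction ℂ} {n : ℕ}
    (h : ∀ d : ℕ, d ∣ n → u d = v d) : (u * w) n = (v * w) n := by
  rw [ArithmeticFunction.mul_apply, ArithmeticFunction.mul_apply]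
  refine sum_congr rfl fun p hp => ?_
  rw [h p.1 (Dvd.intro _ (Nat.mem_divisorsAntidiagonal.mp hp).1)]

/-- Sieving by Dirichlet inverse: convolving with the part of `g` on primes dividing `m` cancels the
Euler factors of `f` at those primes and leaves the others. Both sides are multiplicative, so prime
powers suffice. -/
lemma restrictFactored_mul_eq {f g : ArithmeticFunction ℂ} (hf : f.IsMultiplicative)
    (hg : g.IsMultiplicative) (hgf : g * f = 1) {m : ℕ} (hm : 1 ≤ m) (n : ℕ) :
    (restrictFactored m.primeFactors g * f) n = if n.Coprime m then f n else 0 := by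
  classical
  let R : ArithmeticFunction ℂ := ⟨fun n => if n.Coprime m then f n else 0, by simp⟩
  have hR : R.IsMultiplicative := by
    rw [ArithmeticFunction.IsMultiplicative.iff_ne_zero]
    refine ⟨?_, fun {a b} ha hb hab => ?_⟩
    · change (if Nat.Coprime 1 m then f 1 else 0) = 1
      rw [if_pos (Nat.coprime_one_left m), hf.map_one]
    · change (if Nat.Coprime (a * b) m then f (a * b) else 0)
        = (if Nat.Coprime a m then f a else 0) * (if Nat.Coprime b m then f b else 0)
      have hc := Nat.coprime_mul_iff_left (k := m) (m := a) (n := b)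
      rw [hf.map_mul_of_coprime hab]
      by_cases h2 : a.Coprime m
      · by_cases h3 : b.Coprime m
        · rw [if_pos h2, if_pos h3, if_pos (hc.mpr ⟨h2, h3⟩)]
        · rw [if_neg h3, if_neg fun h => h3 (hc.mp h).2, mul_zero]
      · rw [if_neg h2, if_neg fun h => h2 (hc.mp h).1, zero_mul]
  have hmain : restrictFactored m.primeFactors g * f = R := by
    rw [((isMultiplicative_restrictFactored m.primeFactors hg).mul
      hf).eq_iff_eq_on_prime_powers _ _ hR]
    intro p i hp
    change _ = if Nat.Coprime (p ^ i) m then f (p ^ i) else 0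
    rcases Nat.eq_zero_or_pos i with hi | hi
    · subst hi
      rw [pow_zero, if_pos (Nat.coprime_one_left m),
        ((isMultiplicative_restrictFactored m.primeFactors hg).mul hf).map_one, hf.map_one]
    by_cases hpm : p ∣ m
    · rw [if_neg fun h => hp.one_lt.ne' (Nat.Coprime.eq_one_of_dvd
        (Nat.Coprime.coprime_dvd_left (dvd_pow_self p hi.ne') h) hpm),
        arithmeticFunction_mul_congr_left (v := g), hgf, ArithmeticFunction.one_apply_ne]
      · exact (Nat.one_lt_pow hi.ne' hp.one_lt).ne'
      · intro d hd
        rw [restrictFactored_apply, Set.indicator_of_mem]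
        rw [Nat.mem_factoredNumbers']
        intro r hr hrd
        rw [(Nat.prime_dvd_prime_iff_eq hr hp).mp (hr.dvd_of_dvd_pow (hrd.trans hd))]
        exact Nat.mem_primeFactors.mpr ⟨hp, hpm, by omega⟩
    · rw [if_pos (Nat.Coprime.pow_left i ((Nat.Prime.coprime_iff_not_dvd hp).mpr hpm)),
        arithmeticFunction_mul_congr_left (v := 1), one_mul]
      intro d hd
      by_cases hd1 : d = 1
      · rw [hd1, (isMultiplicative_restrictFactored m.primeFactors hg).map_one,
          ArithmeticFunction.one_one]
      · rw [ArithmeticFunction.one_apply_ne hd1, restrictFactored_apply,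
          Set.indicator_of_notMem]
        intro hmem
        rw [Nat.mem_factoredNumbers'] at hmem
        obtain ⟨r, hr, hrd⟩ := Nat.exists_prime_and_dvd hd1
        have h1 := hmem r hr hrd
        rw [(Nat.prime_dvd_prime_iff_eq hr hp).mp (hr.dvd_of_dvd_pow (hrd.trans hd))] at h1
        exact hpm (Nat.dvd_of_mem_primeFactors h1)
  rw [hmain]
  rfl

/-- The saving a^(-1/2) is what makes the sum over integers composed of primes dividing m bounded in
terms of m alone. If y/a ≥ √y the hypothesis applies, unless y/a < 2, and then y < 4. If y/a < √y,
then a ≥ √y, and the trivial bound y/a saves y^(1/4) besides a^(1/2). -/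
lemma norm_sum_mul_character_div_le {h : ℕ → ℂ} (hh : ∀ n, ‖h n‖ ≤ 1) {A C : ℝ} (hA : 0 < A)
    (hC0 : 0 ≤ C) {y : ℝ} (hy : 2 ≤ y) {r : ℕ} (hr : 1 ≤ r) (χ : DirichletCharacter ℂ r)
    (hC : ∀ z : ℝ, 2 ≤ z → ‖∑ n ∈ Icc 1 ⌊z⌋₊, h n * χ n‖ ≤ C * r * (z / Real.log z ^ A))
    {a : ℕ} (ha : 1 ≤ a) :
    ‖∑ n ∈ Icc 1 (⌊y⌋₊ / a), h n * χ n‖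
      ≤ (C * 2 ^ A + (4 * A) ^ A + 2 ^ A) * r * (y / Real.log y ^ A) * (√(a : ℝ))⁻¹ := by
  have hl : 0 < Real.log y := Real.log_pos (by linarith)
  have hy0 : 0 < y := by linarith
  have ha1 : (1 : ℝ) ≤ a := by exact_mod_cast ha
  have ha0 : (0 : ℝ) < a := by linarith
  have hr1 : (1 : ℝ) ≤ r := by exact_mod_cast hr
  have hsa : 1 ≤ √(a : ℝ) := Real.one_le_sqrt.mpr ha1
  have hsa0 : 0 < √(a : ℝ) := by linarith
  have hL : 0 < Real.log y ^ A := Real.rpow_pos_of_pos hl _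
  have hinv : (1 / a : ℝ) = (√(a : ℝ))⁻¹ * (√(a : ℝ))⁻¹ := by
    rw [← mul_inv, Real.mul_self_sqrt ha0.le, one_div]
  have hinv1 : (√(a : ℝ))⁻¹ ≤ 1 := inv_le_one_of_one_le₀ hsa
  have htriv : ‖∑ n ∈ Icc 1 ⌊y / a⌋₊, h n * χ n‖ ≤ y / a := by
    have := norm_sum_mul_character_le_floor hh (y := y / a) (by positivity) χ 1
    simpa using this
  rw [← Nat.floor_div_natCast]
  have hfin : ∀ c : ℝ, 0 ≤ c → c ≤ (C * 2 ^ A + (4 * A) ^ A + 2 ^ A) * r →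
      ∀ t : ℝ, t ≤ c * (y / Real.log y ^ A) * (√(a : ℝ))⁻¹ →
        t ≤ (C * 2 ^ A + (4 * A) ^ A + 2 ^ A) * r * (y / Real.log y ^ A) * (√(a : ℝ))⁻¹ := by
    intro c hc0 hc t ht
    refine ht.trans ?_
    gcongr
  have hp1 : (0 : ℝ) ≤ C * 2 ^ A := by positivity
  have hp2 : (0 : ℝ) ≤ (4 * A) ^ A := by positivity
  have hp3 : (0 : ℝ) ≤ 2 ^ A := by positivity
  have hle : ∀ c : ℝ, c ≤ C * 2 ^ A + (4 * A) ^ A + 2 ^ A →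
      c ≤ (C * 2 ^ A + (4 * A) ^ A + 2 ^ A) * r := fun c hc =>
    hc.trans (le_mul_of_one_le_right (by positivity) hr1)
  by_cases h1 : √y ≤ y / a
  · by_cases h2 : 2 ≤ y / a
    · refine hfin (C * 2 ^ A * r) (by positivity)
        (mul_le_mul_of_nonneg_right (by linarith) (by linarith)) _ ((hC _ h2).trans ?_)
      calc _ ≤ C * r * (2 ^ A * ((y / a) / Real.log y ^ A)) := by
            gcongr
            exact div_log_rpow_le hA (by linarith) h1
        _ = C * 2 ^ A * r * (y / Real.log y ^ A) * (1 / a : ℝ) := by ring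
        _ = C * 2 ^ A * r * (y / Real.log y ^ A) * (√(a : ℝ))⁻¹ * (√(a : ℝ))⁻¹ := by
            rw [hinv]; ring
        _ ≤ _ := mul_le_of_le_one_right (by positivity) hinv1
    · refine hfin (2 ^ A) hp3 (hle _ (by linarith)) _ (htriv.trans ?_)
      have hy4 : y < 4 := by
        rw [not_le] at h2
        have h3 : √y < 2 := h1.trans_lt h2
        rw [Real.sqrt_lt' (by norm_num)] at h3
        linarith
      have hl2 : Real.log y ≤ 2 := by
        have := Real.log_le_log hy0 hy4.le
        have h4 : Real.log 4 = 2 * Real.log 2 := by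
          rw [← Real.log_rpow (by norm_num)]; norm_num
        have := Real.log_two_lt_d9
        linarith
      have h5 : Real.log y ^ A ≤ 2 ^ A := Real.rpow_le_rpow hl.le hl2 hA.le
      calc y / a = y * (√(a : ℝ))⁻¹ * (√(a : ℝ))⁻¹ := by
            rw [mul_assoc, ← hinv]; ring
        _ ≤ y * (√(a : ℝ))⁻¹ := mul_le_of_le_one_right (by positivity) hinv1
        _ ≤ 2 ^ A * (y / Real.log y ^ A) * (√(a : ℝ))⁻¹ := by
            gcongr
            rw [← mul_div_assoc, le_div_iff₀ hL, mul_comm]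
            gcongr
  · refine hfin ((4 * A) ^ A) hp2 (hle _ (by linarith)) _ (htriv.trans ?_)
    rw [not_le] at h1
    have h3 : √y ≤ a := by
      rw [div_lt_iff₀ ha0] at h1
      have h4 : √y * √y = y := Real.mul_self_sqrt hy0.le
      have h5 : 0 < √y := Real.sqrt_pos.mpr hy0
      by_contra h6
      rw [not_le] at h6
      have := mul_lt_mul_of_pos_left h6 h5
      linarith
    have h4 : y ^ (1 / 4 : ℝ) ≤ √(a : ℝ) := by
      have h5 := Real.sqrt_le_sqrt h3
      have h6 : √(√y) = y ^ (1 / 4 : ℝ) := by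
        rw [Real.sqrt_eq_rpow, Real.sqrt_eq_rpow, ← Real.rpow_mul hy0.le]
        norm_num
      rwa [h6] at h5
    have h5 := log_rpow_le_mul_rpow_quarter hA (y := y) (by linarith)
    calc y / a = y * (√(a : ℝ))⁻¹ * (√(a : ℝ))⁻¹ := by
          rw [mul_assoc, ← hinv]; ring
      _ ≤ ((4 * A) ^ A * (y / Real.log y ^ A)) * (√(a : ℝ))⁻¹ := by
          refine mul_le_mul_of_nonneg_right ?_ (by positivity)
          rw [← div_eq_mul_inv, div_le_iff₀ hsa0, ← mul_div_assoc, div_mul_eq_mul_div,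
            le_div_iff₀ hL]
          calc y * Real.log y ^ A ≤ y * ((4 * A) ^ A * √(a : ℝ)) := by
                gcongr
                exact h5.trans (by gcongr)
            _ = _ := by ring

/-- For a multiplicative function bounded by one, together with its Dirichlet inverse, the
Siegel–Walfisz criterion bounds character sums over integers coprime to a given modulus. -/
lemma SiegelWalfiszCriterion.characterSumBound {f g : ArithmeticFunction ℂ}
    (hf : f.IsMultiplicative) (hg : g.IsMultiplicative) (hgf : g * f = 1)
    (hf1 : ∀ n, ‖f n‖ ≤ 1) (hg1 : ∀ n, ‖g n‖ ≤ 1) (hS : SiegelWalfiszCriterion f) :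
    CharacterSumBound f := by
  classical
  intro A hA
  obtain ⟨C, hC0, hC⟩ := hS.norm_character_sum_le hA
  set C' := C * 2 ^ A + (4 * A) ^ A + 2 ^ A with hC'
  have hC'0 : 0 ≤ C' := by positivity
  refine ⟨C', hC'0, fun y hy r hr χ hχ m hm => ?_⟩
  have hl : 0 < Real.log y := Real.log_pos (by linarith)
  set G := restrictFactored m.primeFactors g with hG
  -- The coprimality condition becomes a convolution with `G`, whose variable runs over integers
  -- composed of primes dividing m; what remains is a complete character sum of `f` of length y/a.
  have h1 : ∑ n ∈ Icc 1 ⌊y⌋₊ with n.Coprime m, f n * χ n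
      = ∑ a ∈ Icc 1 ⌊y⌋₊, G a * χ a * ∑ b ∈ Icc 1 (⌊y⌋₊ / a), f b * χ b := by
    have h2 := sum_dirichletConv_mul G f (fun n => χ n) ⌊y⌋₊
    rw [Finset.sum_filter]
    calc _ = ∑ n ∈ Icc 1 ⌊y⌋₊, dirichletConv G f n * χ n := sum_congr rfl fun n _ => ?_
      _ = _ := h2.trans (sum_congr rfl fun a _ => ?_)
    · have h3 := restrictFactored_mul_eq hf hg hgf hm n
      rw [ArithmeticFunction.mul_apply] at h3
      rw [dirichletConv, h3, ite_mul, zero_mul]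
    · rw [mul_assoc, Finset.mul_sum (a := χ a)]
      refine congrArg (G a * ·) ?_
      refine sum_congr rfl fun b _ => ?_
      rw [Nat.cast_mul, map_mul]
      ring
  rw [h1]
  calc _ ≤ ∑ a ∈ Icc 1 ⌊y⌋₊, if a ∈ Nat.factoredNumbers m.primeFactors then
          C' * r * (y / Real.log y ^ A) * (√(a : ℝ))⁻¹ else 0 := by
        refine (norm_sum_le _ _).trans (sum_le_sum fun a ha => ?_)
        rw [mem_Icc] at ha
        split_ifs with hmem
        · rw [norm_mul, norm_mul]
          have h2 := norm_sum_mul_character_div_le hf1 hA hC0 hy hr χ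
            (fun z hz => hC z hz r hr χ hχ) ha.1
          have h3 : ‖G a‖ * ‖χ a‖ ≤ 1 := by
            refine mul_le_one₀ ?_ (norm_nonneg _) (DirichletCharacter.norm_le_one χ _)
            rw [hG, restrictFactored_apply, Set.indicator_of_mem hmem]
            exact hg1 a
          exact (mul_le_of_le_one_left (norm_nonneg _) h3).trans h2
        · rw [hG, restrictFactored_apply, Set.indicator_of_notMem hmem]
          simp
    _ = C' * r * (y / Real.log y ^ A) *
          ∑ a ∈ Icc 1 ⌊y⌋₊ with a ∈ Nat.factoredNumbers m.primeFactors, (√(a : ℝ))⁻¹ := by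
        rw [← Finset.sum_filter, Finset.mul_sum]
    _ ≤ C' * r * (y / Real.log y ^ A) * (#m.divisors : ℝ) ^ 2 := by
        refine mul_le_mul_of_nonneg_left ?_ (by positivity)
        convert sum_factoredNumbers_inv_sqrt_le hm ⌊y⌋₊
    _ = _ := by ring

/-! ### The Bombieri–Vinogradov Hypothesis implies the Siegel–Walfisz criterion. -/

/-- A single term of the sum of d(n)²/n already bounds d(q) by √q·(1 + log q)², and 1/φ(q) ≤ d(q)/q.
With 1 + log q ≤ 9q^(1/8), the constant is 81 = 9². -/
lemma one_div_totient_le_rpow {q : ℕ} (hq : 1 ≤ q) :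
    (1 / q.totient : ℝ) ≤ 81 / (q : ℝ) ^ (1 / 4 : ℝ) := by
  have hq1 : (1 : ℝ) ≤ q := by exact_mod_cast hq
  have hq0 : (0 : ℝ) < q := by linarith
  have hl : 0 ≤ Real.log q := Real.log_nonneg hq1
  have h1 : (#q.divisors : ℝ) ^ 2 / q ≤ (1 + Real.log q) ^ 4 := by
    have h2 := sum_card_divisors_pow_div_le 2 q
    norm_num only at h2
    refine le_trans ?_ h2
    exact Finset.single_le_sum (f := fun n : ℕ => (#n.divisors : ℝ) ^ 2 / n)
      (fun n _ => by positivity) (mem_Icc.mpr ⟨hq, le_rfl⟩)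
  set e := (q : ℝ) ^ (1 / 8 : ℝ) with he
  have he1 : 1 ≤ e := Real.one_le_rpow hq1 (by norm_num)
  have hlog : 1 + Real.log q ≤ 9 * e := by
    have := Real.log_le_rpow_div hq0.le (ε := 1 / 8) (by norm_num)
    rw [div_div_eq_mul_div, div_one, ← he] at this
    linarith
  have he4 : e ^ 4 = √(q : ℝ) := by
    rw [he, ← Real.rpow_natCast, ← Real.rpow_mul hq0.le, Real.sqrt_eq_rpow]
    norm_num
  have he2 : e ^ 2 = (q : ℝ) ^ (1 / 4 : ℝ) := by
    rw [he, ← Real.rpow_natCast, ← Real.rpow_mul hq0.le]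
    norm_num
  have he8 : (e ^ 4) ^ 2 = q := by rw [he4, Real.sq_sqrt hq0.le]
  have hd : (#q.divisors : ℝ) ≤ 81 * e ^ 6 := by
    rw [div_le_iff₀ hq0] at h1
    refine (sq_le_sq₀ (by positivity) (by positivity)).mp (h1.trans ?_)
    calc (1 + Real.log q) ^ 4 * q ≤ (9 * e) ^ 4 * q := by gcongr
      _ = (9 * e) ^ 4 * (e ^ 4) ^ 2 := by rw [he8]
      _ = _ := by ring
  refine (one_div_totient_le q hq).trans ?_
  rw [← he2, div_le_div_iff₀ hq0 (by positivity), ← he8]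
  calc (#q.divisors : ℝ) * e ^ 2 ≤ 81 * e ^ 6 * e ^ 2 := by gcongr
    _ = _ := by ring

lemma norm_discrepancy_le_totalDiscrepancy (h : ℕ → ℂ) (y : ℝ) {q : ℕ} (hq : 1 ≤ q)
    (a : (ZMod q)ˣ) : ‖discrepancy h y q a‖ ≤ totalDiscrepancy h y q :=
  (norm_discrepancy_le_max h y hq a).trans
    (Finset.single_le_sum (f := fun q => maxDiscrepancy h y q)
      (fun _ _ => maxDiscrepancy_nonneg _ _ _) (mem_Icc.mpr ⟨hq, le_rfl⟩))

/-- For bounded functions the Bombieri–Vinogradov Hypothesis implies the Siegel–Walfisz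
criterion. -/
lemma BombieriVinogradovHypothesis.siegelWalfisz {h : ℕ → ℂ} (hh : ∀ n, ‖h n‖ ≤ 1)
    (hBV : BombieriVinogradovHypothesis h) : SiegelWalfiszCriterion h := by
  intro A hA
  obtain ⟨B, C, hB, hC, hev⟩ := bvBound_of_hypothesis hBV A
  have hev' : ∀ᶠ x : ℝ in atTop, ∀ q : ℕ, 1 ≤ q → ∀ a : (ZMod q)ˣ,
      ‖discrepancy h x q a‖ ≤ (C + 163) * (x / Real.log x ^ A) := by
    filter_upwards [hev, eventually_log_ge 1, eventually_ge_atTop 1,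
      eventually_log_rpow_le (4 * A + B) (s := 1 / 2) (by norm_num),
      eventually_log_rpow_le A (s := 1) (by norm_num)] with x hx hlog hx1 hs1 hs2 q hq a
    have hx0 : 0 < x := by linarith
    have hl : 0 < Real.log x := by linarith
    have hp : 0 ≤ x / Real.log x ^ A := by positivity
    rcases le_or_gt (q : ℝ) (√x / Real.log x ^ B) with hqx | hqx
    · refine (norm_discrepancy_le_totalDiscrepancy h x hq a).trans ((hx q hqx).trans ?_)
      exact mul_le_mul_of_nonneg_right (by linarith) hp
    -- Beyond the range of the hypothesis q exceeds (log x)^(4A), so 1/φ(q) ≤ 81/(log x)^A and the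
    -- trivial bound is enough, with 163 = 2·81 + 1.
    · have h1 : Real.log x ^ (4 * A) ≤ q := by
        refine le_trans ?_ hqx.le
        rw [le_div_iff₀ (by positivity), ← Real.rpow_add hl, Real.sqrt_eq_rpow]
        exact hs1
      have h2 : Real.log x ^ A ≤ (q : ℝ) ^ (1 / 4 : ℝ) := by
        have h3 := Real.rpow_le_rpow (by positivity) h1 (z := 1 / 4) (by norm_num)
        rw [← Real.rpow_mul hl.le] at h3
        convert h3 using 2
        ring
      have h3 : (1 : ℝ) ≤ x / Real.log x ^ A := by
        rw [le_div_iff₀ (by positivity), one_mul]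
        simpa using hs2
      have h4 : (1 / q.totient : ℝ) ≤ 81 / Real.log x ^ A :=
        (one_div_totient_le_rpow hq).trans (by gcongr)
      calc ‖discrepancy h x q a‖ ≤ 1 * (2 * x * (1 / q.totient) + 1) :=
            norm_discrepancy_le_of_bounded hx0.le zero_le_one (fun n _ => hh n) hq _
        _ ≤ 1 * (2 * x * (81 / Real.log x ^ A) + x / Real.log x ^ A) := by gcongr
        _ = 163 * (x / Real.log x ^ A) := by ring
        _ ≤ _ := mul_le_mul_of_nonneg_right (by linarith) hp
  obtain ⟨x₀, hx₀⟩ := eventually_atTop.mp hev'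
  set x₁ := max x₀ 2 with hx₁
  set S := 2 * ∑ n ∈ Icc 1 ⌊x₁⌋₊, ‖h n‖ with hS
  have hS0 : 0 ≤ S := by positivity
  have hx₁2 : 2 ≤ x₁ := le_max_right _ _
  have hl1 : 0 < Real.log x₁ := Real.log_pos (by linarith)
  have hT : 0 ≤ S * (Real.log x₁ ^ A / 2) := by positivity
  refine ⟨C + 163 + S * (Real.log x₁ ^ A / 2), fun x hx q hq a => ?_⟩
  have hl : 0 < Real.log x := Real.log_pos (by linarith)
  have hpos : 0 ≤ x / Real.log x ^ A := by positivity
  rcases le_or_gt x₁ x with hxx | hxx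
  · exact (hx₀ x ((le_max_left _ _).trans hxx) q hq a).trans
      (mul_le_mul_of_nonneg_right (by linarith) hpos)
  · have h2 : 2 * ∑ n ∈ Icc 1 ⌊x⌋₊, ‖h n‖ ≤ S := by
      rw [hS]
      refine mul_le_mul_of_nonneg_left ?_ (by norm_num)
      exact sum_le_sum_of_subset_of_nonneg (Icc_subset_Icc_right (Nat.floor_mono hxx.le))
        fun _ _ _ => norm_nonneg _
    have h3 : 1 ≤ (Real.log x₁ ^ A / 2) * (x / Real.log x ^ A) := by
      have : Real.log x ^ A ≤ Real.log x₁ ^ A :=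
        Real.rpow_le_rpow hl.le (Real.log_le_log (by linarith) hxx.le) hA.le
      rw [div_mul_div_comm, le_div_iff₀ (by positivity), one_mul]
      nlinarith [Real.rpow_nonneg hl.le A]
    calc ‖discrepancy h x q a‖ ≤ S := (norm_discrepancy_le_sum h x q a).trans h2
      _ ≤ S * ((Real.log x₁ ^ A / 2) * (x / Real.log x ^ A)) := le_mul_of_one_le_right hS0 h3
      _ = S * (Real.log x₁ ^ A / 2) * (x / Real.log x ^ A) := by ring
      _ ≤ _ := mul_le_mul_of_nonneg_right (by linarith) hpos

/-! ### Functions supported on primes, and negligible functions. -/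

lemma restrictPrimes_of_prime (f : ℕ → ℂ) {n : ℕ} (hn : n.Prime) : restrictPrimes f n = f n :=
  Set.indicator_of_mem (s := {p : ℕ | p.Prime}) hn f

lemma restrictPrimes_of_not_prime (f : ℕ → ℂ) {n : ℕ} (hn : ¬ n.Prime) :
    restrictPrimes f n = 0 :=
  Set.indicator_of_notMem (s := {p : ℕ | p.Prime}) hn f

lemma norm_restrictPrimes_le {f : ℕ → ℂ} (hf : ∀ n, ‖f n‖ ≤ 1) (n : ℕ) :
    ‖restrictPrimes f n‖ ≤ 1 := by
  by_cases hn : n.Prime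
  · rw [restrictPrimes_of_prime f hn]; exact hf n
  · rw [restrictPrimes_of_not_prime f hn]; simp

lemma SiegelWalfiszCriterion.characterSumBound_restrictPrimes {f : ℕ → ℂ} (hf : ∀ n, ‖f n‖ ≤ 1)
    (hS : SiegelWalfiszCriterion (restrictPrimes f)) :
    CharacterSumBound (restrictPrimes f) := by
  intro A hA
  obtain ⟨C, hC0, hC⟩ := hS.norm_character_sum_le hA
  refine ⟨C + (4 * A) ^ A, by positivity, fun y hy r hr χ hχ m hm => ?_⟩
  have hl : 0 < Real.log y := Real.log_pos (by linarith)
  have hr1 : (1 : ℝ) ≤ r := by exact_mod_cast hr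
  have hd2 : (1 : ℝ) ≤ (#m.divisors : ℝ) ^ 2 := one_le_card_divisors_sq hm
  have hp : 0 ≤ y / Real.log y ^ A := by positivity
  have h1 : (1 : ℝ) ≤ (4 * A) ^ A * (y / Real.log y ^ A) :=
    (Real.one_le_rpow (by linarith) (by norm_num)).trans (rpow_three_quarters_le hA hy)
  have h2 := Finset.sum_filter_add_sum_filter_not (Icc 1 ⌊y⌋₊) (fun n => n.Coprime m)
    (fun n => restrictPrimes f n * χ n)
  -- A prime not coprime to m divides m, so at most d(m) terms are removed.
  have h3 : ‖∑ n ∈ Icc 1 ⌊y⌋₊ with ¬ n.Coprime m, restrictPrimes f n * χ n‖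
      ≤ (#m.divisors : ℝ) := by
    have h4 : ∑ n ∈ Icc 1 ⌊y⌋₊ with ¬ n.Coprime m, restrictPrimes f n * χ n
        = ∑ n ∈ (Icc 1 ⌊y⌋₊).filter (fun n => ¬ n.Coprime m) with n.Prime,
          restrictPrimes f n * χ n := by
      symm
      refine Finset.sum_filter_of_ne fun n _ hne => ?_
      by_contra hn
      exact hne (by rw [restrictPrimes_of_not_prime f hn, zero_mul])
    rw [h4]
    calc _ ≤ ∑ n ∈ (Icc 1 ⌊y⌋₊).filter (fun n => ¬ n.Coprime m) with n.Prime, (1 : ℝ) := by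
          refine (_root_.norm_sum_le _ _).trans (sum_le_sum fun n _ => ?_)
          rw [norm_mul]
          exact mul_le_one₀ (norm_restrictPrimes_le hf n) (norm_nonneg _)
            (DirichletCharacter.norm_le_one χ _)
      _ ≤ _ := by
          rw [Finset.sum_const, nsmul_eq_mul, mul_one]
          refine Nat.cast_le.mpr (card_le_card fun n hn => ?_)
          rw [mem_filter, mem_filter] at hn
          refine Nat.mem_divisors.mpr ⟨?_, by omega⟩
          by_contra h
          exact hn.1.2 ((Nat.Prime.coprime_iff_not_dvd hn.2).mpr h)
  have h5 : (#m.divisors : ℝ) ≤ (#m.divisors : ℝ) ^ 2 := by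
    have : 1 ≤ #m.divisors := Finset.card_pos.mpr ⟨1, Nat.one_mem_divisors.mpr (by omega)⟩
    exact_mod_cast Nat.le_self_pow (by norm_num) _
  rw [eq_sub_of_add_eq h2]
  calc _ ≤ C * r * (y / Real.log y ^ A) + (#m.divisors : ℝ) ^ 2 :=
        (norm_sub_le _ _).trans (add_le_add (hC y hy r hr χ hχ) (h3.trans h5))
    _ ≤ C * r * (y / Real.log y ^ A) * (#m.divisors : ℝ) ^ 2
        + (#m.divisors : ℝ) ^ 2 * (r * ((4 * A) ^ A * (y / Real.log y ^ A))) :=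
        add_le_add (le_mul_of_one_le_right (by positivity) hd2)
          (le_mul_of_one_le_right (by positivity) (one_le_mul_of_one_le_of_one_le hr1 h1))
    _ = _ := by ring

lemma BVBound.add {h k : ℕ → ℂ} {A : ℝ} (hh : BVBound h A) (hk : BVBound k A) :
    BVBound (fun n => h n + k n) A := by
  obtain ⟨B, C, hB, hC, hev⟩ := hk
  refine hh.of_le (B₀ := B) (C₀ := C) ?_
  filter_upwards [hev] with x hx Q hQ
  exact (totalDiscrepancy_add_le h k x Q).trans (add_le_add le_rfl (hx Q hQ))

lemma BVBound.neg {h : ℕ → ℂ} {A : ℝ} (hh : BVBound h A) : BVBound (fun n => -h n) A := by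
  obtain ⟨B, C, hB, hC, hev⟩ := hh
  refine ⟨B, C, hB, hC, ?_⟩
  filter_upwards [hev] with x hx Q hQ
  rw [totalDiscrepancy_neg]
  exact hx Q hQ

/-- With Q ≤ √x/(log x)^(|A| + 1), even Q times the total mass is small enough. -/
lemma BVBound.of_small {w : ℕ → ℂ}
    (hw : ∀ y : ℝ, 2 ≤ y → ∑ n ∈ Icc 1 ⌊y⌋₊, ‖w n‖ ≤ 2 * √y * Real.log y) (A : ℝ) :
    BVBound w A := by
  refine BVBound.mono (A' := |A|) ?_ (le_abs_self A)
  refine ⟨|A| + 1, 4, by positivity, by norm_num, ?_⟩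
  filter_upwards [eventually_ge_atTop 2] with x hx Q hQ
  have hl : 0 < Real.log x := Real.log_pos (by linarith)
  have hx0 : 0 ≤ x := by linarith
  refine (totalDiscrepancy_le_card_mul w x Q).trans ?_
  calc _ ≤ √x / Real.log x ^ (|A| + 1) * (2 * (2 * √x * Real.log x)) := by
        gcongr
        exact hw x hx
    _ = 4 * (√x * √x / (Real.log x ^ (|A| + 1) / Real.log x)) := by field_simp; ring
    _ = _ := by
        rw [Real.mul_self_sqrt hx0, Real.rpow_add hl, Real.rpow_one,
          mul_div_cancel_right₀ _ hl.ne']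

/-! ### Coefficient identities for the class 𝒞. -/

lemma eq_of_LSeries_eq {u v : ℕ → ℂ} (hu : ∀ s : ℂ, 1 < s.re → LSeriesSummable u s)
    (hv : ∀ s : ℂ, 1 < s.re → LSeriesSummable v s)
    (h : ∀ s : ℂ, 1 < s.re → LSeries u s = LSeries v s) {n : ℕ} (hn : n ≠ 0) : u n = v n := by
  have habs : ∀ w : ℕ → ℂ, (∀ s : ℂ, 1 < s.re → LSeriesSummable w s) →
      LSeries.abscissaOfAbsConv w < ⊤ := fun w hw =>
    (LSeries.abscissaOfAbsConv_le_of_forall_lt_LSeriesSummable (x := 1)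
      fun y hy => hw y (by simpa using hy)).trans_lt (EReal.coe_lt_top 1)
  refine LSeries.eq_of_LSeries_eventually_eq (habs u hu) (habs v hv) ?_ hn
  filter_upwards [eventually_gt_atTop 1] with x hx
  exact h x (by simpa using hx)

lemma IsClassC.mul_eq_one {f g : ArithmeticFunction ℂ} (hf : IsClassC f) (hg : IsClassC g)
    (hfg : ∀ s : ℂ, 1 < s.re → LSeries f s * LSeries g s = 1) : f * g = 1 := by
  ext n
  rcases eq_or_ne n 0 with rfl | hn
  · simp
  have h1 : ∀ s : ℂ, LSeriesSummable (fun n => (1 : ArithmeticFunction ℂ) n) s := by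
    intro s
    rw [ArithmeticFunction.one_eq_delta]
    refine summable_of_ne_finset_zero (s := {1}) fun n hn => ?_
    rcases eq_or_ne n 0 with rfl | h0
    · simp
    · simp only [mem_singleton] at hn
      simp [LSeries.term_of_ne_zero h0, LSeries.delta, hn]
  refine eq_of_LSeries_eq (u := fun n => (f * g) n)
    (v := fun n => (1 : ArithmeticFunction ℂ) n)
    (fun s hs => ArithmeticFunction.LSeriesSummable_mul (hf.summable s hs) (hg.summable s hs))
    (fun s _ => h1 s) (fun s hs => ?_) hn
  rw [ArithmeticFunction.LSeries_mul' (hf.summable s hs) (hg.summable s hs),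
    ArithmeticFunction.one_eq_delta, LSeries_delta]
  exact hfg s hs

/-- The function `n ↦ f n * log n`. -/
def mulLog (f : ArithmeticFunction ℂ) : ArithmeticFunction ℂ :=
  ⟨fun n => f n * (Real.log n : ℝ), by simp⟩

lemma mulLog_apply (f : ArithmeticFunction ℂ) (n : ℕ) : mulLog f n = f n * (Real.log n : ℝ) := rfl

/-- Clears the denominator in -F'/F and compares coefficients; nonvanishing of F is needed because
division by zero would lose the information. -/
lemma IsClassC.exists_mul_eq_mulLog {f : ArithmeticFunction ℂ} (hf : IsClassC f)
    (hne : ∀ s : ℂ, 1 < s.re → LSeries f s ≠ 0) :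
    ∃ L : ArithmeticFunction ℂ, (∀ n, ‖L n‖ ≤ ArithmeticFunction.vonMangoldt n) ∧
      L * f = mulLog f := by
  obtain ⟨l, hl, hle⟩ := hf.exists_vonMangoldt
  have hl0 : l 0 = 0 := by
    have := hle 0
    rw [ArithmeticFunction.map_zero] at this
    exact norm_le_zero_iff.mp this
  let L : ArithmeticFunction ℂ := ⟨l, hl0⟩
  refine ⟨L, hle, ?_⟩
  have habs : LSeries.abscissaOfAbsConv f ≤ (1 : ℝ) :=
    LSeries.abscissaOfAbsConv_le_of_forall_lt_LSeriesSummable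
      fun y hy => hf.summable y (by simpa using hy)
  have hlt : ∀ s : ℂ, 1 < s.re → LSeries.abscissaOfAbsConv f < s.re := fun s hs =>
    habs.trans_lt (by exact_mod_cast hs)
  have hlogMul : (fun n => mulLog f n) = LSeries.logMul f := by
    funext n
    rw [mulLog_apply, LSeries.logMul, Complex.natCast_log, mul_comm]
  ext n
  rcases eq_or_ne n 0 with rfl | hn
  · simp
  have hL : ∀ s : ℂ, 1 < s.re → LSeriesSummable (fun n => L n) s := fun s hs =>
    (hl s hs).LSeriesSummable
  refine eq_of_LSeries_eq (u := fun n => (L * f) n) (v := fun n => mulLog f n)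
    (fun s hs => ArithmeticFunction.LSeriesSummable_mul (hL s hs) (hf.summable s hs))
    (fun s hs => ?_) (fun s hs => ?_) hn
  · rw [hlogMul]
    exact LSeriesSummable_logMul_of_lt_re (hlt s hs)
  · rw [ArithmeticFunction.LSeries_mul' (hL s hs) (hf.summable s hs), hlogMul]
    have h1 : LSeries (fun n => L n) s = -deriv (LSeries f) s / LSeries f s :=
      (hl s hs).LSeries_eq
    rw [h1, LSeries_deriv (hlt s hs), neg_neg]
    exact div_mul_cancel₀ _ (hne s hs)

lemma eq_zero_of_norm_le_vonMangoldt {L : ℕ → ℂ}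
    (hL : ∀ n, ‖L n‖ ≤ ArithmeticFunction.vonMangoldt n) {n : ℕ}
    (hn : ArithmeticFunction.vonMangoldt n = 0) : L n = 0 :=
  norm_le_zero_iff.mp ((hL n).trans_eq hn)

/-- Strong induction: |f(n)| log n ≤ ∑_{d ∣ n} Λ(d)|f(n/d)| ≤ ∑_{d ∣ n} Λ(d) = log n. The term d =
1, which contains f(n) itself, drops out since Λ(1) = 0. -/
lemma norm_le_one_of_mul_eq_mulLog {f L : ArithmeticFunction ℂ} (hf : f.IsMultiplicative)
    (hL : ∀ n, ‖L n‖ ≤ ArithmeticFunction.vonMangoldt n) (hLf : L * f = mulLog f)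
    (n : ℕ) : ‖f n‖ ≤ 1 := by
  induction n using Nat.strong_induction_on with
  | _ n ih =>
    rcases Nat.lt_or_ge n 2 with hn | hn
    · interval_cases n
      · simp
      · simp [hf.map_one]
    have hlog : 0 < Real.log n := Real.log_pos (by exact_mod_cast hn)
    have h1 : ‖f n‖ * Real.log n ≤ Real.log n := by
      have h2 : (L * f) n = f n * (Real.log n : ℝ) := by rw [hLf, mulLog_apply]
      have h3 : ‖f n‖ * Real.log n = ‖(L * f) n‖ := by
        rw [h2, norm_mul, Complex.norm_real, Real.norm_of_nonneg hlog.le]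
      rw [h3, ArithmeticFunction.mul_apply, ← ArithmeticFunction.vonMangoldt_sum,
        ← Nat.sum_divisorsAntidiagonal (f := fun d _ => ArithmeticFunction.vonMangoldt d)]
      refine (norm_sum_le _ _).trans (sum_le_sum fun p hp => ?_)
      rw [Nat.mem_divisorsAntidiagonal] at hp
      rw [norm_mul]
      rcases eq_or_ne p.1 1 with hp1 | hp1
      · have h4 : L p.1 = 0 := eq_zero_of_norm_le_vonMangoldt hL (by rw [hp1]; simp)
        rw [h4, norm_zero, zero_mul]
        exact ArithmeticFunction.vonMangoldt_nonneg
      · have hp0 : p.1 ≠ 0 := fun h => hp.2 (by rw [← hp.1, h, zero_mul])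
        have hp2 : p.2 ≠ 0 := fun h => hp.2 (by rw [← hp.1, h, mul_zero])
        have hlt : p.2 < n := by
          rw [← hp.1]
          exact lt_mul_left (by omega) (by omega)
        exact (mul_le_of_le_one_right (norm_nonneg _) (ih p.2 hlt)).trans (hL _)
    exact le_of_mul_le_mul_right (by simpa using h1) hlog

lemma apply_prime_of_mul_eq_mulLog {f L : ArithmeticFunction ℂ} (hf : f.IsMultiplicative)
    (hL : ∀ n, ‖L n‖ ≤ ArithmeticFunction.vonMangoldt n) (hLf : L * f = mulLog f)
    {p : ℕ} (hp : p.Prime) : L p = f p * (Real.log p : ℝ) := by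
  have h1 : (L * f) p = f p * (Real.log p : ℝ) := by rw [hLf, mulLog_apply]
  have h2 : L 1 = 0 := eq_zero_of_norm_le_vonMangoldt hL (by simp)
  rw [ArithmeticFunction.mul_apply, Nat.sum_divisorsAntidiagonal (f := fun a b => L a * f b),
    hp.sum_divisors, Nat.div_self hp.pos, h2, hf.map_one, zero_mul, add_zero, mul_one] at h1
  exact h1

lemma norm_le_log_of_norm_le_vonMangoldt {L : ArithmeticFunction ℂ}
    (hL : ∀ n, ‖L n‖ ≤ ArithmeticFunction.vonMangoldt n) (n : ℕ) : ‖L n‖ ≤ 1 + Real.log n :=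
  (hL n).trans (ArithmeticFunction.vonMangoldt_le_log.trans (by linarith))

/-- Prime powers are compared with ψ(y) - θ(y). -/
lemma sum_norm_not_prime_le {L : ArithmeticFunction ℂ}
    (hL : ∀ n, ‖L n‖ ≤ ArithmeticFunction.vonMangoldt n) {y : ℝ} (hy : 2 ≤ y) :
    ∑ n ∈ Icc 1 ⌊y⌋₊, ‖if n.Prime then 0 else L n‖ ≤ 2 * √y * Real.log y := by
  refine le_trans ?_ (Chebyshev.psi_sub_theta_le (x := y) (by linarith))
  rw [Chebyshev.psi_sub_theta_eq_sum_not_prime, Finset.sum_filter]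
  have h1 : Icc 1 ⌊y⌋₊ = Ioc 0 ⌊y⌋₊ := by
    ext n; simp [Nat.succ_le_iff]
  rw [h1]
  refine sum_le_sum fun n _ => ?_
  by_cases hn : n.Prime
  · simp [hn]
  · simpa [hn] using hL n

lemma eq_restrictPrimes_mul_log_add {f L : ArithmeticFunction ℂ} (hf : f.IsMultiplicative)
    (hL : ∀ n, ‖L n‖ ≤ ArithmeticFunction.vonMangoldt n) (hLf : L * f = mulLog f)
    (n : ℕ) :
    L n = restrictPrimes f n * (Real.log n : ℝ) + if n.Prime then 0 else L n := by
  by_cases hn : n.Prime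
  · rw [restrictPrimes_of_prime _ hn, if_pos hn, add_zero,
      apply_prime_of_mul_eq_mulLog hf hL hLf hn]
  · rw [restrictPrimes_of_not_prime _ hn, if_neg hn, zero_mul, zero_add]

/-- At a prime p the identity f * g = 1 reads f(p) + g(p) = 0. -/
lemma restrictPrimes_eq_neg {f g : ArithmeticFunction ℂ} (hf : f.IsMultiplicative)
    (hg : g.IsMultiplicative) (hfg : f * g = 1) :
    restrictPrimes g = fun n => -restrictPrimes f n := by
  funext n
  by_cases hn : n.Prime
  · rw [restrictPrimes_of_prime _ hn, restrictPrimes_of_prime _ hn]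
    have h1 : (f * g) n = 0 := by
      rw [hfg, ArithmeticFunction.one_apply_ne hn.one_lt.ne']
    rw [ArithmeticFunction.mul_apply, Nat.sum_divisorsAntidiagonal (f := fun a b => f a * g b),
      hn.sum_divisors, Nat.div_self hn.pos, Nat.div_one, hf.map_one, hg.map_one, one_mul,
      mul_one] at h1
    exact eq_neg_of_add_eq_zero_right h1
  · rw [restrictPrimes_of_not_prime _ hn, restrictPrimes_of_not_prime _ hn, neg_zero]

lemma norm_le_one_add_log {h : ℕ → ℂ} (hh : ∀ n, ‖h n‖ ≤ 1) (n : ℕ) : ‖h n‖ ≤ 1 + Real.log n := by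
  have := Real.log_natCast_nonneg n
  linarith [hh n]

lemma norm_mul_log_le {h : ℕ → ℂ} (hh : ∀ n, ‖h n‖ ≤ 1) (n : ℕ) :
    ‖h n * (Real.log n : ℝ)‖ ≤ 1 + Real.log n := by
  have h0 := Real.log_natCast_nonneg n
  rw [norm_mul, Complex.norm_real, Real.norm_of_nonneg h0]
  have := mul_le_of_le_one_left h0 (hh n)
  linarith

/-! ### The two implications. -/

/-- The starting point of the bootstrapping: the trivial bound is x(log x)³ up to a constant. -/
lemma bvBound_neg_three {h : ℕ → ℂ} (hh : ∀ n, ‖h n‖ ≤ 1) : BVBound h (-3) := by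
  refine ⟨0, 18, le_rfl, by norm_num, ?_⟩
  filter_upwards [eventually_log_ge 1, eventually_ge_atTop 1] with x hlog hx Q hQ
  rw [Real.rpow_zero, div_one] at hQ
  have hl : 0 < Real.log x := by linarith
  refine (totalDiscrepancy_trivial (fun n _ => norm_le_one_add_log hh n) hx hlog (by linarith)
    le_rfl hQ).trans ?_
  have h1 : √x ≤ x := by
    rw [Real.sqrt_le_left (by linarith)]
    exact le_self_pow₀ hx (by norm_num)
  have h2 : Real.log x ≤ Real.log x ^ 3 := le_self_pow₀ hlog (by norm_num)
  have h3 : Real.log x * √x ≤ Real.log x ^ 3 * x := by gcongr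
  rw [Real.rpow_neg hl.le, div_inv_eq_mul]
  norm_cast
  linarith

lemma bvBound_mul_log {h : ℕ → ℂ} (hh : ∀ n, ‖h n‖ ≤ 1) (hB : ∀ A, BVBound h A) (A : ℝ) :
    BVBound (fun n => h n * (Real.log n : ℝ)) A :=
  ((hB (A + 1)).uniform fun n _ => norm_le_one_add_log hh n).mul_log

/-- The Bombieri–Vinogradov Hypothesis for a multiplicative function and its Dirichlet inverse
implies the one for its restriction to the primes. -/
theorem hypothesis_restrictPrimes {f g L : ArithmeticFunction ℂ} (hf : f.IsMultiplicative)
    (hg : g.IsMultiplicative) (hfg : f * g = 1) (hf1 : ∀ n, ‖f n‖ ≤ 1) (hg1 : ∀ n, ‖g n‖ ≤ 1)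
    (hL : ∀ n, ‖L n‖ ≤ ArithmeticFunction.vonMangoldt n) (hLf : L * f = mulLog f)
    (hBf : BombieriVinogradovHypothesis f) (hBg : BombieriVinogradovHypothesis g) :
    BombieriVinogradovHypothesis (restrictPrimes f) := by
  have hSf : CharacterSumBound f := (hBf.siegelWalfisz hf1).characterSumBound hf hg
    (by rw [mul_comm, hfg]) hf1 hg1
  have hSg : CharacterSumBound g := (hBg.siegelWalfisz hg1).characterSumBound hg hf hfg hg1 hf1
  have hconv : ∀ A, BVBound L A := by
    intro A
    have h1 : (L : ℕ → ℂ) = dirichletConv (fun n => f n * (Real.log n : ℝ)) g := by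
      have h2 : L = mulLog f * g := by rw [← hLf, mul_assoc, hfg, mul_one]
      funext n
      rw [h2, ArithmeticFunction.mul_apply]
      rfl
    -- The exponent A + 1/2 compensates the loss in the convolution.
    have h3 := BVUniform.dirichletConv (A := A + 1 / 2) (fun n _ => norm_mul_log_le hf1 n)
      (fun n _ => norm_le_one_add_log hg1 n) (hSf.mul_log hf1) hSg
      ((bvBound_mul_log hf1 (bvBound_of_hypothesis hBf) _).uniform fun n _ => norm_mul_log_le hf1 n)
      ((bvBound_of_hypothesis hBg _).uniform fun n _ => norm_le_one_add_log hg1 n)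
    rw [add_sub_cancel_right, ← h1] at h3
    exact h3
  have hP1 := norm_restrictPrimes_le hf1
  have hlog : ∀ A, BVBound (fun n => restrictPrimes f n * (Real.log n : ℝ)) A := by
    intro A
    have h1 : (fun n => restrictPrimes f n * ((Real.log n : ℝ) : ℂ))
        = fun n => L n + -(if n.Prime then 0 else L n) := by
      funext n
      have h2 := eq_restrictPrimes_mul_log_add hf hL hLf n
      linear_combination -h2
    rw [h1]
    exact (hconv A).add (BVBound.of_small (fun y hy => sum_norm_not_prime_le hL hy) A).neg
  refine hypothesis_of_bvBound fun A _ => ?_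
  have h1 := ((hlog A).uniform fun n _ => norm_mul_log_le hP1 n).div_log
  convert h1 using 1
  funext n
  by_cases hn : n.Prime
  · have h2 : Real.log n ≠ 0 := (Real.log_pos (by exact_mod_cast hn.one_lt)).ne'
    rw [mul_assoc, ← Complex.ofReal_mul, mul_one_div_cancel h2, Complex.ofReal_one, mul_one]
  · rw [restrictPrimes_of_not_prime _ hn, zero_mul, zero_mul]

/-- The Bombieri–Vinogradov Hypothesis on primes and the Siegel–Walfisz criterion imply the
Bombieri–Vinogradov Hypothesis. -/
theorem hypothesis_of_restrictPrimes {f g L : ArithmeticFunction ℂ} (hf : f.IsMultiplicative)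
    (hg : g.IsMultiplicative) (hfg : f * g = 1) (hf1 : ∀ n, ‖f n‖ ≤ 1) (hg1 : ∀ n, ‖g n‖ ≤ 1)
    (hL : ∀ n, ‖L n‖ ≤ ArithmeticFunction.vonMangoldt n) (hLf : L * f = mulLog f)
    (hB : BombieriVinogradovHypothesis (restrictPrimes f)) (hS : SiegelWalfiszCriterion f) :
    BombieriVinogradovHypothesis f := by
  have hP1 := norm_restrictPrimes_le hf1
  have hLeq : (L : ℕ → ℂ) = fun n => restrictPrimes f n * (Real.log n : ℝ)
      + if n.Prime then 0 else L n :=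
    funext fun n => eq_restrictPrimes_mul_log_add hf hL hLf n
  -- Character sums of `L` need no further assumption: `hB` already yields the Siegel–Walfisz
  -- criterion on primes.
  have hSL : CharacterSumBound L := by
    rw [hLeq]
    exact (((hB.siegelWalfisz hP1).characterSumBound_restrictPrimes hf1).mul_log hP1).add_small
      fun y hy => sum_norm_not_prime_le hL hy
  have hBL : ∀ A, BVBound L A := by
    intro A
    rw [hLeq]
    exact (bvBound_mul_log hP1 (bvBound_of_hypothesis hB) A).add
      (BVBound.of_small (fun y hy => sum_norm_not_prime_le hL hy) A)
  have hSf : CharacterSumBound f := hS.characterSumBound hf hg (by rw [mul_comm, hfg]) hf1 hg1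
  have hf2 : ∀ n : ℕ, 1 ≤ n → ‖f n‖ ≤ 1 + Real.log n := fun n _ => norm_le_one_add_log hf1 n
  have hL2 : ∀ n : ℕ, 1 ≤ n → ‖L n‖ ≤ 1 + Real.log n :=
    fun n _ => norm_le_log_of_norm_le_vonMangoldt hL n
  -- The convolution L * f = f·log costs 1/2 in the exponent and removing the logarithm gains 1.
  have hstep : ∀ A, BVBound f A → BVBound f (A + 1 / 2) := by
    intro A hA
    have h1 := BVUniform.dirichletConv hL2 hf2 hSL hSf ((hBL A).uniform hL2) (hA.uniform hf2)
    have h2 : dirichletConv L f = fun n => f n * ((Real.log n : ℝ) : ℂ) := by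
      funext n
      rw [← mulLog_apply, ← hLf, ArithmeticFunction.mul_apply]
      rfl
    rw [h2] at h1
    have h3 := (((hA.mono (by linarith : A - 1 / 2 ≤ A)).uniform hf2).of_mul_log h1)
    convert h3 using 1
    ring
  have hall : ∀ n : ℕ, BVBound f (n / 2 - 3) := by
    intro n
    induction n with
    | zero => simpa using bvBound_neg_three hf1
    | succ n ih =>
      have := hstep _ ih
      convert this using 1
      push_cast
      ring
  refine hypothesis_of_bvBound fun A _ => ?_
  obtain ⟨n, hn⟩ := exists_nat_ge (2 * (A + 3))
  exact (hall n).mono (by linarith)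

end

theorem theorem1p1 (f g : ArithmeticFunction ℂ) (hf : IsClassC f) (hg : IsClassC g)
    (hfg : ∀ s : ℂ, 1 < s.re → LSeries f s * LSeries g s = 1) :
    (BombieriVinogradovHypothesis f → BombieriVinogradovHypothesis g →
      BombieriVinogradovHypothesis (restrictPrimes f)) ∧
    (BombieriVinogradovHypothesis (restrictPrimes f) → SiegelWalfiszCriterion f →
      BombieriVinogradovHypothesis f) ∧
    ((BombieriVinogradovHypothesis f ∧ BombieriVinogradovHypothesis g) ↔
      (BombieriVinogradovHypothesis (restrictPrimes f) ∧
        SiegelWalfiszCriterion f ∧ SiegelWalfiszCriterion g)) := by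
  obtain ⟨Lf, hLf, hLf'⟩ := hf.exists_mul_eq_mulLog
    fun s hs => left_ne_zero_of_mul_eq_one (hfg s hs)
  obtain ⟨Lg, hLg, hLg'⟩ := hg.exists_mul_eq_mulLog
    fun s hs => right_ne_zero_of_mul_eq_one (hfg s hs)
  have hmf := hf.isMultiplicative
  have hmg := hg.isMultiplicative
  have hone : f * g = 1 := hf.mul_eq_one hg hfg
  have hone' : g * f = 1 := by rw [mul_comm, hone]
  have hf1 := norm_le_one_of_mul_eq_mulLog hmf hLf hLf'
  have hg1 := norm_le_one_of_mul_eq_mulLog hmg hLg hLg'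
  have ha := hypothesis_restrictPrimes hmf hmg hone hf1 hg1 hLf hLf'
  have hb := hypothesis_of_restrictPrimes hmf hmg hone hf1 hg1 hLf hLf'
  refine ⟨ha, hb, fun h => ⟨ha h.1 h.2, h.1.siegelWalfisz hf1, h.2.siegelWalfisz hg1⟩,
    fun h => ⟨hb h.1 h.2.1, ?_⟩⟩
  -- The second implication with f and g exchanged; its hypothesis on primes follows from that for f
  -- by a change of sign.
  refine hypothesis_of_restrictPrimes hmg hmf hone' hg1 hf1 hLg hLg' ?_ h.2.2
  rw [restrictPrimes_eq_neg hmf hmg hone]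
  exact hypothesis_of_bvBound fun A _ => (bvBound_of_hypothesis h.1 A).neg
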